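/- Let $p,q\ge 0$, $\mathbb{R}^{p,q}=\mathbb{R}^p\times\mathbb{R}_{\ge 0}^q$ and $\square^{a,b}=(-1,1)^a\times[0,1)^b$. For $Q\subseteq\{1,\dots,q\}$ let $\square^{p,Q}=(-1,1)^p\times\prod_{j=1}^q\delta_j$ with $\delta_j=[0,1)$ if $j\in Q$ and $\delta_j=(-1,1)$ otherwise; a permutation of coordinates identifies it with $\square^{p+q-|Q|,|Q|}$. Let $\iota_Q\colon\square^{p,Q}\to\mathbb{R}^{p,q}$ be the open embedding which translates the $j$-th of the last $q$ coordinates by $1$ for each $j\notin Q$. * The generalized Swiss-cheese operad $\mathbb{E}_{p,q}$ is the coloured operad in topological spaces whose colours are the subsets of $\{1,\dots,q\}$, and whose operations $(Q_i)_{i\in I}\to Q$ are the families of open rectilinear maps $f_i\colon\square^{p,Q_i}\to\square^{p,Q}$ (restrictions of $x\mapsto(\lambda_kx_k+v_k)_k$ with all $\lambda_k>0$) which are jointly injective on $\bigsqcup_i\square^{p,Q_i}$, with the compact-open topology; there are none unless $Q_i\subseteq Q$ for all $i$. * The little $\mathbb{R}^{p,q}$-discs operad $\mathcal{E}_{\mathbb{R}^{p,q}}$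 has as colours the pairs $(\square^{a,b},\iota)$ with $\iota\colon\square^{a,b}\to\mathbb{R}^{p,q}$ a smooth open embedding, and as spaces of operations $(\square^{a_i,b_i},\iota_i)_{i\in I}\to(\square^{a,b},\iota)$ the homotopy fibres over $(\iota_i)_i$ of $$\mathrm{Emb}\Big(\bigsqcup_i\square^{a_i,b_i},\square^{a,b}\Big)\to\prod_i\mathrm{Emb}(\square^{a_i,b_i},\mathbb{R}^{p,q}),\qquad (f_i)_i\mapsto(\iota\circ f_i)_i .$$ Here $\mathrm{Emb}$ is the space of smooth open embeddings with the weak $C^\infty$-topology, and homotopy fibres are formed with Moore paths, so that composition is strictly associative: an operation is a jointly injective family $(f_i)_i$ together with Moore paths from $\iota_i$ to $\iota\circ f_i$. * Let $\widetilde{\mathbb{E}}_{p,q}$ be the operad with the colours of $\mathbb{E}_{p,q}$, whose operations $(Q_i)_i\to Q$ are operations $(f_i)_i$ of $\mathbb{E}_{p,q}$ together with Moore paths from $\iota_{Q_i}$ to $\iota_Q\circ f_i$ in the spaces of open rectilinear maps $\square^{p,Q_i}\to\mathbb{R}^{p,q}$. Forgetting the paths, respectively regarding rectilinear maps as smooth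 embeddings and sending $Q$ to $(\square^{p,Q},\iota_Q)$, gives morphisms of topological operads $$\mathbb{E}_{p,q}\longleftarrow\widetilde{\mathbb{E}}_{p,q}\longrightarrow\mathcal{E}_{\mathbb{R}^{p,q}} .$$ The canonical map $\mathbb{E}_{p,q}\to\mathcal{E}_{\mathbb{R}^{p,q}}$ is the resulting map in the homotopy category of topological operads; on spaces of operations it is given by $(f_i)_i\mapsto(f_i,\text{straight-line path from }\iota_{Q_i}\text{ to }\iota_Q\circ f_i)_i$. **Proposition.** The canonical map $\mathbb{E}_{p,q}\to\mathcal{E}_{\mathbb{R}^{p,q}}$ is an equivalence of topological operads. That is, both morphisms above are equivalences (weak homotopy equivalences on all spaces of operations, and essentially surjective on colours up to isomorphism in the homotopy category of unary operations), and for all finite families $(Q_i)_{i\in I}$ and all $Q$ the map $$\mathbb{E}_{p,q}\big((Q_i)_i;Q\big)\to\mathcal{E}_{\mathbb{R}^{p,q}}\big((\square^{p,Q_i},\iota_{Q_i})_i;(\square^{p,Q},\iota_Q)\big),\quad (f_i)_i\mapsto(f_i,\text{straight-line paths}),$$ is a weak homotopy equivalence. -/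

import Mathlib

open Set Topology
open scoped ContDiff NNReal

noncomputable section

namespace LittleCubes

/-! ### Weak homotopy equivalences -/

section WeakEquivalence

variable {X Y : Type*} [TopologicalSpace X] [TopologicalSpace Y]

/-- The map induced by a continuous map on sets of path components. -/
def mapPi0 (f : C(X, Y)) : ZerothHomotopy X → ZerothHomotopy Y :=
  Quotient.map' f fun _ _ h => h.map f.continuous

/-- Postcomposition of an `n`-dimensional based loop with a continuous map. -/
def mapGenLoop (n : ℕ) (f : C(X, Y)) (x : X) (γ : GenLoop (Fin n) X x) :
    GenLoop (Fin n) Y (f x) :=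
  ⟨f.comp γ.1, fun t ht => congrArg f (γ.2 t ht)⟩

/-- The map induced by a continuous map on homotopy groups. -/
def mapPi (n : ℕ) (f : C(X, Y)) (x : X) :
    HomotopyGroup (Fin n) X x → HomotopyGroup (Fin n) Y (f x) :=
  Quotient.map' (mapGenLoop n f x) fun _ _ h =>
    ContinuousMap.HomotopicRel.comp_continuousMap h f

/-- Weak homotopy equivalences: bijective on path components, and on all homotopy groups at all
base points. -/
structure IsWeakHomotopyEquiv (f : C(X, Y)) : Prop where
  bijective_pi0 : Function.Bijective (mapPi0 f)
  bijective_pi : ∀ (n : ℕ) (x : X), 1 ≤ n → Function.Bijective (mapPi n f x)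

end WeakEquivalence

/-! ### Coloured symmetric operads in topological spaces -/

/-- Coloured symmetric operads in topological spaces. Inputs are indexed by arbitrary finite
types, and `reindex` is the action of bijections between finite types. -/
structure TopOperad where
  Color : Type
  Mul : {I : Type} → [Finite I] → (I → Color) → Color → Type
  topology : ∀ {I : Type} [Finite I] (x : I → Color) (y : Color), TopologicalSpace (Mul x y)
  one : ∀ c : Color, Mul (fun _ : Unit => c) c
  reindex : ∀ {I I' : Type} [Finite I] [Finite I'] (e : I' ≃ I) {x : I → Color} {y : Color},
    Mul x y → Mul (fun i => x (e i)) y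
  comp : ∀ {J : Type} [Finite J] {I : J → Type} [∀ j, Finite (I j)]
    {x : ∀ j, I j → Color} {y : J → Color} {z : Color},
    Mul y z → (∀ j, Mul (x j) (y j)) → Mul (fun s : Σ j, I j => x s.1 s.2) z
  continuous_reindex : ∀ {I I' : Type} [Finite I] [Finite I'] (e : I' ≃ I) {x : I → Color}
    {y : Color}, Continuous (reindex e : Mul x y → _)
  continuous_comp : ∀ {J : Type} [Finite J] {I : J → Type} [∀ j, Finite (I j)]
    {x : ∀ j, I j → Color} {y : J → Color} {z : Color},
    Continuous fun t : Mul y z × (∀ j, Mul (x j) (y j)) => comp t.1 t.2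
  reindex_refl : ∀ {I : Type} [Finite I] {x : I → Color} {y : Color} (f : Mul x y),
    reindex (Equiv.refl I) f = f
  reindex_trans : ∀ {I I' I'' : Type} [Finite I] [Finite I'] [Finite I''] (e : I' ≃ I)
    (e' : I'' ≃ I') {x : I → Color} {y : Color} (f : Mul x y),
    reindex (e'.trans e) f = reindex e' (reindex e f)
  comp_reindex_outer : ∀ {J J' : Type} [Finite J] [Finite J'] (e : J' ≃ J) {I : J → Type}
    [∀ j, Finite (I j)] {x : ∀ j, I j → Color} {y : J → Color} {z : Color}
    (g : Mul y z) (f : ∀ j, Mul (x j) (y j)),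
    comp (reindex e g) (fun j' => f (e j')) = reindex e.sigmaCongrLeft (comp g f)
  comp_reindex_inner : ∀ {J : Type} [Finite J] {I I' : J → Type} [∀ j, Finite (I j)]
    [∀ j, Finite (I' j)] (e : ∀ j, I' j ≃ I j) {x : ∀ j, I j → Color} {y : J → Color}
    {z : Color} (g : Mul y z) (f : ∀ j, Mul (x j) (y j)),
    comp g (fun j => reindex (e j) (f j)) = reindex (Equiv.sigmaCongrRight e) (comp g f)
  one_comp : ∀ {I : Type} [Finite I] {x : I → Color} {y : Color} (f : Mul x y),
    comp (one y) (fun _ => f) = reindex ((Equiv.sigmaEquivProd Unit I).trans (Equiv.punitProd I)) f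
  comp_one : ∀ {I : Type} [Finite I] {x : I → Color} {y : Color} (f : Mul x y),
    comp f (fun i => one (x i)) = reindex (Equiv.sigmaUnique I fun _ => Unit) f
  comp_assoc : ∀ {K : Type} [Finite K] {J : K → Type} [∀ k, Finite (J k)]
    {I : ∀ k, J k → Type} [∀ k j, Finite (I k j)] {x : ∀ k j, I k j → Color}
    {y : ∀ k, J k → Color} {z : K → Color} {w : Color}
    (h : Mul z w) (g : ∀ k, Mul (y k) (z k)) (f : ∀ k j, Mul (x k j) (y k j)),
    comp (comp h g) (fun s : Σ k, J k => f s.1 s.2) =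
      reindex (Equiv.sigmaAssoc I) (comp h fun k => comp (g k) (f k))

attribute [instance] TopOperad.topology

namespace TopOperad

/-- Composition of unary operations. -/
def comp₁ (P : TopOperad) {a b c : P.Color} (g : P.Mul (fun _ : Unit => b) c)
    (f : P.Mul (fun _ : Unit => a) b) : P.Mul (fun _ : Unit => a) c :=
  P.reindex (Equiv.sigmaUnique Unit fun _ => Unit).symm (P.comp g fun _ => f)

/-- Two colours are equivalent if they are isomorphic in the homotopy category of the category
of unary operations. -/
def ColorEquiv (P : TopOperad) (a b : P.Color) : Prop :=
  ∃ (f : P.Mul (fun _ : Unit => a) b) (g : P.Mul (fun _ : Unit => b) a),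
    Joined (P.comp₁ g f) (P.one a) ∧ Joined (P.comp₁ f g) (P.one b)

end TopOperad

/-- Morphisms of topological operads. -/
structure TopOperadHom (P Q : TopOperad) where
  onColor : P.Color → Q.Color
  onMul : ∀ {I : Type} [Finite I] (x : I → P.Color) (y : P.Color),
    C(P.Mul x y, Q.Mul (fun i => onColor (x i)) (onColor y))
  map_one : ∀ c, onMul _ _ (P.one c) = Q.one (onColor c)
  map_reindex : ∀ {I I' : Type} [Finite I] [Finite I'] (e : I' ≃ I) {x : I → P.Color}
    {y : P.Color} (f : P.Mul x y), onMul _ _ (P.reindex e f) = Q.reindex e (onMul _ _ f)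
  map_comp : ∀ {J : Type} [Finite J] {I : J → Type} [∀ j, Finite (I j)]
    {x : ∀ j, I j → P.Color} {y : J → P.Color} {z : P.Color}
    (g : P.Mul y z) (f : ∀ j, P.Mul (x j) (y j)),
    onMul _ _ (P.comp g f) = Q.comp (onMul _ _ g) fun j => onMul _ _ (f j)

/-- Equivalences of topological operads: weak homotopy equivalences on all spaces of
multimorphisms, and essentially surjective up to equivalence on colours. -/
structure TopOperadHom.IsEquivalence {P Q : TopOperad} (F : TopOperadHom P Q) : Prop where
  isWeakHomotopyEquiv : ∀ {I : Type} [Finite I] (x : I → P.Color) (y : P.Color),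
    IsWeakHomotopyEquiv (F.onMul x y)
  essSurj : ∀ d : Q.Color, ∃ c : P.Color, Q.ColorEquiv (F.onColor c) d

/-! ### Topological categories of spaces and their operads of embeddings -/

universe u v

/-- A topological category whose objects have underlying sets and whose morphisms are
(determined by) functions between them. -/
structure TopCategory where
  Obj : Type u
  carrier : Obj → Type
  Hom : Obj → Obj → Type
  topology : ∀ a b, TopologicalSpace (Hom a b)
  toFun : ∀ {a b}, Hom a b → carrier a → carrier b
  toFun_injective : ∀ {a b}, Function.Injective (toFun : Hom a b → carrier a → carrier b)
  id : ∀ a, Hom a a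
  comp : ∀ {a b c}, Hom b c → Hom a b → Hom a c
  toFun_id : ∀ a u, toFun (id a) u = u
  toFun_comp : ∀ {a b c} (g : Hom b c) (f : Hom a b) u, toFun (comp g f) u = toFun g (toFun f u)
  continuous_comp : ∀ {a b c}, Continuous fun t : Hom b c × Hom a b => comp t.1 t.2

attribute [instance] TopCategory.topology

namespace TopCategory

variable (D : TopCategory.{u}) {C : Type}

variable {D} in
theorem id_comp {a b : D.Obj} (f : D.Hom a b) : D.comp (D.id b) f = f :=
  D.toFun_injective (funext fun u => by rw [D.toFun_comp, D.toFun_id])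

variable {D} in
theorem comp_id {a b : D.Obj} (f : D.Hom a b) : D.comp f (D.id a) = f :=
  D.toFun_injective (funext fun u => by rw [D.toFun_comp, D.toFun_id])

variable {D} in
theorem comp_assoc {a b c d : D.Obj} (h : D.Hom c d) (g : D.Hom b c) (f : D.Hom a b) :
    D.comp (D.comp h g) f = D.comp h (D.comp g f) :=
  D.toFun_injective (funext fun u => by simp only [D.toFun_comp])

/-- The space of families of morphisms `x i ⟶ y` which are jointly injective as a map
`⨆ x i → y` from the disjoint union. -/
abbrev MultiHom {I : Type} (x : I → D.Obj) (y : D.Obj) : Type :=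
  {f : ∀ i, D.Hom (x i) y //
    Function.Injective fun s : Σ i, D.carrier (x i) => D.toFun (f s.1) s.2}

variable {D}

namespace MultiHom

/-- The identity as a family with one member. -/
def one (x : D.Obj) : D.MultiHom (fun _ : Unit => x) x :=
  ⟨fun _ => D.id x, by
    rintro ⟨⟨⟩, u⟩ ⟨⟨⟩, v⟩ h
    simp only [D.toFun_id] at h
    rw [h]⟩

/-- Reindexing a family along a bijection. -/
def reindex {I I' : Type} (e : I' ≃ I) {x : I → D.Obj} {y : D.Obj} (f : D.MultiHom x y) :
    D.MultiHom (fun i => x (e i)) y :=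
  ⟨fun i => f.1 (e i), by
    rintro ⟨i, u⟩ ⟨j, v⟩ h
    have h' := @f.2 ⟨e i, u⟩ ⟨e j, v⟩ h
    rw [Sigma.mk.injEq] at h'
    obtain ⟨h1, h2⟩ := h'
    obtain rfl := e.injective h1
    rw [eq_of_heq h2]⟩

/-- Composition of families. -/
def comp {J : Type} {I : J → Type} {x : ∀ j, I j → D.Obj} {y : J → D.Obj} {z : D.Obj}
    (g : D.MultiHom y z) (f : ∀ j, D.MultiHom (x j) (y j)) :
    D.MultiHom (fun s : Σ j, I j => x s.1 s.2) z :=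
  ⟨fun s => D.comp (g.1 s.1) ((f s.1).1 s.2), by
    rintro ⟨⟨j, i⟩, u⟩ ⟨⟨j', i'⟩, u'⟩ h
    simp only [D.toFun_comp] at h
    have h' := @g.2 ⟨j, D.toFun ((f j).1 i) u⟩ ⟨j', D.toFun ((f j').1 i') u'⟩ h
    rw [Sigma.mk.injEq] at h'
    obtain ⟨rfl, h2⟩ := h'
    have h3 := @(f j).2 ⟨i, u⟩ ⟨i', u'⟩ (eq_of_heq h2)
    rw [Sigma.mk.injEq] at h3
    obtain ⟨rfl, h4⟩ := h3
    rw [eq_of_heq h4]⟩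

theorem continuous_reindex {I I' : Type} (e : I' ≃ I) {x : I → D.Obj} {y : D.Obj} :
    Continuous (reindex e : D.MultiHom x y → _) := by
  refine Continuous.subtype_mk (continuous_pi fun i => ?_) _
  exact (continuous_apply (e i)).comp continuous_subtype_val

theorem continuous_comp {J : Type} {I : J → Type} {x : ∀ j, I j → D.Obj} {y : J → D.Obj}
    {z : D.Obj} :
    Continuous fun t : D.MultiHom y z × (∀ j, D.MultiHom (x j) (y j)) => comp t.1 t.2 := by
  refine Continuous.subtype_mk (continuous_pi fun s => ?_) _
  have h₁ : Continuous fun t : D.MultiHom y z × (∀ j, D.MultiHom (x j) (y j)) => t.1.1 s.1 :=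
    (continuous_apply s.1).comp (continuous_subtype_val.comp continuous_fst)
  have h₂ : Continuous fun t : D.MultiHom y z × (∀ j, D.MultiHom (x j) (y j)) =>
      (t.2 s.1).1 s.2 :=
    (continuous_apply s.2).comp (continuous_subtype_val.comp
      ((continuous_apply s.1).comp continuous_snd))
  exact D.continuous_comp.comp (h₁.prodMk h₂)

end MultiHom

variable (D)

/-- The operad of embeddings on a family of objects of `D`: its colours are the indices of the
family, and its operations `(c i)_i → d` are the jointly injective families of morphisms. -/
def embOperad (obj : C → D.Obj) : TopOperad where
  Color := C
  Mul x y := D.MultiHom (fun i => obj (x i)) (obj y)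
  topology _ _ := inferInstance
  one c := MultiHom.one (obj c)
  reindex e _ _ f := MultiHom.reindex e f
  comp g f := MultiHom.comp g f
  continuous_reindex e _ _ := MultiHom.continuous_reindex e
  continuous_comp := MultiHom.continuous_comp
  reindex_refl _ := rfl
  reindex_trans _ _ _ _ _ := rfl
  comp_reindex_outer _ _ _ _ _ _ _ _ := rfl
  comp_reindex_inner _ _ _ _ _ _ := rfl
  one_comp f := Subtype.ext (funext fun s => id_comp (f.1 s.2))
  comp_one f := Subtype.ext (funext fun s => comp_id (f.1 s.1))
  comp_assoc h g f := Subtype.ext (funext fun s =>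
    comp_assoc (h.1 s.1.1) ((g s.1.1).1 s.1.2) ((f s.1.1 s.1.2).1 s.2))
end TopCategory

/-! ### Moore paths -/

section Moore

variable {Y : Type*} [TopologicalSpace Y]

/-- The concatenation of a Moore path `γ` of length `r` with a Moore path `δ`. -/
def mooreConcat (r : ℝ≥0) (γ δ : C(ℝ≥0, Y)) (h : γ r = δ 0) : C(ℝ≥0, Y) where
  toFun t := if t ≤ r then γ t else δ (t - r)
  continuous_toFun := by
    refine Continuous.if_le γ.continuous (δ.continuous.comp (continuous_id.sub continuous_const))
      continuous_id continuous_const ?_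
    rintro t rfl
    simpa using h

theorem continuous_mooreConcat {T : Type*} [TopologicalSpace T] {r : T → ℝ≥0}
    {γ δ : T → C(ℝ≥0, Y)} (hr : Continuous r) (hγ : Continuous γ) (hδ : Continuous δ)
    (h : ∀ s, γ s (r s) = δ s 0) :
    Continuous fun s => mooreConcat (r s) (γ s) (δ s) (h s) := by
  refine ContinuousMap.continuous_of_continuous_uncurry _ ?_
  change Continuous fun p : T × ℝ≥0 =>
    if p.2 ≤ r p.1 then γ p.1 p.2 else δ p.1 (p.2 - r p.1)
  refine Continuous.if_le ?_ ?_ continuous_snd (hr.comp continuous_fst) ?_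
  · exact (hγ.comp continuous_fst).eval continuous_snd
  · exact (hδ.comp continuous_fst).eval (continuous_snd.sub (hr.comp continuous_fst))
  · rintro ⟨s, t⟩ (rfl : t = r s)
    simpa using h s

theorem mooreConcat_zero {r : ℝ≥0} {γ δ : C(ℝ≥0, Y)} (h : γ r = δ 0) :
    mooreConcat r γ δ h 0 = γ 0 := by
  simp [mooreConcat]

theorem mooreConcat_apply_of_le {r t : ℝ≥0} {γ δ : C(ℝ≥0, Y)} (h : γ r = δ 0) (ht : r ≤ t) :
    mooreConcat r γ δ h t = δ (t - r) := by
  rcases ht.eq_or_lt with rfl | ht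
  · simpa [mooreConcat] using h
  · simp [mooreConcat, ht]

theorem mooreConcat_apply_of_ge {r t : ℝ≥0} {γ δ : C(ℝ≥0, Y)} (h : γ r = δ 0) (ht : t ≤ r) :
    mooreConcat r γ δ h t = γ t := by
  simp [mooreConcat, ht]

end Moore

namespace TopCategory

variable {D : TopCategory.{u}} {C : Type}

/-- Precomposition of a path of morphisms `b ⟶ X` with a morphism `a ⟶ b`. -/
def precompPath {a b X : D.Obj} (γ : C(ℝ≥0, D.Hom b X)) (f : D.Hom a b) : C(ℝ≥0, D.Hom a X) :=
  ⟨fun t => D.comp (γ t) f,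
    D.continuous_comp.comp (γ.continuous.prodMk continuous_const)⟩

theorem continuous_precompPath {a b X : D.Obj} :
    Continuous fun t : C(ℝ≥0, D.Hom b X) × D.Hom a b => precompPath t.1 t.2 := by
  refine ContinuousMap.continuous_of_continuous_uncurry _ ?_
  exact D.continuous_comp.comp (((continuous_fst.comp continuous_fst).eval continuous_snd).prodMk
    (continuous_snd.comp continuous_fst))

variable (X : D.Obj) (obj : C → D.Obj) (ι : ∀ c, D.Hom (obj c) X)

/-- The space of operations `(x i)_i → y` over `X`: a jointly injective family of morphisms
`f i : obj (x i) ⟶ obj y` together with, for each `i`, a Moore path (a length and a path which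
is constant from there on) in the space of morphisms `obj (x i) ⟶ X`, from `ι (x i)` to
`ι y ∘ f i`. This is the homotopy pullback of
`MultiHom (obj ∘ x) (obj y) → ∏ i, Hom (obj (x i)) X ← *`. -/
abbrev SliceMul {I : Type} (x : I → C) (y : C) : Type :=
  {t : D.MultiHom (fun i => obj (x i)) (obj y) × (∀ i, ℝ≥0 × C(ℝ≥0, D.Hom (obj (x i)) X)) //
    ∀ i, (t.2 i).2 0 = ι (x i) ∧ ∀ s, (t.2 i).1 ≤ s → (t.2 i).2 s = D.comp (ι y) (t.1.1 i)}

variable {X obj ι}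

namespace SliceMul

@[ext]
theorem ext {I : Type} {x : I → C} {y : C} {t t' : SliceMul X obj ι x y}
    (h₁ : ∀ i, t.1.1.1 i = t'.1.1.1 i) (h₂ : ∀ i, (t.1.2 i).1 = (t'.1.2 i).1)
    (h₃ : ∀ i s, (t.1.2 i).2 s = (t'.1.2 i).2 s) : t = t' :=
  Subtype.ext (Prod.ext (Subtype.ext (funext h₁))
    (funext fun i => Prod.ext (h₂ i) (ContinuousMap.ext (h₃ i))))

/-- The identity, with the constant path of length zero. -/
def one (c : C) : SliceMul X obj ι (fun _ : Unit => c) c :=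
  ⟨(MultiHom.one (obj c), fun _ => (0, ContinuousMap.const _ (ι c))), fun _ =>
    ⟨rfl, fun _ _ => (comp_id (ι c)).symm⟩⟩

/-- Reindexing along a bijection. -/
def reindex {I I' : Type} (e : I' ≃ I) {x : I → C} {y : C} (t : SliceMul X obj ι x y) :
    SliceMul X obj ι (fun i => x (e i)) y :=
  ⟨(MultiHom.reindex e t.1.1, fun i => t.1.2 (e i)), fun i => t.2 (e i)⟩

theorem comp_aux {J : Type} {I : J → Type} {x : ∀ j, I j → C} {y : J → C} {z : C}
    (g : SliceMul X obj ι y z) (f : ∀ j, SliceMul X obj ι (x j) (y j)) (j : J) (i : I j) :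
    ((f j).1.2 i).2 ((f j).1.2 i).1 = precompPath (g.1.2 j).2 ((f j).1.1.1 i) 0 :=
  (((f j).2 i).2 _ le_rfl).trans
    (congrArg (fun k => D.comp k ((f j).1.1.1 i)) (g.2 j).1.symm)

/-- Composition: the families of morphisms are composed, and the path from `ι (x j i)` to
`ι (y j) ∘ f j i` is followed by the path from `ι (y j)` to `ι z ∘ g j`, precomposed with
`f j i`. -/
def comp {J : Type} {I : J → Type} {x : ∀ j, I j → C} {y : J → C} {z : C}
    (g : SliceMul X obj ι y z) (f : ∀ j, SliceMul X obj ι (x j) (y j)) :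
    SliceMul X obj ι (fun s : Σ j, I j => x s.1 s.2) z :=
  ⟨(MultiHom.comp g.1.1 fun j => (f j).1.1, fun s =>
      (((f s.1).1.2 s.2).1 + (g.1.2 s.1).1,
        mooreConcat ((f s.1).1.2 s.2).1 ((f s.1).1.2 s.2).2
          (precompPath (g.1.2 s.1).2 ((f s.1).1.1.1 s.2)) (comp_aux g f s.1 s.2))), by
    rintro ⟨j, i⟩
    refine ⟨(mooreConcat_zero (comp_aux g f j i)).trans ((f j).2 i).1, fun t ht => ?_⟩
    refine (mooreConcat_apply_of_le (comp_aux g f j i) (le_self_add.trans ht)).trans ?_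
    change D.comp ((g.1.2 j).2 _) _ = D.comp _ (D.comp _ _)
    rw [(g.2 j).2 _ (le_tsub_of_add_le_left ht), comp_assoc]⟩

theorem continuous_reindex {I I' : Type} (e : I' ≃ I) {x : I → C} {y : C} :
    Continuous (reindex e : SliceMul X obj ι x y → _) := by
  refine Continuous.subtype_mk (Continuous.prodMk ?_ (continuous_pi fun i => ?_)) _
  · exact (MultiHom.continuous_reindex e).comp (continuous_fst.comp continuous_subtype_val)
  · exact (continuous_apply (e i)).comp (continuous_snd.comp continuous_subtype_val)

theorem continuous_comp {J : Type} {I : J → Type} {x : ∀ j, I j → C} {y : J → C} {z : C} :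
    Continuous fun t : SliceMul X obj ι y z × (∀ j, SliceMul X obj ι (x j) (y j)) =>
      comp t.1 t.2 := by
  have hg : Continuous fun t : SliceMul X obj ι y z × (∀ j, SliceMul X obj ι (x j) (y j)) =>
      t.1.1 := continuous_subtype_val.comp continuous_fst
  have hf : ∀ j, Continuous fun t : SliceMul X obj ι y z ×
      (∀ j, SliceMul X obj ι (x j) (y j)) => (t.2 j).1 := fun j =>
    continuous_subtype_val.comp ((continuous_apply j).comp continuous_snd)
  refine Continuous.subtype_mk (Continuous.prodMk ?_ (continuous_pi fun s => ?_)) _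
  · exact MultiHom.continuous_comp.comp ((continuous_fst.comp hg).prodMk
      (continuous_pi fun j => continuous_fst.comp (hf j)))
  · have h₁ := (continuous_apply s.2).comp (continuous_snd.comp (hf s.1))
    have h₂ := (continuous_apply s.1).comp (continuous_snd.comp hg)
    have h₃ := (continuous_apply s.2).comp
      (continuous_subtype_val.comp (continuous_fst.comp (hf s.1)))
    refine Continuous.prodMk ((continuous_fst.comp h₁).add (continuous_fst.comp h₂)) ?_
    exact continuous_mooreConcat (continuous_fst.comp h₁) (continuous_snd.comp h₁)
      (continuous_precompPath.comp ((continuous_snd.comp h₂).prodMk h₃)) _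

/-- Forgetting the paths. -/
def forget {I : Type} (x : I → C) (y : C) :
    C(SliceMul X obj ι x y, D.MultiHom (fun i => obj (x i)) (obj y)) :=
  ⟨fun t => t.1.1, continuous_fst.comp continuous_subtype_val⟩

end SliceMul

variable (X obj ι)

/-- The operad of embeddings over `X`, a strictly associative model of the homotopical slice over
`X` of the operad of embeddings. -/
def sliceOperad : TopOperad where
  Color := C
  Mul x y := SliceMul X obj ι x y
  topology _ _ := inferInstance
  one c := SliceMul.one c
  reindex e _ _ f := SliceMul.reindex e f
  comp g f := SliceMul.comp g f
  continuous_reindex e _ _ := SliceMul.continuous_reindex e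
  continuous_comp := SliceMul.continuous_comp
  reindex_refl _ := rfl
  reindex_trans _ _ _ _ _ := rfl
  comp_reindex_outer _ _ _ _ _ _ _ _ := rfl
  comp_reindex_inner _ _ _ _ _ _ := rfl
  one_comp {I _ x y} f := by
    refine SliceMul.ext (fun s => id_comp (f.1.1.1 s.2)) (fun s => add_zero _) fun s t => ?_
    rcases le_total t (f.1.2 s.2).1 with h | h
    · exact mooreConcat_apply_of_ge
        (SliceMul.comp_aux (x := fun _ => x) (SliceMul.one y) (fun _ => f) s.1 s.2) h
    · exact (mooreConcat_apply_of_le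
        (SliceMul.comp_aux (x := fun _ => x) (SliceMul.one y) (fun _ => f) s.1 s.2) h).trans ((f.2 s.2).2 t h).symm
  comp_one {I _ x y} f := by
    refine SliceMul.ext (fun s => comp_id (f.1.1.1 s.1)) (fun s => zero_add _) fun s t => ?_
    refine (mooreConcat_apply_of_le
      (SliceMul.comp_aux f (fun i => SliceMul.one (x i)) s.1 s.2) zero_le).trans ?_
    refine (comp_id _).trans ?_
    exact congrArg (f.1.2 s.1).2 (tsub_zero t)
  comp_assoc {K _ J _ I _ x y z w} h g f := by
    refine SliceMul.ext (fun s => comp_assoc (h.1.1.1 s.1.1) ((g s.1.1).1.1.1 s.1.2)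
      ((f s.1.1 s.1.2).1.1.1 s.2)) (fun s => (add_assoc _ _ _).symm) fun s t => ?_
    obtain ⟨⟨k, j⟩, i⟩ := s
    have hL := SliceMul.comp_aux (SliceMul.comp h g) (fun s : Σ k, J k => f s.1 s.2) ⟨k, j⟩ i
    have hL' := SliceMul.comp_aux h g k j
    have hR := SliceMul.comp_aux h (fun k => SliceMul.comp (g k) (f k)) k ⟨j, i⟩
    have hR' := SliceMul.comp_aux (g k) (f k) j i
    rcases le_total t ((f k j).1.2 i).1 with h₁ | h₁
    · refine (mooreConcat_apply_of_ge hL h₁).trans (Eq.symm ?_)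
      exact (mooreConcat_apply_of_ge hR (h₁.trans le_self_add)).trans
        (mooreConcat_apply_of_ge hR' h₁)
    · refine (mooreConcat_apply_of_le hL h₁).trans ?_
      rcases le_total t (((f k j).1.2 i).1 + ((g k).1.2 j).1) with h₂ | h₂
      · have h₃ : t - ((f k j).1.2 i).1 ≤ ((g k).1.2 j).1 := tsub_le_iff_left.2 h₂
        refine Eq.trans ?_ ((mooreConcat_apply_of_ge hR h₂).trans
          (mooreConcat_apply_of_le hR' h₁)).symm
        exact congrArg (fun l => D.comp l ((f k j).1.1.1 i)) (mooreConcat_apply_of_ge hL' h₃)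
      · have h₃ : ((g k).1.2 j).1 ≤ t - ((f k j).1.2 i).1 := le_tsub_of_add_le_left h₂
        refine Eq.trans ?_ (mooreConcat_apply_of_le hR h₂).symm
        refine (congrArg (fun l => D.comp l ((f k j).1.1.1 i))
          (mooreConcat_apply_of_le hL' h₃)).trans ?_
        refine (comp_assoc _ _ _).trans ?_
        exact congrArg (fun l => D.comp ((h.1.2 k).2 l) (D.comp ((g k).1.1.1 j) ((f k j).1.1.1 i)))
          (tsub_tsub t _ _)

/-- The morphism of operads forgetting the paths. -/
def sliceForget : TopOperadHom (sliceOperad X obj ι) (embOperad D obj) where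
  onColor c := c
  onMul x y := SliceMul.forget x y
  map_one _ := rfl
  map_reindex _ _ _ _ := rfl
  map_comp _ _ := rfl

end TopCategory

/-- Continuous functors between topological categories of spaces which do not change the
underlying sets and functions, up to given bijections. -/
structure TopFunctor (D : TopCategory.{u}) (D' : TopCategory.{v}) where
  obj : D.Obj → D'.Obj
  map : ∀ {a b}, D.Hom a b → D'.Hom (obj a) (obj b)
  continuous_map : ∀ {a b}, Continuous (map : D.Hom a b → _)
  equiv : ∀ a, D.carrier a ≃ D'.carrier (obj a)
  toFun_map : ∀ {a b} (f : D.Hom a b) u, D'.toFun (map f) (equiv a u) = equiv b (D.toFun f u)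

namespace TopFunctor

variable {D : TopCategory.{u}} {D' : TopCategory.{v}} (F : TopFunctor D D') {C : Type}

theorem map_id (a : D.Obj) : F.map (D.id a) = D'.id (F.obj a) :=
  D'.toFun_injective (funext fun u => by
    obtain ⟨u, rfl⟩ := (F.equiv a).surjective u
    rw [F.toFun_map, D.toFun_id, D'.toFun_id])

theorem map_comp {a b c : D.Obj} (g : D.Hom b c) (f : D.Hom a b) :
    F.map (D.comp g f) = D'.comp (F.map g) (F.map f) :=
  D'.toFun_injective (funext fun u => by
    obtain ⟨u, rfl⟩ := (F.equiv a).surjective u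
    simp only [F.toFun_map, D.toFun_comp, D'.toFun_comp])

/-- The action on jointly injective families. -/
def mapMulti {I : Type} {x : I → D.Obj} {y : D.Obj} (f : D.MultiHom x y) :
    D'.MultiHom (fun i => F.obj (x i)) (F.obj y) :=
  ⟨fun i => F.map (f.1 i), by
    rintro ⟨i, u⟩ ⟨j, v⟩ h
    obtain ⟨u, rfl⟩ := (F.equiv _).surjective u
    obtain ⟨v, rfl⟩ := (F.equiv _).surjective v
    simp only [F.toFun_map] at h
    have h' := @f.2 ⟨i, u⟩ ⟨j, v⟩ ((F.equiv y).injective h)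
    rw [Sigma.mk.injEq] at h'
    obtain ⟨rfl, h2⟩ := h'
    rw [eq_of_heq h2]⟩

variable {X : D.Obj} {obj : C → D.Obj} {ι : ∀ c, D.Hom (obj c) X}

/-- The action on operations over `X`: apply the functor to the morphisms and to the paths. -/
def mapSlice {I : Type} (x : I → C) (y : C) :
    C(TopCategory.SliceMul X obj ι x y, TopCategory.SliceMul (F.obj X) (fun c => F.obj (obj c))
      (fun c => F.map (ι c)) x y) where
  toFun t := ⟨(F.mapMulti t.1.1, fun i => ((t.1.2 i).1,
      (⟨F.map, F.continuous_map⟩ : C(_, _)).comp (t.1.2 i).2)), fun i =>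
    ⟨congrArg F.map (t.2 i).1, fun s hs =>
      (congrArg F.map ((t.2 i).2 s hs)).trans (F.map_comp _ _)⟩⟩
  continuous_toFun := by
    refine Continuous.subtype_mk (Continuous.prodMk ?_ (continuous_pi fun i => ?_)) _
    · refine Continuous.subtype_mk (continuous_pi fun i => ?_) _
      exact F.continuous_map.comp ((continuous_apply i).comp
        (continuous_subtype_val.comp (continuous_fst.comp continuous_subtype_val)))
    · have h := (continuous_apply i).comp (continuous_snd.comp (continuous_subtype_val
        (p := fun t : D.MultiHom (fun i => obj (x i)) (obj y) ×
            (∀ i, ℝ≥0 × C(ℝ≥0, D.Hom (obj (x i)) X)) =>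
          ∀ i, (t.2 i).2 0 = ι (x i) ∧
            ∀ s, (t.2 i).1 ≤ s → (t.2 i).2 s = D.comp (ι y) (t.1.1 i))))
      exact (continuous_fst.comp h).prodMk
        ((ContinuousMap.continuous_postcomp _).comp (continuous_snd.comp h))

theorem mapSlice_one (c : C) :
    F.mapSlice _ _ (TopCategory.SliceMul.one c : TopCategory.SliceMul X obj ι _ c) =
      TopCategory.SliceMul.one c :=
  TopCategory.SliceMul.ext (fun _ => F.map_id (obj c)) (fun _ => rfl) (fun _ _ => rfl)

theorem mapSlice_comp {J : Type} {I : J → Type} {x : ∀ j, I j → C} {y : J → C} {z : C}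
    (g : TopCategory.SliceMul X obj ι y z) (f : ∀ j, TopCategory.SliceMul X obj ι (x j) (y j)) :
    F.mapSlice _ _ (TopCategory.SliceMul.comp g f) =
      TopCategory.SliceMul.comp (F.mapSlice _ _ g) fun j => F.mapSlice _ _ (f j) := by
  refine TopCategory.SliceMul.ext (fun s => F.map_comp (g.1.1.1 s.1) ((f s.1).1.1.1 s.2))
    (fun _ => rfl) (fun s t => ?_)
  obtain ⟨j, i⟩ := s
  have hF := TopCategory.SliceMul.comp_aux (F.mapSlice y z g)
    (fun j => F.mapSlice (x j) (y j) (f j)) j i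
  have hD := TopCategory.SliceMul.comp_aux g f j i
  rcases le_total t ((f j).1.2 i).1 with h | h
  · refine Eq.trans ?_ (mooreConcat_apply_of_ge hF h).symm
    exact congrArg F.map (mooreConcat_apply_of_ge hD h)
  · refine Eq.trans ?_ (mooreConcat_apply_of_le hF h).symm
    exact (congrArg F.map (mooreConcat_apply_of_le hD h)).trans (F.map_comp _ _)

variable (X obj ι)

/-- The morphism of operads over `X` induced by a continuous functor. -/
def sliceMap : TopOperadHom (D.sliceOperad X obj ι)
    (D'.sliceOperad (F.obj X) (fun c => F.obj (obj c)) (fun c => F.map (ι c))) where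
  onColor c := c
  onMul x y := F.mapSlice x y
  map_one c := F.mapSlice_one c
  map_reindex _ _ _ _ := rfl
  map_comp g f := F.mapSlice_comp g f

end TopFunctor

namespace TopCategory

variable {D : TopCategory.{u}} {C C' : Type} (X : D.Obj) (obj : C → D.Obj)
  (ι : ∀ c, D.Hom (obj c) X)

/-- The inclusion of the operad over `X` with colours indexed along a map `C' → C`. -/
def sliceRecolor (κ : C' → C) :
    TopOperadHom (D.sliceOperad X (fun c => obj (κ c)) (fun c => ι (κ c)))
      (D.sliceOperad X obj ι) where
  onColor := κ
  onMul x y := ContinuousMap.id (SliceMul X obj ι (fun i => κ (x i)) (κ y))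
  map_one _ := rfl
  map_reindex _ _ _ _ := rfl
  map_comp _ _ := rfl

end TopCategory

/-- Composition of morphisms of operads. -/
def TopOperadHom.comp {P Q R : TopOperad} (G : TopOperadHom Q R) (F : TopOperadHom P Q) :
    TopOperadHom P R where
  onColor c := G.onColor (F.onColor c)
  onMul x y := (G.onMul _ _).comp (F.onMul x y)
  map_one c := (congrArg (G.onMul _ _) (F.map_one c)).trans (G.map_one _)
  map_reindex e _ _ f := (congrArg (G.onMul _ _) (F.map_reindex e f)).trans (G.map_reindex e (F.onMul _ _ f))
  map_comp g f := (congrArg (G.onMul _ _) (F.map_comp g f)).trans (G.map_comp (F.onMul _ _ g) fun j => F.onMul _ _ (f j))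

/-! ### Boxes and smooth open embeddings -/

/-- Boxes: subsets of a coordinate space `ℝ^n` which are products of locally closed intervals
with non-empty interior. -/
structure Box where
  Coord : Type
  [fintype : Fintype Coord]
  side : Coord → Set ℝ
  convex_side : ∀ i, Convex ℝ (side i)
  interior_side : ∀ i, (interior (side i)).Nonempty
  isLocallyClosed_side : ∀ i, IsLocallyClosed (side i)

attribute [instance] Box.fintype

namespace Box

/-- The ambient vector space of a box. -/
abbrev Space (U : Box) : Type := U.Coord → ℝ

/-- The underlying set of a box. -/
def set (U : Box) : Set U.Space := Set.pi univ U.side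

theorem uniqueDiffOn (U : Box) : UniqueDiffOn ℝ U.set :=
  UniqueDiffOn.univ_pi fun i => uniqueDiffOn_convex (U.convex_side i) (U.interior_side i)

theorem isLocallyClosed (U : Box) : IsLocallyClosed U.set := by
  choose A B hA hB hAB using U.isLocallyClosed_side
  refine ⟨Set.pi univ A, Set.pi univ B, isOpen_set_pi finite_univ fun i _ => hA i,
    isClosed_set_pi fun i _ => hB i, ?_⟩
  rw [← Set.pi_inter_distrib]
  exact Set.pi_congr rfl fun i _ => hAB i

instance (U : Box) : LocallyCompactSpace U.set := U.isLocallyClosed.locallyCompactSpace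

end Box

variable {U V W : Box}

/-- Smooth open embeddings between boxes: open topological embeddings which are smooth and have a
smooth inverse on their image. A function on a subset of a Euclidean space is smooth if it
extends to a smooth function on an open neighbourhood of that subset. -/
structure IsSmoothOpenEmbedding (f : U.set → V.set) : Prop where
  isOpenEmbedding : IsOpenEmbedding f
  smooth : ∃ (O : Set U.Space) (F : U.Space → V.Space), IsOpen O ∧ U.set ⊆ O ∧
    ContDiffOn ℝ ∞ F O ∧ ∀ u : U.set, F u = f u
  smooth_inverse : ∃ (O : Set V.Space) (G : V.Space → U.Space), IsOpen O ∧
    (∀ u : U.set, (f u : V.Space) ∈ O) ∧ ContDiffOn ℝ ∞ G O ∧ ∀ u : U.set, G (f u) = u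

/-- The set of smooth open embeddings `U → V`. -/
def SmoothEmb (U V : Box) : Type :=
  {f : U.set → V.set // IsSmoothOpenEmbedding f}

namespace SmoothEmb

/-- A smooth open embedding, as a function on the ambient space (extended by zero). -/
def ambient (f : SmoothEmb U V) : U.Space → V.Space :=
  Function.extend Subtype.val (fun u => (f.1 u : V.Space)) 0

theorem ambient_apply (f : SmoothEmb U V) (u : U.set) : f.ambient u = f.1 u :=
  Subtype.val_injective.extend_apply _ _ u

theorem contDiffOn_ambient (f : SmoothEmb U V) : ContDiffOn ℝ ∞ f.ambient U.set := by
  obtain ⟨O, F, -, hO, hF, hf⟩ := f.2.smooth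
  exact (hF.mono hO).congr fun u hu => by rw [f.ambient_apply ⟨u, hu⟩, ← hf]

theorem mapsTo_ambient (f : SmoothEmb U V) : MapsTo f.ambient U.set V.set := fun u hu => by
  rw [f.ambient_apply ⟨u, hu⟩]
  exact (f.1 ⟨u, hu⟩).2

/-- The `k`-th derivative of a smooth open embedding, as a continuous function. -/
def jet (k : ℕ) (f : SmoothEmb U V) : C(U.set, U.Space [×k]→L[ℝ] V.Space) where
  toFun u := iteratedFDerivWithin ℝ k f.ambient U.set u
  continuous_toFun := continuousOn_iff_continuous_domRestrict.1
    (f.contDiffOn_ambient.continuousOn_iteratedFDerivWithin (by exact_mod_cast le_top)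
      U.uniqueDiffOn)

/-- The weak `C^∞`-topology: uniform convergence on compact subsets of all derivatives. -/
instance : TopologicalSpace (SmoothEmb U V) :=
  ⨅ k : ℕ, TopologicalSpace.induced (jet k) inferInstance

theorem continuous_jet (k : ℕ) :
    Continuous fun t : SmoothEmb U V × U.set => jet k t.1 t.2 := by
  have h : Continuous (jet k : SmoothEmb U V → _) :=
    continuous_iff_le_induced.2 (iInf_le _ k)
  exact (h.comp continuous_fst).eval continuous_snd

theorem continuous_of_jet {T : Type*} [TopologicalSpace T] {φ : T → SmoothEmb U V}
    (h : ∀ k, Continuous fun t : T × U.set => jet k (φ t.1) t.2) : Continuous φ :=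
  continuous_iInf_rng.2 fun k => continuous_induced_rng.2
    (ContinuousMap.continuous_of_continuous_uncurry _ (h k))

theorem continuous_eval : Continuous fun t : SmoothEmb U V × U.set => t.1.1 t.2 := by
  refine Continuous.subtype_mk (p := fun x => x ∈ V.set)
    (f := fun t : SmoothEmb U V × U.set => (t.1.1 t.2 : V.Space)) ?_ fun t => (t.1.1 t.2).2
  have h := (continuousMultilinearCurryFin0 ℝ U.Space V.Space).continuous.comp
    (continuous_jet (U := U) (V := V) 0)
  refine h.congr fun t => ?_
  change iteratedFDerivWithin ℝ 0 t.1.ambient U.set t.2 0 = _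
  rw [iteratedFDerivWithin_zero_apply, ambient_apply]

/-- The identity. -/
def id (U : Box) : SmoothEmb U U :=
  ⟨fun u => u, IsOpenEmbedding.id, ⟨univ, fun x => x, isOpen_univ, subset_univ _, contDiffOn_id,
    fun _ => rfl⟩, ⟨univ, fun x => x, isOpen_univ, fun _ => mem_univ _, contDiffOn_id,
    fun _ => rfl⟩⟩

/-- Composition of smooth open embeddings. -/
def comp (g : SmoothEmb V W) (f : SmoothEmb U V) : SmoothEmb U W :=
  ⟨fun u => g.1 (f.1 u), g.2.isOpenEmbedding.comp f.2.isOpenEmbedding, by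
    obtain ⟨O, F, hO, hUO, hF, hf⟩ := f.2.smooth
    obtain ⟨O', F', hO', hVO', hF', hg⟩ := g.2.smooth
    refine ⟨O ∩ F ⁻¹' O', F' ∘ F, hF.continuousOn.isOpen_inter_preimage hO hO', fun u hu => ?_,
      hF'.comp (hF.mono inter_subset_left) fun x hx => hx.2, fun u => ?_⟩
    · refine ⟨hUO hu, ?_⟩
      change F (⟨u, hu⟩ : U.set) ∈ O'
      rw [hf]
      exact hVO' (f.1 ⟨u, hu⟩).2
    · rw [Function.comp_apply, hf, hg], by
    obtain ⟨O, F, hO, hUO, hF, hf⟩ := f.2.smooth_inverse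
    obtain ⟨O', F', hO', hVO', hF', hg⟩ := g.2.smooth_inverse
    refine ⟨O' ∩ F' ⁻¹' O, F ∘ F', hF'.continuousOn.isOpen_inter_preimage hO' hO, fun u => ?_,
      hF.comp (hF'.mono inter_subset_left) fun x hx => hx.2, fun u => ?_⟩
    · refine ⟨hVO' (f.1 u), ?_⟩
      rw [mem_preimage, hg]
      exact hUO u
    · rw [Function.comp_apply, hg, hf]⟩

theorem jet_comp (k : ℕ) (g : SmoothEmb V W) (f : SmoothEmb U V) (u : U.set) :
    jet k (comp g f) u = ∑ c : OrderedFinpartition k,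
      c.compAlongOrderedFinpartitionL ℝ U.Space V.Space W.Space (jet c.length g (f.1 u))
        fun m => jet (c.partSize m) f u := by
  have h : EqOn (comp g f).ambient (g.ambient ∘ f.ambient) U.set := fun x hx => by
    rw [Function.comp_apply, (comp g f).ambient_apply ⟨x, hx⟩, f.ambient_apply ⟨x, hx⟩,
      g.ambient_apply]
    rfl
  change iteratedFDerivWithin ℝ k (comp g f).ambient U.set u = _
  rw [iteratedFDerivWithin_congr h u.2,
    iteratedFDerivWithin_comp (g.contDiffOn_ambient _ (f.mapsTo_ambient u.2))
      (f.contDiffOn_ambient _ u.2) V.uniqueDiffOn U.uniqueDiffOn u.2 f.mapsTo_ambient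
      (by exact_mod_cast le_top), f.ambient_apply]
  rfl

theorem continuous_comp :
    Continuous fun t : SmoothEmb V W × SmoothEmb U V => comp t.1 t.2 := by
  refine continuous_of_jet fun k => ?_
  simp only [jet_comp]
  refine continuous_finsetSum _ fun c _ => ?_
  have hf : Continuous fun t : (SmoothEmb V W × SmoothEmb U V) × U.set => (t.1.2, t.2) :=
    (continuous_snd.comp continuous_fst).prodMk continuous_snd
  have hg : Continuous fun t : (SmoothEmb V W × SmoothEmb U V) × U.set =>
      (t.1.1, t.1.2.1 t.2) :=
    (continuous_fst.comp continuous_fst).prodMk (continuous_eval.comp hf)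
  have h₁ := (c.compAlongOrderedFinpartitionL ℝ U.Space V.Space W.Space).continuous.comp
    ((continuous_jet c.length).comp hg)
  exact h₁.eval (continuous_pi fun m => (continuous_jet (c.partSize m)).comp hf)

end SmoothEmb

/-- The topological category of boxes and smooth open embeddings. -/
def smoothCat : TopCategory.{1} where
  Obj := Box
  carrier U := U.set
  Hom U V := SmoothEmb U V
  topology _ _ := inferInstance
  toFun f := f.1
  toFun_injective h := Subtype.ext h
  id := SmoothEmb.id
  comp g f := SmoothEmb.comp g f
  toFun_id _ _ := rfl
  toFun_comp _ _ _ := rfl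
  continuous_comp := SmoothEmb.continuous_comp

/-! ### Rectilinear maps -/

section Rectilinear

variable {ι : Type} {R S T : Set (ι → ℝ)}

/-- Rectilinear maps: restrictions of compositions of a dilation `x ↦ (a i * x i)_i`, `a i > 0`,
and a translation. -/
def IsRectilinear (f : S → T) : Prop :=
  ∃ a v : ι → ℝ, (∀ i, 0 < a i) ∧ ∀ (x : S) (i : ι), (f x : ι → ℝ) i = a i * (x : ι → ℝ) i + v i

/-- The space of open rectilinear maps, with the compact-open topology. -/
abbrev Rect (S T : Set (ι → ℝ)) : Type :=
  {f : C(S, T) // IsRectilinear f ∧ IsOpenMap f}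

namespace Rect

/-- The identity. -/
def id (S : Set (ι → ℝ)) : Rect S S :=
  ⟨ContinuousMap.id S, ⟨fun _ => 1, fun _ => 0, fun _ => one_pos, fun x i => by simp⟩,
    IsOpenMap.id⟩

/-- Composition. -/
def comp (g : Rect S T) (f : Rect R S) : Rect R T :=
  ⟨g.1.comp f.1, by
    obtain ⟨a, v, ha, hf⟩ := f.2.1
    obtain ⟨b, w, hb, hg⟩ := g.2.1
    refine ⟨fun i => b i * a i, fun i => b i * v i + w i, fun i => mul_pos (hb i) (ha i),
      fun x i => ?_⟩
    rw [ContinuousMap.comp_apply, hg, hf]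
    ring, g.2.2.comp f.2.2⟩

end Rect

end Rectilinear

section Cubes

variable {p q : ℕ}

/-- The sides of the quadrant `ℝ^p × ℝ_{≥ 0}^q`. -/
def quadrantSide (p q : ℕ) : Fin p ⊕ Fin q → Set ℝ :=
  Sum.elim (fun _ => univ) fun _ => Ici 0

/-- The sides of the cube `(-1, 1)^p × [0, 1)^q`. -/
def cubeSide (p q : ℕ) : Fin p ⊕ Fin q → Set ℝ :=
  Sum.elim (fun _ => Ioo (-1) 1) fun _ => Ico 0 1

/-- The sides of the cube of type `Q ⊆ {1, …, q}`: in the last `q` coordinates they are `[0, 1)`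
for the elements of `Q` and `(-1, 1)` otherwise. -/
def typedCubeSide (p : ℕ) {q : ℕ} (Q : Finset (Fin q)) : Fin p ⊕ Fin q → Set ℝ :=
  Sum.elim (fun _ => Ioo (-1) 1) fun j => if j ∈ Q then Ico 0 1 else Ioo (-1) 1

/-- The intervals which occur as sides. -/
def IsSide (A : Set ℝ) : Prop := A = univ ∨ A = Ici 0 ∨ A = Ioo (-1) 1 ∨ A = Ico 0 1

theorem IsSide.convex {A : Set ℝ} (h : IsSide A) : Convex ℝ A := by
  rcases h with rfl | rfl | rfl | rfl
  exacts [convex_univ, convex_Ici 0, convex_Ioo _ _, convex_Ico _ _]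

theorem IsSide.interior_nonempty {A : Set ℝ} (h : IsSide A) : (interior A).Nonempty := by
  rcases h with rfl | rfl | rfl | rfl
  · simp
  · exact ⟨1, by simp⟩
  · exact ⟨0, by simp⟩
  · exact ⟨1 / 2, by rw [interior_Ico]; constructor <;> norm_num⟩

theorem IsSide.isLocallyClosed {A : Set ℝ} (h : IsSide A) : IsLocallyClosed A := by
  rcases h with rfl | rfl | rfl | rfl
  · exact isOpen_univ.isLocallyClosed
  · exact isClosed_Ici.isLocallyClosed
  · exact isOpen_Ioo.isLocallyClosed
  · exact ⟨Iio 1, Ici 0, isOpen_Iio, isClosed_Ici, by ext; simp [and_comm]⟩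

/-- The box with given sides. -/
def boxOfSides {a b : ℕ} (s : Fin a ⊕ Fin b → Set ℝ) (h : ∀ i, IsSide (s i)) : Box where
  Coord := Fin a ⊕ Fin b
  side := s
  convex_side i := (h i).convex
  interior_side i := (h i).interior_nonempty
  isLocallyClosed_side i := (h i).isLocallyClosed

theorem isSide_quadrantSide (i : Fin p ⊕ Fin q) : IsSide (quadrantSide p q i) := by
  rcases i with i | j
  · exact Or.inl rfl
  · exact Or.inr (Or.inl rfl)

theorem isSide_cubeSide (i : Fin p ⊕ Fin q) : IsSide (cubeSide p q i) := by
  rcases i with i | j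
  · exact Or.inr (Or.inr (Or.inl rfl))
  · exact Or.inr (Or.inr (Or.inr rfl))

theorem isSide_typedCubeSide (Q : Finset (Fin q)) (i : Fin p ⊕ Fin q) :
    IsSide (typedCubeSide p Q i) := by
  rcases i with i | j
  · exact Or.inr (Or.inr (Or.inl rfl))
  · by_cases h : j ∈ Q <;> simp [IsSide, typedCubeSide, h]

/-- The quadrant `ℝ^{p,q} = ℝ^p × ℝ_{≥ 0}^q`. -/
def quadrant (p q : ℕ) : Box := boxOfSides (quadrantSide p q) isSide_quadrantSide

/-- The cube `□^{p,q} = (-1, 1)^p × [0, 1)^q`. -/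
def cube (p q : ℕ) : Box := boxOfSides (cubeSide p q) isSide_cubeSide

/-- The objects of the category of rectilinear maps: the cubes `□^{p,Q}` (`some Q`) and the
quadrant `ℝ^{p,q}` (`none`). -/
def rectSide (p : ℕ) {q : ℕ} : Option (Finset (Fin q)) → Fin p ⊕ Fin q → Set ℝ
  | none => quadrantSide p q
  | some Q => typedCubeSide p Q

theorem isSide_rectSide : ∀ (a : Option (Finset (Fin q))) (i : Fin p ⊕ Fin q),
    IsSide (rectSide p a i)
  | none => isSide_quadrantSide
  | some Q => isSide_typedCubeSide Q

/-- The subset of `ℝ^{p+q}` underlying `□^{p,Q}` (`some Q`) or `ℝ^{p,q}` (`none`). -/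
def rectSet (p : ℕ) {q : ℕ} (a : Option (Finset (Fin q))) : Set (Fin p ⊕ Fin q → ℝ) :=
  Set.pi univ (rectSide p a)

instance (a : Option (Finset (Fin q))) : LocallyCompactSpace (rectSet p a) :=
  inferInstanceAs (LocallyCompactSpace (boxOfSides (rectSide p a) (isSide_rectSide a)).set)

/-- The topological category of the cubes `□^{p,Q}` and the quadrant `ℝ^{p,q}`, with open
rectilinear maps. -/
def rectCat (p q : ℕ) : TopCategory.{0} where
  Obj := Option (Finset (Fin q))
  carrier a := rectSet p a
  Hom a b := Rect (rectSet p a) (rectSet p b)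
  topology _ _ := inferInstance
  toFun f := f.1
  toFun_injective h := Subtype.ext (ContinuousMap.ext (congrFun h))
  id _ := Rect.id _
  comp g f := Rect.comp g f
  toFun_id _ _ := rfl
  toFun_comp _ _ _ := rfl
  continuous_comp := Continuous.subtype_mk
    ((continuous_subtype_val.comp continuous_fst).compCM
      (continuous_subtype_val.comp continuous_snd)) _

theorem zero_mem_rectSet (a : Option (Finset (Fin q))) :
    (0 : Fin p ⊕ Fin q → ℝ) ∈ rectSet p a := by
  rintro (i | j) -
  · rcases a with - | Q <;> simp [rectSide, quadrantSide, typedCubeSide]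
  · rcases a with - | Q
    · simp [rectSide, quadrantSide]
    · by_cases h : j ∈ Q <;> simp [rectSide, typedCubeSide, h]

/-- An open rectilinear map out of `□^{p,Q}` sends the face `x j = 0`, `j ∈ Q`, to points whose
`j`-th coordinate is minimal in the target. -/
theorem Rect.le_of_mem {Q : Finset (Fin q)} {b : Option (Finset (Fin q))}
    {f : rectSet p (some Q) → rectSet p b} (ho : IsOpenMap f) {a v : Fin p ⊕ Fin q → ℝ}
    (ha : ∀ i, 0 < a i) (hf : ∀ x i, (f x).1 i = a i * x.1 i + v i) {j : Fin q} (hj : j ∈ Q)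
    {t : ℝ} (ht : t ∈ rectSide p b (Sum.inr j)) : v (Sum.inr j) ≤ t := by
  by_contra! hlt
  set x₀ : rectSet p (some Q) := ⟨0, zero_mem_rectSet _⟩
  have hv : (f x₀).1 (Sum.inr j) = v (Sum.inr j) := by rw [hf]; simp [x₀]
  have hmem : ∀ s : unitInterval, Function.update (f x₀).1 (Sum.inr j)
      (v (Sum.inr j) + s * (t - v (Sum.inr j))) ∈ rectSet p b := by
    intro s i _
    rcases eq_or_ne i (Sum.inr j) with rfl | hi
    · rw [Function.update_self]
      have h1 : v (Sum.inr j) ∈ rectSide p b (Sum.inr j) := hv ▸ (f x₀).2 _ (mem_univ _)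
      have := (isSide_rectSide b (Sum.inr j)).convex.add_smul_sub_mem h1 ht s.2
      simpa using this
    · rw [Function.update_of_ne hi]
      exact (f x₀).2 _ (mem_univ _)
  let c : unitInterval → rectSet p b := fun s => ⟨_, hmem s⟩
  have hc : Continuous c := by
    refine Continuous.subtype_mk ?_ _
    exact continuous_const.update _ (by fun_prop)
  have hc0 : c 0 = f x₀ := by
    refine Subtype.ext ?_
    change Function.update _ _ _ = _
    simp [← hv]
  have hopen : IsOpen (c ⁻¹' range f) := ho.isOpen_range.preimage hc
  have h0 : (0 : unitInterval) ∈ c ⁻¹' range f := ⟨x₀, hc0.symm⟩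
  obtain ⟨s, hs, hs0⟩ : ∃ s ∈ c ⁻¹' range f, (0 : unitInterval) < s := by
    have h1 : (𝓝[>] (0 : unitInterval)).NeBot := nhdsGT_neBot_of_exists_gt ⟨1, zero_lt_one⟩
    have h2 : c ⁻¹' range f ∈ 𝓝[>] (0 : unitInterval) :=
      mem_nhdsWithin_of_mem_nhds (hopen.mem_nhds h0)
    exact (h1.nonempty_of_mem (Filter.inter_mem h2 self_mem_nhdsWithin))
  obtain ⟨x, hx⟩ := hs
  have h3 : (c s).1 (Sum.inr j) = v (Sum.inr j) + s * (t - v (Sum.inr j)) :=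
    Function.update_self _ _ _
  rw [← hx, hf] at h3
  have h4 : 0 ≤ x.1 (Sum.inr j) := by
    have := x.2 (Sum.inr j) (mem_univ _)
    simp only [rectSide, typedCubeSide, Sum.elim_inr, if_pos hj] at this
    exact this.1
  have h5 : (0 : ℝ) < s := hs0
  nlinarith [mul_nonneg (ha (Sum.inr j)).le h4]

/-- There is no open rectilinear map `□^{p,R} → □^{p,Q}` unless `R ⊆ Q`. -/
theorem Rect.subset {R Q : Finset (Fin q)} (f : Rect (rectSet p (some R)) (rectSet p (some Q))) :
    R ⊆ Q := by
  intro j hj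
  by_contra hQ
  obtain ⟨a, v, ha, hf⟩ := f.2.1
  have hv : v (Sum.inr j) ∈ rectSide p (some Q) (Sum.inr j) := by
    have := (f.1 ⟨0, zero_mem_rectSet _⟩).2 (Sum.inr j) (mem_univ _)
    rw [hf] at this
    simpa using this
  simp only [rectSide, typedCubeSide, Sum.elim_inr, if_neg hQ] at hv
  have := Rect.le_of_mem f.2.2 ha hf hj (t := (v (Sum.inr j) - 1) / 2) (by
    simp only [rectSide, typedCubeSide, Sum.elim_inr, if_neg hQ]
    constructor <;> linarith [hv.1, hv.2])
  linarith [hv.1]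

/-- A rectilinear map from `□^{p,Q}` to the quadrant is open if it does not translate the
coordinates in `Q`. -/
theorem Rect.isOpenMap_of_forall {Q : Finset (Fin q)}
    {f : rectSet p (some Q) → rectSet p (none : Option (Finset (Fin q)))}
    {a v : Fin p ⊕ Fin q → ℝ} (ha : ∀ i, 0 < a i) (hf : ∀ x i, (f x).1 i = a i * x.1 i + v i)
    (hv : ∀ j ∈ Q, v (Sum.inr j) = 0) : IsOpenMap f := by
  rintro _ ⟨O, hO, rfl⟩
  let h : (Fin p ⊕ Fin q → ℝ) → Fin p ⊕ Fin q → ℝ := fun y i => (y i - v i) / a i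
  have hh : Continuous h := by fun_prop
  have hB : IsOpen (Set.pi univ fun _ : Fin p ⊕ Fin q => Ioo (-1 : ℝ) 1) :=
    isOpen_set_pi finite_univ fun _ _ => isOpen_Ioo
  have hhf : ∀ x, h (f x).1 = x.1 := fun x => funext fun i => by
    simp only [h, hf]
    field_simp [(ha i).ne']
    ring
  refine ⟨h ⁻¹' (O ∩ Set.pi univ fun _ => Ioo (-1) 1), (hO.inter hB).preimage hh, ?_⟩
  ext y
  constructor
  · rintro ⟨hyO, hyB⟩
    have hmem : h y.1 ∈ rectSet p (some Q) := by
      rintro (i | j) -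
      · exact hyB _ (mem_univ _)
      · have h1 := hyB (Sum.inr j) (mem_univ _)
        by_cases hj : j ∈ Q
        · simp only [rectSide, typedCubeSide, Sum.elim_inr, if_pos hj]
          refine ⟨?_, h1.2⟩
          simp only [h, hv j hj, sub_zero]
          exact div_nonneg (y.2 (Sum.inr j) (mem_univ _)) (ha _).le
        · simp only [rectSide, typedCubeSide, Sum.elim_inr, if_neg hj]
          exact h1
    refine ⟨⟨h y.1, hmem⟩, hyO, Subtype.ext (funext fun i => ?_)⟩
    rw [hf]
    simp only [h]
    field_simp [(ha i).ne']
    ring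
  · rintro ⟨x, hx, rfl⟩
    rw [mem_preimage, mem_preimage, hhf]
    refine ⟨hx, ?_⟩
    rintro (i | j) -
    · exact x.2 (Sum.inl i) (mem_univ _)
    · have h1 := x.2 (Sum.inr j) (mem_univ _)
      by_cases hj : j ∈ Q
      · simp only [rectSide, typedCubeSide, Sum.elim_inr, if_pos hj] at h1
        exact ⟨by linarith [h1.1], h1.2⟩
      · simpa only [rectSide, typedCubeSide, Sum.elim_inr, if_neg hj] using h1

/-- The inclusion `□^{p,Q} → ℝ^{p,q}`, which translates the coordinates `j ∉ Q` by `1`. -/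
def incl (p : ℕ) {q : ℕ} (Q : Finset (Fin q)) :
    Rect (rectSet p (some Q)) (rectSet p (none : Option (Finset (Fin q)))) :=
  ⟨⟨fun x => ⟨x.1 + Sum.elim (fun _ => 0) (fun j => if j ∈ Q then 0 else 1), by
      rintro (i | j) -
      · exact mem_univ _
      · have h1 := x.2 (Sum.inr j) (mem_univ _)
        change (0 : ℝ) ≤ _
        by_cases hj : j ∈ Q
        · simp only [rectSide, typedCubeSide, Sum.elim_inr, if_pos hj] at h1
          simpa [hj] using h1.1
        · simp only [rectSide, typedCubeSide, Sum.elim_inr, if_neg hj] at h1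
          simp only [Pi.add_apply, Sum.elim_inr, if_neg hj]
          linarith [h1.1]⟩,
    by fun_prop⟩,
    ⟨1, Sum.elim (fun _ => 0) (fun j => if j ∈ Q then 0 else 1), fun _ => one_pos, fun x i => by
      simp⟩,
    Rect.isOpenMap_of_forall (a := 1)
      (v := Sum.elim (fun _ => 0) (fun j => if j ∈ Q then 0 else 1)) (fun _ => one_pos)
      (fun x i => by simp) fun j hj => by simp [hj]⟩

theorem Rect.translation_eq_zero {Q : Finset (Fin q)}
    (f : Rect (rectSet p (some Q)) (rectSet p (none : Option (Finset (Fin q)))))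
    {a v : Fin p ⊕ Fin q → ℝ} (ha : ∀ i, 0 < a i)
    (hf : ∀ x i, (f.1 x).1 i = a i * x.1 i + v i) {j : Fin q} (hj : j ∈ Q) :
    v (Sum.inr j) = 0 := by
  refine le_antisymm (Rect.le_of_mem f.2.2 ha hf hj (mem_Ici.2 le_rfl)) ?_
  have h : (0 : ℝ) ≤ _ := (f.1 ⟨0, zero_mem_rectSet _⟩).2 (Sum.inr j) (mem_univ _)
  rw [hf] at h
  simpa using h

/-- The point at time `t` of the straight-line path, of length one, between two open rectilinear
maps from `□^{p,Q}` to the quadrant. -/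
def straightLine {Q : Finset (Fin q)}
    (f g : Rect (rectSet p (some Q)) (rectSet p (none : Option (Finset (Fin q))))) (t : ℝ≥0) :
    Rect (rectSet p (some Q)) (rectSet p (none : Option (Finset (Fin q)))) :=
  ⟨⟨fun x => ⟨(1 - (min t 1 : ℝ≥0) : ℝ) • (f.1 x).1 + ((min t 1 : ℝ≥0) : ℝ) • (g.1 x).1,
      convex_pi (fun i _ => (isSide_rectSide none i).convex) (f.1 x).2 (g.1 x).2
        (sub_nonneg.2 (by exact_mod_cast min_le_right t 1)) (min t 1).2 (by simp)⟩,
    by fun_prop⟩, by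
    obtain ⟨a, v, ha, hf⟩ := f.2.1
    obtain ⟨b, w, hb, hg⟩ := g.2.1
    have h0 : (0 : ℝ) ≤ ((min t 1 : ℝ≥0) : ℝ) := (min t 1).2
    have h1 : ((min t 1 : ℝ≥0) : ℝ) ≤ 1 := by exact_mod_cast min_le_right t 1
    set s : ℝ := ((min t 1 : ℝ≥0) : ℝ)
    have hpos : ∀ i, 0 < (1 - s) * a i + s * b i := fun i => by
      rcases h0.eq_or_lt with h0 | h0
      · rw [← h0]
        simpa using ha i
      · nlinarith [mul_pos h0 (hb i), mul_nonneg (sub_nonneg.2 h1) (ha i).le]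
    have heq : ∀ (x : rectSet p (some Q)) (i : Fin p ⊕ Fin q),
        ((1 - s) • (f.1 x).1 + s • (g.1 x).1) i =
          ((1 - s) * a i + s * b i) * x.1 i + ((1 - s) * v i + s * w i) := fun x i => by
      simp only [Pi.add_apply, Pi.smul_apply, smul_eq_mul, hf, hg]
      ring
    exact ⟨⟨_, _, hpos, heq⟩, Rect.isOpenMap_of_forall hpos heq fun j hj => by
      rw [f.translation_eq_zero ha hf hj, g.translation_eq_zero hb hg hj]
      simp⟩⟩

theorem continuous_straightLine {Q : Finset (Fin q)} {T : Type*} [TopologicalSpace T]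
    {f g : T → Rect (rectSet p (some Q)) (rectSet p (none : Option (Finset (Fin q))))}
    {t : T → ℝ≥0} (hf : Continuous f) (hg : Continuous g) (ht : Continuous t) :
    Continuous fun s => straightLine (f s) (g s) (t s) := by
  refine Continuous.subtype_mk (ContinuousMap.continuous_of_continuous_uncurry _ ?_) _
  refine Continuous.subtype_mk ?_ _
  have h1 : Continuous fun s : T × rectSet p (some Q) => ((f s.1).1 s.2).1 :=
    continuous_subtype_val.comp
      (((continuous_subtype_val.comp hf).comp continuous_fst).eval continuous_snd)
  have h2 : Continuous fun s : T × rectSet p (some Q) => ((g s.1).1 s.2).1 :=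
    continuous_subtype_val.comp
      (((continuous_subtype_val.comp hg).comp continuous_fst).eval continuous_snd)
  have h3 : Continuous fun s : T × rectSet p (some Q) => ((min (t s.1) 1 : ℝ≥0) : ℝ) :=
    NNReal.continuous_coe.comp ((ht.comp continuous_fst).min continuous_const)
  exact ((continuous_const.sub h3).smul h1).add (h3.smul h2)

theorem straightLine_zero {Q : Finset (Fin q)}
    (f g : Rect (rectSet p (some Q)) (rectSet p (none : Option (Finset (Fin q))))) :
    straightLine f g 0 = f := by
  refine Subtype.ext (ContinuousMap.ext fun x => Subtype.ext ?_)
  change (1 - ((min 0 1 : ℝ≥0) : ℝ)) • (f.1 x).1 + ((min 0 1 : ℝ≥0) : ℝ) • (g.1 x).1 = _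
  simp

theorem straightLine_of_one_le {Q : Finset (Fin q)}
    (f g : Rect (rectSet p (some Q)) (rectSet p (none : Option (Finset (Fin q))))) {t : ℝ≥0}
    (ht : 1 ≤ t) : straightLine f g t = g := by
  refine Subtype.ext (ContinuousMap.ext fun x => Subtype.ext ?_)
  change (1 - ((min t 1 : ℝ≥0) : ℝ)) • (f.1 x).1 + ((min t 1 : ℝ≥0) : ℝ) • (g.1 x).1 = _
  simp [min_eq_right ht]

/-! ### Rectilinear maps as smooth embeddings -/

/-- The boxes underlying `□^{p+q-|Q|,|Q|}` (`some Q`) and `ℝ^{p,q}` (`none`). -/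
def stdBox (p : ℕ) {q : ℕ} : Option (Finset (Fin q)) → Box
  | none => quadrant p q
  | some Q => cube (p + (q - Q.card)) Q.card

/-- The bijection of coordinates identifying `□^{p+q-|Q|,|Q|}` with `□^{p,Q}`: it is order
preserving on the coordinates in `Q`, and on the coordinates not in `Q`. -/
def typeEquiv (p : ℕ) {q : ℕ} (Q : Finset (Fin q)) :
    Fin (p + (q - Q.card)) ⊕ Fin Q.card ≃ Fin p ⊕ Fin q :=
  (Equiv.sumCongr finSumFinEquiv.symm (Equiv.refl (Fin Q.card))).trans <|
  (Equiv.sumAssoc (Fin p) (Fin (q - Q.card)) (Fin Q.card)).trans <|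
  Equiv.sumCongr (Equiv.refl (Fin p)) <|
  (Equiv.sumComm (Fin (q - Q.card)) (Fin Q.card)).trans <|
  finSumEquivOfFinset (s := Q) rfl (by rw [Finset.card_compl, Fintype.card_fin])

theorem cubeSide_typeEquiv (p : ℕ) {q : ℕ} (Q : Finset (Fin q))
    (i : Fin (p + (q - Q.card)) ⊕ Fin Q.card) :
    cubeSide (p + (q - Q.card)) Q.card i = typedCubeSide p Q (typeEquiv p Q i) := by
  rcases i with i | j
  · obtain ⟨i, rfl⟩ := finSumFinEquiv.surjective i
    rcases i with i | j
    · simp [typeEquiv, cubeSide, typedCubeSide]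
    · have h := Finset.mem_compl.1 (Finset.orderEmbOfFin_mem Qᶜ
        (by rw [Finset.card_compl, Fintype.card_fin] : Qᶜ.card = q - Q.card) j)
      simp [typeEquiv, cubeSide, typedCubeSide, h]
  · simp [typeEquiv, cubeSide, typedCubeSide]

/-- The identification of the coordinates of `stdBox p a` with those of `rectSet p a`. -/
def coordEquiv (p : ℕ) {q : ℕ} : ∀ a : Option (Finset (Fin q)),
    (stdBox p a).Coord ≃ Fin p ⊕ Fin q
  | none => Equiv.refl _
  | some Q => typeEquiv p Q

theorem side_stdBox (p : ℕ) {q : ℕ} : ∀ (a : Option (Finset (Fin q))) (i : (stdBox p a).Coord),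
    (stdBox p a).side i = rectSide p a (coordEquiv p a i)
  | none, _ => rfl
  | some Q, i => cubeSide_typeEquiv p Q i

/-- The permutation of coordinates from `□^{p,Q}` to `□^{p+q-|Q|,|Q|}`. -/
def pointEquiv (p : ℕ) {q : ℕ} (a : Option (Finset (Fin q))) :
    rectSet p a ≃ₜ (stdBox p a).set where
  toFun x := ⟨fun i => x.1 (coordEquiv p a i), fun i _ => by
    rw [side_stdBox]
    exact x.2 _ (mem_univ _)⟩
  invFun y := ⟨fun i => y.1 ((coordEquiv p a).symm i), fun i _ => by
    have h := y.2 ((coordEquiv p a).symm i) (mem_univ _)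
    rwa [side_stdBox, Equiv.apply_symm_apply] at h⟩
  left_inv x := by simp
  right_inv y := by simp
  continuous_toFun := by
    refine Continuous.subtype_mk (continuous_pi fun i => ?_) _
    exact (continuous_apply _).comp continuous_subtype_val
  continuous_invFun := by
    refine Continuous.subtype_mk (continuous_pi fun i => ?_) _
    exact (continuous_apply _).comp continuous_subtype_val

/-- The scaling coefficients of a rectilinear map. -/
def Rect.slope {a b : Option (Finset (Fin q))} (f : Rect (rectSet p a) (rectSet p b))
    (i : Fin p ⊕ Fin q) : ℝ := f.2.1.choose i

/-- The translation part of a rectilinear map. -/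
def Rect.shift {a b : Option (Finset (Fin q))} (f : Rect (rectSet p a) (rectSet p b))
    (i : Fin p ⊕ Fin q) : ℝ := f.2.1.choose_spec.choose i

theorem Rect.slope_pos {a b : Option (Finset (Fin q))} (f : Rect (rectSet p a) (rectSet p b))
    (i : Fin p ⊕ Fin q) : 0 < f.slope i := f.2.1.choose_spec.choose_spec.1 i

theorem Rect.apply_eq {a b : Option (Finset (Fin q))} (f : Rect (rectSet p a) (rectSet p b))
    (x : rectSet p a) (i : Fin p ⊕ Fin q) : (f.1 x).1 i = f.slope i * x.1 i + f.shift i :=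
  f.2.1.choose_spec.choose_spec.2 x i

theorem half_mem_rectSet (a : Option (Finset (Fin q))) :
    (fun _ => 1 / 2 : Fin p ⊕ Fin q → ℝ) ∈ rectSet p a := by
  rintro (i | j) -
  · rcases a with - | Q
    · simp [rectSide, quadrantSide]
    · change _ ∈ Ioo (-1 : ℝ) 1
      constructor <;> norm_num
  · rcases a with - | Q
    · change _ ∈ Ici (0 : ℝ)
      norm_num
    · by_cases h : j ∈ Q
      · simp only [rectSide, typedCubeSide, Sum.elim_inr, if_pos h]
        constructor <;> norm_num
      · simp only [rectSide, typedCubeSide, Sum.elim_inr, if_neg h]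
        constructor <;> norm_num

theorem Rect.continuous_apply {a b : Option (Finset (Fin q))} (x : rectSet p a)
    (i : Fin p ⊕ Fin q) :
    Continuous fun f : Rect (rectSet p a) (rectSet p b) => (f.1 x).1 i :=
  (_root_.continuous_apply i).comp (continuous_subtype_val.comp
    ((continuous_eval_const x).comp continuous_subtype_val))

theorem Rect.continuous_shift {a b : Option (Finset (Fin q))} (i : Fin p ⊕ Fin q) :
    Continuous fun f : Rect (rectSet p a) (rectSet p b) => f.shift i := by
  refine (Rect.continuous_apply ⟨0, zero_mem_rectSet a⟩ i).congr fun f => ?_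
  rw [f.apply_eq]
  simp

theorem Rect.continuous_slope {a b : Option (Finset (Fin q))} (i : Fin p ⊕ Fin q) :
    Continuous fun f : Rect (rectSet p a) (rectSet p b) => f.slope i := by
  refine (((Rect.continuous_apply ⟨_, half_mem_rectSet a⟩ i).sub
    (Rect.continuous_shift i)).mul_const 2).congr fun f => ?_
  change ((f.1 _).1 i - f.shift i) * 2 = _
  rw [f.apply_eq]
  ring

/-- An open rectilinear map, as a smooth open embedding. -/
def Rect.toSmoothEmb {a b : Option (Finset (Fin q))} (f : Rect (rectSet p a) (rectSet p b)) :
    SmoothEmb (stdBox p a) (stdBox p b) :=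
  ⟨fun y => pointEquiv p b (f.1 ((pointEquiv p a).symm y)), by
    have hinj : Function.Injective f.1 := fun x y h => Subtype.ext (funext fun i => by
      have h1 := congrArg (fun z : rectSet p b => z.1 i) h
      simp only [f.apply_eq] at h1
      exact mul_left_cancel₀ (f.slope_pos i).ne' (add_right_cancel h1))
    exact (pointEquiv p b).isOpenEmbedding.comp
      ((IsOpenEmbedding.of_continuous_injective_isOpenMap f.1.continuous hinj f.2.2).comp
        (pointEquiv p a).symm.isOpenEmbedding),
    ⟨univ, fun y i => f.slope (coordEquiv p b i) *
        y ((coordEquiv p a).symm (coordEquiv p b i)) + f.shift (coordEquiv p b i), isOpen_univ,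
      subset_univ _, ContDiff.contDiffOn (by fun_prop), fun u => funext fun i =>
        (f.apply_eq ((pointEquiv p a).symm u) (coordEquiv p b i)).symm⟩,
    ⟨univ, fun z i => (z ((coordEquiv p b).symm (coordEquiv p a i)) -
        f.shift (coordEquiv p a i)) / f.slope (coordEquiv p a i), isOpen_univ,
      fun _ => mem_univ _, ContDiff.contDiffOn (by fun_prop), fun u => funext fun i => by
        have h := f.apply_eq ((pointEquiv p a).symm u) (coordEquiv p a i)
        have h2 : ((pointEquiv p a).symm u).1 (coordEquiv p a i) = u.1 i :=
          congrArg u.1 (Equiv.symm_apply_apply _ _)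
        rw [h2] at h
        change ((f.1 ((pointEquiv p a).symm u)).1 (coordEquiv p b
          ((coordEquiv p b).symm (coordEquiv p a i))) - _) / _ = _
        rw [Equiv.apply_symm_apply, h]
        field_simp [(f.slope_pos (coordEquiv p a i)).ne']
        ring⟩⟩

theorem Rect.continuous_toSmoothEmb {a b : Option (Finset (Fin q))} :
    Continuous (Rect.toSmoothEmb : Rect (rectSet p a) (rectSet p b) → _) := by
  classical
  refine SmoothEmb.continuous_of_jet fun k => ?_
  let h : (stdBox p b).Coord → (stdBox p a).Space → (stdBox p b).Space := fun i y =>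
    Pi.single i (y ((coordEquiv p a).symm (coordEquiv p b i)))
  let c : (stdBox p b).Coord → (stdBox p a).Space → (stdBox p b).Space := fun i _ =>
    Pi.single i 1
  have hh : ∀ i, ContDiff ℝ ∞ (h i) := fun i =>
    (ContinuousLinearMap.single ℝ (fun _ : (stdBox p b).Coord => ℝ) i ∘L
      ContinuousLinearMap.proj (R := ℝ) (φ := fun _ : (stdBox p a).Coord => ℝ)
        ((coordEquiv p a).symm (coordEquiv p b i))).contDiff
  have hc : ∀ i, ContDiff ℝ ∞ (c i) := fun i => contDiff_const
  have hk : (k : WithTop ℕ∞) ≤ ∞ := by exact_mod_cast le_top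
  have key : ∀ (f : Rect (rectSet p a) (rectSet p b)) (u : (stdBox p a).set),
      SmoothEmb.jet k f.toSmoothEmb u = ∑ i,
        (f.slope (coordEquiv p b i) • iteratedFDerivWithin ℝ k (h i) (stdBox p a).set u +
          f.shift (coordEquiv p b i) • iteratedFDerivWithin ℝ k (c i) (stdBox p a).set u) := by
    intro f u
    have heq : EqOn f.toSmoothEmb.ambient (fun y => ∑ i, (f.slope (coordEquiv p b i) • h i +
        f.shift (coordEquiv p b i) • c i) y) (stdBox p a).set := fun y hy => by
      rw [f.toSmoothEmb.ambient_apply ⟨y, hy⟩]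
      funext j
      refine (f.apply_eq ((pointEquiv p a).symm ⟨y, hy⟩) (coordEquiv p b j)).trans ?_
      simp only [Finset.sum_apply, Pi.add_apply, Pi.smul_apply, h, c, Pi.single_apply, smul_eq_mul,
        mul_ite, mul_zero, mul_one]
      rw [Finset.sum_add_distrib]
      simp only [Finset.sum_ite_eq, Finset.mem_univ, if_true]
      rfl
    change iteratedFDerivWithin ℝ k _ _ _ = _
    have hu := (stdBox p a).uniqueDiffOn
    have h1 : ∀ i, ContDiffWithinAt ℝ k (f.slope (coordEquiv p b i) • h i) (stdBox p a).set u :=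
      fun i => (((hh i).of_le hk).const_smul (f.slope (coordEquiv p b i))).contDiffWithinAt
    have h2 : ∀ i, ContDiffWithinAt ℝ k (f.shift (coordEquiv p b i) • c i) (stdBox p a).set u :=
      fun i => (((hc i).of_le hk).const_smul (f.shift (coordEquiv p b i))).contDiffWithinAt
    rw [iteratedFDerivWithin_congr heq u.2, iteratedFDerivWithin_fun_sum_apply
      (f := fun i => f.slope (coordEquiv p b i) • h i + f.shift (coordEquiv p b i) • c i) hu u.2
      fun i _ => (h1 i).add (h2 i)]
    refine Finset.sum_congr rfl fun i _ => ?_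
    rw [iteratedFDerivWithin_add_apply (h1 i) (h2 i) hu u.2,
      iteratedFDerivWithin_const_smul_apply ((hh i).of_le hk).contDiffWithinAt hu u.2,
      iteratedFDerivWithin_const_smul_apply ((hc i).of_le hk).contDiffWithinAt hu u.2]
  simp only [key]
  have hcont : ∀ g : (stdBox p a).Space → (stdBox p b).Space, ContDiff ℝ ∞ g →
      Continuous fun u : (stdBox p a).set => iteratedFDerivWithin ℝ k g (stdBox p a).set u :=
    fun g hg => continuousOn_iff_continuous_domRestrict.1
      (hg.contDiffOn.continuousOn_iteratedFDerivWithin hk (stdBox p a).uniqueDiffOn)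
  refine continuous_finsetSum _ fun i _ => ?_
  exact (((Rect.continuous_slope _).comp continuous_fst).smul
    ((hcont _ (hh i)).comp continuous_snd)).add
    (((Rect.continuous_shift _).comp continuous_fst).smul
      ((hcont _ (hc i)).comp continuous_snd))

/-- The functor which views open rectilinear maps between the cubes `□^{p,Q} ≅ □^{p+q-|Q|,|Q|}` and
the quadrant `ℝ^{p,q}` as smooth open embeddings. -/
def rectToSmooth (p q : ℕ) : TopFunctor (rectCat p q) smoothCat where
  obj a := stdBox p a
  map f := Rect.toSmoothEmb f
  continuous_map := Rect.continuous_toSmoothEmb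
  equiv a := (pointEquiv p a).toEquiv
  toFun_map {a b} f u := congrArg (fun x => pointEquiv p b (f.1 x))
    ((pointEquiv p a).symm_apply_apply u)

end Cubes

/-! ### The operads -/

/-- The cube `□^{p,Q}`. -/
def typedCube (p q : ℕ) (Q : Finset (Fin q)) : (rectCat p q).Obj := some Q

/-- The quadrant `ℝ^{p,q}`. -/
def rectQuadrant (p q : ℕ) : (rectCat p q).Obj := none

/-- The generalized Swiss-cheese operad `E_{p,q}`: its colours are the subsets of `{1, …, q}`, and
its operations `(Q i)_i → Q` are the families of open rectilinear maps `□^{p,Q i} → □^{p,Q}` which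
are injective on the disjoint union. (By `Rect.subset`, there are no such families unless `Q i ⊆ Q`
for all `i`.) -/
def swissCheeseOperad (p q : ℕ) : TopOperad :=
  (rectCat p q).embOperad (typedCube p q)

/-- The little `ℝ^{p,q}`-discs operad: its colours are the cubes `□^{a,b}` together with a smooth
open embedding into `ℝ^{p,q}`. -/
def littleDiscsOperad (p q : ℕ) : TopOperad :=
  smoothCat.sliceOperad (C := Σ a b : ℕ, SmoothEmb (cube a b) (quadrant p q)) (quadrant p q)
    (fun c => cube c.1 c.2.1) (fun c => c.2.2)

/-- The operad of rectilinear embeddings over `ℝ^{p,q}`: operations are operations of `E_{p,q}`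
together with Moore paths, in the space of open rectilinear maps `□^{p,Q i} → ℝ^{p,q}`, from the
inclusion of `□^{p,Q i}` to its embedding through `□^{p,Q}`. -/
def rectSliceOperad (p q : ℕ) : TopOperad :=
  (rectCat p q).sliceOperad (rectQuadrant p q) (typedCube p q) (incl p)

/-- The projection to `E_{p,q}`. -/
def toSwissCheese (p q : ℕ) : TopOperadHom (rectSliceOperad p q) (swissCheeseOperad p q) :=
  (rectCat p q).sliceForget (rectQuadrant p q) (typedCube p q) (incl p)

/-- The cube `□^{p,Q}` and its inclusion in `ℝ^{p,q}`, as a colour of the little discs operad. -/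
def discOfType (p q : ℕ) (Q : Finset (Fin q)) : Σ a b : ℕ, SmoothEmb (cube a b) (quadrant p q) :=
  ⟨p + (q - Q.card), Q.card, (incl p Q).toSmoothEmb⟩

/-- The morphism to the little discs operad which views rectilinear maps as smooth embeddings. -/
def toLittleDiscs (p q : ℕ) : TopOperadHom (rectSliceOperad p q) (littleDiscsOperad p q) :=
  (smoothCat.sliceRecolor (quadrant p q) (fun c => cube c.1 c.2.1) (fun c => c.2.2)
    (discOfType p q)).comp ((rectToSmooth p q).sliceMap (rectQuadrant p q) (typedCube p q) (incl p))

/-- The section of `toSwissCheese` on spaces of operations, given by straight-line paths. -/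
def straighten {p q : ℕ} {I : Type} (x : I → Finset (Fin q)) (y : Finset (Fin q)) :
    C((rectCat p q).MultiHom (fun i => typedCube p q (x i)) (typedCube p q y),
      TopCategory.SliceMul (rectQuadrant p q) (typedCube p q) (incl p) x y) where
  toFun f := ⟨(f, fun i => (1, ⟨straightLine (incl p (x i)) (Rect.comp (incl p y) (f.1 i)),
      continuous_straightLine continuous_const continuous_const continuous_id⟩)), fun i =>
    ⟨straightLine_zero _ _, fun s hs => straightLine_of_one_le _ _ hs⟩⟩
  continuous_toFun := by
    refine Continuous.subtype_mk (continuous_id.prodMk (continuous_pi fun i =>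
      continuous_const.prodMk (ContinuousMap.continuous_of_continuous_uncurry _ ?_))) _
    have h : Continuous fun t : (rectCat p q).MultiHom (fun i => typedCube p q (x i))
        (typedCube p q y) × ℝ≥0 =>
          (rectCat p q).comp (a := typedCube p q (x i)) (b := typedCube p q y)
            (c := rectQuadrant p q) (incl p y) (t.1.1 i) :=
      (rectCat p q).continuous_comp.comp (continuous_const.prodMk
        ((continuous_apply i).comp (continuous_subtype_val.comp continuous_fst)))
    exact continuous_straightLine continuous_const h continuous_snd

theorem toSwissCheese_straighten {p q : ℕ} {I : Type} [Finite I]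
    (x : I → (swissCheeseOperad p q).Color) (y : (swissCheeseOperad p q).Color)
    (f : (swissCheeseOperad p q).Mul x y) :
    (toSwissCheese p q).onMul x y (straighten x y f) = f := rfl

/-- The colour of the little discs operad corresponding to a colour of `E_{p,q}`. -/
def canonicalColor (p q : ℕ) (Q : (swissCheeseOperad p q).Color) :
    (littleDiscsOperad p q).Color :=
  discOfType p q Q

/-- The canonical map on spaces of operations: it sends a family of open rectilinear maps to the
same family, regarded as a family of smooth open embeddings, together with the straight-line
paths. -/
def canonicalMap (p q : ℕ) {I : Type} [Finite I] (x : I → (swissCheeseOperad p q).Color)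
    (y : (swissCheeseOperad p q).Color) :
    C((swissCheeseOperad p q).Mul x y,
      (littleDiscsOperad p q).Mul (fun i => canonicalColor p q (x i)) (canonicalColor p q y)) :=
  ContinuousMap.comp (β := TopCategory.SliceMul (rectQuadrant p q) (typedCube p q) (incl p) x y)
    ((toLittleDiscs p q).onMul x y) (straighten x y)

end LittleCubes

end

noncomputable section

namespace LittleCubes

/-! ### A criterion for weak homotopy equivalences -/

section Criterion

open unitInterval

/-! The two morphisms out of the operad of rectilinear embeddings over the quadrant are treated
separately. The canonical map is a section of the first on operations, followed by the second, so it
is a weak equivalence once both are.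

Forgetting the paths: positivity of slopes and vanishing of the shifts in the closed coordinates are
convex conditions. A path of open rectilinear maps into the quadrant can therefore be interpolated
linearly to the straight-line path with the same endpoints (`straightenDeformation`).

Passing to smooth embeddings: on operations this map is a topological embedding, and its image
consists of the operations whose paths are rectilinear at all times. A compact family of operations
is deformed into the image in two stages (`DiscMul.exists_deformation`). The cubes are first shrunk
towards their centres until they are tiny compared with all distances that matter. Then a cube
follows its own path only up to a fraction of its length, after which it is merely translated so
that its centre keeps to the original trajectory. When the fraction reaches 0, what remains is a
scaled and translated copy of the initial embedding, which is rectilinear. Scaling and translating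
keep rectilinear operations rectilinear, so the image is preserved throughout.

The translations must respect the boundary of the quadrant. The derivative shows that a smooth open
embedding preserves the depth of the corner at the centre (`card_zeroCoords`). Hence the set of
coordinates vanishing at the image of the centre is constant along paths (`zeroCoords_eq`). Those
coordinates are not translated, and the others stay bounded away from 0 by compactness.

Such deformations of cube families are converted into bijections on path components and homotopy
groups by `IsDeformable.isWeakHomotopyEquiv`; a collar of the cube makes them relative to the
boundary.

Essential surjectivity for the little discs: given an embedded cube, let `Q` be its set of vanishing
coordinates. The standard cube of type `Q` has the same shape, and can be shrunk and translated into
the given one (`exists_joined_comp`). A unary operation preserving the centre has a right inverse up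
to homotopy, built by running its path backwards (`DiscMul.exists_rightInverse`). That inverse again
preserves the centre, so it has a right inverse too, and the operation is invertible in the homotopy
category. -/

theorem isClosed_cubeBoundary (N : Type*) [Finite N] : IsClosed (Cube.boundary N) := by
  have h : Cube.boundary N = ⋃ i, ({y | y i = 0} ∪ {y | y i = 1}) := by
    ext y
    simp [Cube.boundary]
  rw [h]
  refine isClosed_iUnion_of_finite fun i => ?_
  exact (isClosed_eq (continuous_apply i) continuous_const).union
    (isClosed_eq (continuous_apply i) continuous_const)

/-- A collar of the boundary of a cube: the map `κ` expands an inner cube to the whole cube and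
sends the complement to the boundary, where `μ` is a coordinate. -/
theorem exists_cubeCollar (N : Type*) [Finite N] :
    ∃ (κ : C(N → I, N → I)) (μ : C(N → I, I)) (J : C(I × (N → I), N → I)),
      (∀ x ∈ Cube.boundary N, μ x = 0) ∧ (∀ x, μ x = 1 ∨ κ x ∈ Cube.boundary N) ∧
      (∀ x, J (0, x) = κ x) ∧ (∀ x, J (1, x) = x) ∧ ∀ s, ∀ x ∈ Cube.boundary N, J (s, x) = x := by
  have := Fintype.ofFinite N
  -- Coordinates centred at the midpoint: the boundary of the cube becomes the unit sphere of the
  -- sup norm, and the inner cube is the ball of radius 1/2.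
  let v : (N → I) → N → ℝ := fun x i => 2 * (x i : ℝ) - 1
  have hv : Continuous v := by fun_prop
  have hv1 : ∀ x, ‖v x‖ ≤ 1 := fun x => (pi_norm_le_iff_of_nonneg zero_le_one).2 fun i => by
    rw [Real.norm_eq_abs, abs_le]
    constructor <;> simp only [v] <;> linarith [(x i).2.1, (x i).2.2]
  have hvb : ∀ x ∈ Cube.boundary N, ‖v x‖ = 1 := by
    rintro x ⟨i, hi⟩
    refine le_antisymm (hv1 x) (le_trans ?_ (norm_le_pi_norm (v x) i))
    rcases hi with hi | hi <;> norm_num [v, hi]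
  have hpos : ∀ x, 0 < max ‖v x‖ (1 / 2) := fun x => lt_max_of_lt_right (by norm_num)
  have hn : Continuous fun x => max ‖v x‖ (1 / 2) := by fun_prop
  -- Doubles the inner cube and projects the outer shell radially onto the boundary.
  let k : (N → I) → N → ℝ := fun x i => (v x i / max ‖v x‖ (1 / 2) + 1) / 2
  have hk : Continuous k := by
    refine continuous_pi fun i => ?_
    exact ((((continuous_apply i).comp hv).div hn fun x => (hpos x).ne').add_const 1).div_const 2
  have hkm : ∀ x i, k x i ∈ I := fun x i => by
    have h1 : |v x i / max ‖v x‖ (1 / 2)| ≤ 1 := by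
      rw [abs_div, abs_of_pos (hpos x), div_le_one (hpos x)]
      exact (norm_le_pi_norm (v x) i).trans (le_max_left _ _)
    rw [abs_le] at h1
    constructor <;> simp only [k] <;> linarith [h1.1, h1.2]
  have hkb : ∀ x ∈ Cube.boundary N, ∀ i, k x i = x i := fun x hx i => by
    simp only [k, hvb x hx, v]
    norm_num
  refine ⟨⟨fun x i => ⟨k x i, hkm x i⟩, by fun_prop⟩,
    ⟨fun x => projIcc 0 1 zero_le_one (2 - 2 * ‖v x‖), by fun_prop⟩,
    ⟨fun t i => ⟨(1 - t.1) * k t.2 i + t.1 * t.2 i, ?_⟩, ?_⟩, fun x hx => ?_, fun x => ?_,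
    fun x => ?_, fun x => ?_, fun s x hx => ?_⟩
  · exact (convex_Icc (0 : ℝ) 1) (hkm t.2 i) (t.2 i).2 (by linarith [t.1.2.2]) t.1.2.1 (by ring)
  · fun_prop
  · simp [hvb x hx]
  · rcases le_or_gt ‖v x‖ (1 / 2) with h | h
    · left
      exact projIcc_of_right_le zero_le_one (by linarith)
    · right
      have hne : Nonempty N := by
        by_contra hN
        rw [not_nonempty_iff] at hN
        have : v x = 0 := Subsingleton.elim _ _
        rw [this] at h
        norm_num at h
      obtain ⟨i, hi⟩ := Finite.exists_max fun i => ‖v x i‖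
      replace hi : ‖v x i‖ = ‖v x‖ := le_antisymm (norm_le_pi_norm (v x) i)
        ((pi_norm_le_iff_of_nonneg (norm_nonneg _)).2 hi)
      refine ⟨i, ?_⟩
      have hm : max ‖v x‖ (1 / 2) = ‖v x‖ := max_eq_left h.le
      have h0 : ‖v x‖ ≠ 0 := by linarith
      rcases le_total 0 (v x i) with h' | h'
      · right
        refine Subtype.ext ?_
        change k x i = 1
        rw [Real.norm_of_nonneg h'] at hi
        simp only [k, hm, hi, div_self h0]
        norm_num
      · left
        refine Subtype.ext ?_
        change k x i = 0
        rw [Real.norm_of_nonpos h'] at hi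
        simp only [k, hm]
        rw [← hi, div_neg, div_self (by linarith)]
        norm_num
  · funext i
    refine Subtype.ext ?_
    simp
  · funext i
    refine Subtype.ext ?_
    simp
  · funext i
    refine Subtype.ext ?_
    change (1 - (s : ℝ)) * k x i + s * x i = x i
    rw [hkb x hx]
    ring

variable {X Y : Type*} [TopologicalSpace X] [TopologicalSpace Y]

/-- Deformability of maps of cubes into the target to maps which lift to the source, compatibly
with given lifts. -/
def IsDeformable (f : C(X, Y)) : Prop :=
  ∀ (N : Type) [Finite N] (S : C(N → I, Y)), ∃ (H : C((N → I) × I, Y)) (L : C(N → I, X))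
    (h : C({q : (N → I) × X // S q.1 = f q.2} × I, X)),
    (∀ k, H (k, 0) = S k) ∧ (∀ k, H (k, 1) = f (L k)) ∧ (∀ q t, f (h (q, t)) = H (q.1.1, t)) ∧
      (∀ q, h (q, 0) = q.1.2) ∧ ∀ q, h (q, 1) = L q.1.1

/-- The inner cube of the collar carries the lift `L`, expanded. On the shell, which projects to the
boundary, the path `h` leads from the prescribed lift on the outside to `L` on the inside. Both are
compatible with `H`, so the result lies over `H (κ x, μ x)`. -/
theorem IsDeformable.exists_lift {f : C(X, Y)} (hf : IsDeformable f) {N : Type} [Finite N]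
    (S : C(N → I, Y)) (a : C(Cube.boundary N, X)) (ha : ∀ x, f (a x) = S x) :
    ∃ L : C(N → I, X), (∀ x : Cube.boundary N, L x = a x) ∧
      (f.comp L).HomotopicRel S (Cube.boundary N) := by
  classical
  obtain ⟨H, L, h, H0, H1, hH, h0, h1⟩ := hf N S
  obtain ⟨κ, μ, J, hμ, hκ, J0, J1, Jb⟩ := exists_cubeCollar N
  have hκb : ∀ x ∈ Cube.boundary N, κ x = x := fun x hx => by rw [← J0, Jb 0 x hx]
  let P : ∀ x, κ x ∈ Cube.boundary N → {q : (N → I) × X // S q.1 = f q.2} := fun x hx =>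
    ⟨(κ x, a ⟨κ x, hx⟩), (ha ⟨κ x, hx⟩).symm⟩
  let L' : (N → I) → X := fun x =>
    if hx : κ x ∈ Cube.boundary N then h (P x hx, μ x) else L (κ x)
  have hA : EqOn L' (fun x => L (κ x)) {x | μ x = 1} := fun x (hx : μ x = 1) => by
    by_cases hb : κ x ∈ Cube.boundary N
    · simp only [L', dif_pos hb, hx, h1, P]
    · simp only [L', dif_neg hb]
  have hcA : ContinuousOn L' {x | μ x = 1} :=
    ContinuousOn.congr (L.continuous.comp κ.continuous).continuousOn hA
  have hcB : ContinuousOn L' {x | κ x ∈ Cube.boundary N} := by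
    rw [continuousOn_iff_continuous_domRestrict]
    have : domRestrict {x | κ x ∈ Cube.boundary N} L' = fun x => h (P x.1 x.2, μ x.1) :=
      funext fun x => dif_pos x.2
    rw [this]
    refine h.continuous.comp (Continuous.prodMk (Continuous.subtype_mk
      (Continuous.prodMk ?_ ?_) _) ?_)
    · exact κ.continuous.comp continuous_subtype_val
    · exact a.continuous.comp (Continuous.subtype_mk (κ.continuous.comp continuous_subtype_val) _)
    · exact μ.continuous.comp continuous_subtype_val
  have hc : Continuous L' := by
    have := hcA.union_of_isClosed hcB (isClosed_eq μ.continuous continuous_const)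
      ((isClosed_cubeBoundary N).preimage κ.continuous)
    rw [← continuousOn_univ]
    refine this.mono fun x _ => hκ x
  have hfL : ∀ x, f (L' x) = H (κ x, μ x) := fun x => by
    by_cases hb : κ x ∈ Cube.boundary N
    · simp only [L', dif_pos hb, hH, P]
    · rw [hA ((hκ x).resolve_right hb), (hκ x).resolve_right hb, H1]
  -- The homotopy to `S` undoes the collar by `J` and runs `H` back to time 0; on the boundary both
  -- are stationary.
  refine ⟨⟨L', hc⟩, fun x => ?_, ⟨⟨⟨⟨fun t => H (J t, σ t.1 * μ t.2), by fun_prop⟩,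
    fun x => ?_, fun x => ?_⟩, fun t x hx => ?_⟩⟩⟩
  · have hb : κ x.1 ∈ Cube.boundary N := by rw [hκb x.1 x.2]; exact x.2
    change L' x = a x
    simp only [L', dif_pos hb, hμ x.1 x.2, h0, P]
    exact congrArg a (Subtype.ext (hκb x.1 x.2))
  · change H (J (0, x), σ 0 * μ x) = f (L' x)
    rw [J0, hfL, symm_zero, one_mul]
  · change H (J (1, x), σ 1 * μ x) = S x
    rw [J1, symm_one, zero_mul, H0]
  · change H (J (t, x), σ t * μ x) = f (L' x)
    rw [Jb t x hx, hfL, hκb x hx, hμ x hx, mul_zero]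

/-- The given homotopy is a map from a cube with one more coordinate `none`. Its boundary carries
the lift `β` on the face `none = 1` and `α` on the remaining faces, and a lift extending this is the
required homotopy. -/
theorem IsDeformable.homotopicRel {f : C(X, Y)} (hf : IsDeformable f) {N : Type} [Finite N]
    {α β : C(N → I, X)} (hαβ : ∀ x ∈ Cube.boundary N, α x = β x)
    (h : (f.comp α).HomotopicRel (f.comp β) (Cube.boundary N)) :
    α.HomotopicRel β (Cube.boundary N) := by
  classical
  obtain ⟨G⟩ := h
  let S : C(Option N → I, Y) := ⟨fun y => G (y none, fun i => y (some i)), by fun_prop⟩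
  let a : (Option N → I) → X := fun y =>
    if y none = 1 then β (fun i => y (some i)) else α fun i => y (some i)
  have hA : ContinuousOn a {y | y none = 1} :=
    ContinuousOn.congr (f := fun y => β (fun i => y (some i)))
      (by fun_prop) fun y (hy : y none = 1) => if_pos hy
  have hB : ContinuousOn a {y | y none = 0 ∨ (fun i => y (some i)) ∈ Cube.boundary N} :=
    ContinuousOn.congr (f := fun y => α (fun i => y (some i)))
      (by fun_prop) fun y hy => by
        by_cases h1 : y none = 1
        · simp only [a, if_pos h1]
          refine (hαβ _ (Or.resolve_left hy fun h0 => ?_)).symm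
          rw [h0] at h1
          exact zero_ne_one h1
        · exact if_neg h1
  have hb : ∀ y ∈ Cube.boundary (Option N), y ∈ {y : Option N → I | y none = 1} ∪
      {y | y none = 0 ∨ (fun i => y (some i)) ∈ Cube.boundary N} := by
    rintro y ⟨_ | i, hi⟩
    · rcases hi with hi | hi
      · exact Or.inr (Or.inl hi)
      · exact Or.inl hi
    · exact Or.inr (Or.inr ⟨i, hi⟩)
  have hcont : ContinuousOn a (Cube.boundary (Option N)) := by
    refine (hA.union_of_isClosed hB (isClosed_eq (continuous_apply _) continuous_const) ?_).mono hb
    exact (isClosed_eq (continuous_apply _) continuous_const).union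
      ((isClosed_cubeBoundary N).preimage (by fun_prop))
  have hGb : ∀ t, ∀ x ∈ Cube.boundary N, G (t, x) = f (α x) := fun t x hx => G.eq_fst t hx
  obtain ⟨L, hL, -⟩ := hf.exists_lift S
    ⟨_, continuousOn_iff_continuous_domRestrict.1 hcont⟩ (fun y => by
      change f (a y.1) = G (y.1 none, fun i => y.1 (some i))
      by_cases h1 : y.1 none = 1
      · simp only [a, if_pos h1]
        rw [h1]
        exact (G.apply_one _).symm
      · simp only [a, if_neg h1]
        rcases hb y.1 y.2 with h | h | h
        · exact absurd h h1
        · rw [h]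
          exact (G.apply_zero _).symm
        · exact (hGb _ _ h).symm)
  let c : I × (N → I) → Option N → I := fun t o => o.elim t.1 t.2
  have hc : Continuous c := continuous_pi fun o => by
    cases o
    · exact continuous_fst
    · exact (continuous_apply _).comp continuous_snd
  have hLa : ∀ t, c t ∈ Cube.boundary (Option N) → L (c t) = a (c t) := fun t ht => hL ⟨c t, ht⟩
  refine ⟨⟨⟨⟨fun t => L (c t), by fun_prop⟩, fun x => ?_, fun x => ?_⟩, fun t x hx => ?_⟩⟩
  · exact (hLa (0, x) ⟨none, Or.inl rfl⟩).trans (if_neg zero_ne_one)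
  · exact (hLa (1, x) ⟨none, Or.inr rfl⟩).trans (if_pos rfl)
  · obtain ⟨i, hi⟩ := hx
    refine (hLa (t, x) ⟨some i, hi⟩).trans ?_
    change (if t = 1 then β x else α x) = α x
    split_ifs
    · exact (hαβ x ⟨i, hi⟩).symm
    · rfl

/-- A cube without coordinates is a point with empty boundary; this makes path components the case
`N = Empty` of the lifting statements. -/
theorem joined_of_homotopicRel_const {x y : X} {s : Set (Empty → I)}
    (h : (ContinuousMap.const (Empty → I) x).HomotopicRel (ContinuousMap.const _ y) s) :
    Joined x y := by
  obtain ⟨G⟩ := h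
  exact ⟨⟨⟨fun t => G (t, Empty.elim), by fun_prop⟩, G.apply_zero _, G.apply_one _⟩⟩

theorem homotopicRel_const_of_joined {x y : X} (h : Joined x y) :
    (ContinuousMap.const (Empty → I) x).HomotopicRel (ContinuousMap.const _ y)
      (Cube.boundary Empty) := by
  obtain ⟨p⟩ := h
  exact ⟨⟨⟨⟨fun t => p t.1, by fun_prop⟩, fun _ => p.source, fun _ => p.target⟩,
    fun _ _ hx => hx.choose.elim⟩⟩

/-- Surjectivity comes from `IsDeformable.exists_lift`, with a constant lift on the boundary for
homotopy groups, and injectivity from `IsDeformable.homotopicRel`. -/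
theorem IsDeformable.isWeakHomotopyEquiv {f : C(X, Y)} (hf : IsDeformable f) :
    IsWeakHomotopyEquiv f where
  bijective_pi0 := by
    constructor
    · rintro ⟨x⟩ ⟨y⟩ h
      exact Quotient.sound (joined_of_homotopicRel_const (hf.homotopicRel (N := Empty)
        (fun x hx => hx.choose.elim) (homotopicRel_const_of_joined (Quotient.exact h))))
    · rintro ⟨y⟩
      obtain ⟨L, -, h⟩ := hf.exists_lift (N := Empty) (ContinuousMap.const _ y)
        ⟨fun x => x.2.choose.elim, continuous_of_discreteTopology⟩ fun x => x.2.choose.elim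
      refine ⟨Quotient.mk _ (L Empty.elim), Quotient.sound ?_⟩
      have : f.comp L = ContinuousMap.const _ (f (L Empty.elim)) :=
        ContinuousMap.ext fun x => congrArg (fun z => f (L z)) (Subsingleton.elim _ _)
      rw [this] at h
      exact joined_of_homotopicRel_const h
  bijective_pi n x _ := by
    constructor
    · rintro ⟨α⟩ ⟨β⟩ h
      exact Quotient.sound (hf.homotopicRel (fun z hz => (α.2 z hz).trans (β.2 z hz).symm)
        (Quotient.exact h))
    · rintro ⟨γ⟩
      obtain ⟨L, hL, h⟩ := hf.exists_lift γ.1 (ContinuousMap.const _ x)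
        fun z => (γ.2 z.1 z.2).symm
      exact ⟨Quotient.mk _ ⟨L, fun z hz => hL ⟨z, hz⟩⟩, Quotient.sound h⟩

/-- An embedding is a weak homotopy equivalence if maps of cubes can be deformed into the image
without leaving the image. -/
theorem isWeakHomotopyEquiv_of_isEmbedding {f : C(X, Y)} (hf : IsEmbedding f)
    (h : ∀ (N : Type) [Finite N] (S : C(N → I, Y)), ∃ H : C((N → I) × I, Y),
      (∀ k, H (k, 0) = S k) ∧ (∀ k, H (k, 1) ∈ range f) ∧
        ∀ k t, S k ∈ range f → H (k, t) ∈ range f) : IsWeakHomotopyEquiv f := by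
  refine IsDeformable.isWeakHomotopyEquiv fun N _ S => ?_
  obtain ⟨H, H0, H1, Ht⟩ := h N S
  choose L hL using H1
  have hr : ∀ (q : {q : (N → I) × X // S q.1 = f q.2} × I), ∃ x, f x = H (q.1.1.1, q.2) :=
    fun q => Ht _ _ ⟨_, q.1.2.symm⟩
  choose l hl using hr
  refine ⟨H, ⟨L, hf.isInducing.continuous_iff.2 ?_⟩, ⟨l, hf.isInducing.continuous_iff.2 ?_⟩, H0,
    fun k => (hL k).symm, fun q t => hl (q, t), fun q => hf.injective ?_, fun q => hf.injective ?_⟩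
  · have : f ∘ L = fun k => H (k, 1) := funext hL
    rw [this]
    fun_prop
  · have : f ∘ l = fun q => H (q.1.1.1, q.2) := funext hl
    rw [this]
    fun_prop
  · exact (hl _).trans ((H0 _).trans q.2)
  · exact (hl _).trans (hL _).symm

/-- A section of a weak homotopy equivalence is a weak homotopy equivalence. -/
theorem IsWeakHomotopyEquiv.of_rightInverse {f : C(X, Y)} (hf : IsWeakHomotopyEquiv f)
    {s : C(Y, X)} (h : ∀ y, f (s y) = y) : IsWeakHomotopyEquiv s where
  bijective_pi0 := by
    have hs : Function.RightInverse (mapPi0 s) (mapPi0 f) := by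
      rintro ⟨y⟩
      exact congrArg (Quotient.mk _) (h y)
    refine ⟨hs.injective, fun x => ⟨mapPi0 f x, hf.bijective_pi0.1 (hs _)⟩⟩
  bijective_pi n y hn := by
    have hmap : ∀ (α : GenLoop (Fin n) X (s y)),
        f.comp (s.comp (f.comp α.1)) = f.comp α.1 := fun α =>
      ContinuousMap.ext fun z => h _
    constructor
    · rintro ⟨α⟩ ⟨β⟩ hαβ
      refine Quotient.sound ?_
      have := ContinuousMap.HomotopicRel.comp_continuousMap (Quotient.exact hαβ) f
      have e : ∀ α : GenLoop (Fin n) Y y, f.comp (s.comp α.1) = α.1 := fun α =>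
        ContinuousMap.ext fun z => h _
      change (f.comp (s.comp α.1)).HomotopicRel (f.comp (s.comp β.1)) _ at this
      rwa [e, e] at this
    · rintro ⟨α⟩
      -- The preimage of the class of `α` is that of `f ∘ α`: applying `s` and then `f` to it gives
      -- `f ∘ α` back, and `f` is injective on homotopy classes.
      refine ⟨Quotient.mk _ ⟨f.comp α.1, fun t ht =>
        (congrArg f (α.2 t ht)).trans (h y)⟩, (hf.bijective_pi n (s y) hn).1 ?_⟩
      refine Quotient.sound ?_
      change (f.comp (s.comp (f.comp α.1))).HomotopicRel (f.comp α.1) _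
      rw [hmap]
      exact ContinuousMap.HomotopicRel.refl _

theorem IsWeakHomotopyEquiv.comp {Z : Type*} [TopologicalSpace Z] {g : C(Y, Z)} {f : C(X, Y)}
    (hg : IsWeakHomotopyEquiv g) (hf : IsWeakHomotopyEquiv f) : IsWeakHomotopyEquiv (g.comp f) where
  bijective_pi0 := by
    have : mapPi0 (g.comp f) = mapPi0 g ∘ mapPi0 f := by
      funext x
      obtain ⟨x⟩ := x
      rfl
    rw [this]
    exact hg.bijective_pi0.comp hf.bijective_pi0
  bijective_pi n x hn := by
    have : mapPi n (g.comp f) x = mapPi n g (f x) ∘ mapPi n f x := by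
      funext α
      obtain ⟨α⟩ := α
      rfl
    rw [this]
    exact (hg.bijective_pi n _ hn).comp (hf.bijective_pi n x hn)

end Criterion

/-! ### Constructions of smooth open embeddings -/

section SmoothConstructions

variable {U V W : Box}

open Filter

namespace SmoothEmb

theorem ext' {f g : SmoothEmb U V} (h : ∀ u, (f.1 u).1 = (g.1 u).1) : f = g :=
  Subtype.ext (funext fun u => Subtype.ext (h u))

theorem continuous_apply (f : SmoothEmb U V) : Continuous f.1 := f.2.isOpenEmbedding.continuous

theorem continuous_eval_point {T : Type*} [TopologicalSpace T] {φ : T → SmoothEmb U V}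
    (u : U.set) (hφ : Continuous φ) : Continuous fun t => ((φ t).1 u).1 :=
  continuous_subtype_val.comp (continuous_eval.comp (hφ.prodMk continuous_const))

theorem continuous_eval_coord {T : Type*} [TopologicalSpace T] {φ : T → SmoothEmb U V}
    (u : U.set) (i : V.Coord) (hφ : Continuous φ) : Continuous fun t => ((φ t).1 u).1 i :=
  (_root_.continuous_apply i).comp (continuous_eval_point u hφ)

/-- A map which differs from a smooth open embedding by a translation which locally preserves the
target is a smooth open embedding. -/
theorem isSmoothOpenEmbedding_of_add (φ : SmoothEmb U V) {ψ : U.set → V.set} (w : V.Space)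
    (h : ∀ u, (ψ u).1 = (φ.1 u).1 + w) (hV : ∀ u, ∀ᶠ y in 𝓝[V.set] (ψ u).1, y - w ∈ V.set) :
    IsSmoothOpenEmbedding ψ := by
  obtain ⟨O, F, hO, hU, hF, hFφ⟩ := φ.2.smooth
  obtain ⟨O', G, hO', hφ, hG, hGφ⟩ := φ.2.smooth_inverse
  refine ⟨?_, ⟨O, fun x => F x + w, hO, hU, hF.add contDiffOn_const, fun u => by rw [h, ← hFφ]⟩,
    ⟨(fun y => y - w) ⁻¹' O', fun y => G (y - w), hO'.preimage (by fun_prop), fun u => ?_,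
      hG.comp (by fun_prop) (mapsTo_preimage _ _), fun u => ?_⟩⟩
  · refine IsOpenEmbedding.of_continuous_injective_isOpenMap ?_ (fun x y hxy => ?_) ?_
    · refine continuous_induced_rng.2 ?_
      have : Subtype.val ∘ ψ = fun u => (φ.1 u).1 + w := funext h
      rw [this]
      exact (continuous_subtype_val.comp φ.continuous_apply).add continuous_const
    · refine φ.2.isOpenEmbedding.injective (Subtype.ext ?_)
      have := congrArg Subtype.val hxy
      rw [h, h] at this
      exact add_right_cancel this
    · rw [isOpenMap_iff_nhds_le]
      intro u s hs
      rw [mem_map] at hs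
      have h1 : φ.1 '' (ψ ⁻¹' s) ∈ 𝓝 (φ.1 u) := φ.2.isOpenEmbedding.isOpenMap.image_mem_nhds hs
      rw [mem_nhds_subtype] at h1
      obtain ⟨t, ht, hts⟩ := h1
      have h2 : (fun y => y - w) ⁻¹' t ∈ 𝓝 (ψ u).1 := by
        refine ContinuousAt.preimage_mem_nhds (by fun_prop) ?_
        rwa [h, add_sub_cancel_right]
      rw [mem_nhds_subtype_iff_nhdsWithin]
      -- A point of the target near `ψ u`, moved back by `w`, lies in the target and close to `φ u`,
      -- hence in the open image of `φ`.
      filter_upwards [hV u, mem_nhdsWithin_of_mem_nhds h2, self_mem_nhdsWithin] with y hy hyt hyV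
      obtain ⟨z, hz, hzy⟩ := hts (show (⟨y - w, hy⟩ : V.set) ∈ Subtype.val ⁻¹' t from hyt)
      refine ⟨ψ z, hz, ?_⟩
      rw [h, hzy]
      exact sub_add_cancel y w
  · rw [mem_preimage, h, add_sub_cancel_right]
    exact hφ u
  · change G ((ψ u).1 - w) = u
    rw [h, add_sub_cancel_right, hGφ]

/-- The jets of the translated family are those of the original plus the jet of a constant, which is
`w t` in order 0 and vanishes in positive order. -/
theorem continuous_of_add {T : Type*} [TopologicalSpace T] {φ ψ : T → SmoothEmb U V}
    {w : T → V.Space} (hφ : Continuous φ) (hw : Continuous w)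
    (h : ∀ t u, ((ψ t).1 u).1 = ((φ t).1 u).1 + w t) : Continuous ψ := by
  refine continuous_of_jet fun k => ?_
  have key : ∀ (t : T) (u : U.set), jet k (ψ t) u =
      jet k (φ t) u + iteratedFDerivWithin ℝ k (fun _ => w t) U.set u := fun t u => by
    have heq : EqOn (ψ t).ambient ((φ t).ambient + fun _ => w t) U.set := fun x hx => by
      rw [(ψ t).ambient_apply ⟨x, hx⟩, h, Pi.add_apply, (φ t).ambient_apply ⟨x, hx⟩]
    change iteratedFDerivWithin ℝ k _ _ _ = _
    rw [iteratedFDerivWithin_congr heq u.2, iteratedFDerivWithin_add_apply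
      (((φ t).contDiffOn_ambient u u.2).of_le (by exact_mod_cast le_top)) contDiffWithinAt_const
      U.uniqueDiffOn u.2]
    rfl
  simp only [key]
  refine Continuous.add ?_ ?_
  · exact (continuous_jet k).comp ((hφ.comp continuous_fst).prodMk continuous_snd)
  · rcases eq_or_ne k 0 with rfl | hk
    · have : ∀ t : T × U.set, iteratedFDerivWithin ℝ 0 (fun _ => w t.1) U.set t.2 =
          (continuousMultilinearCurryFin0 ℝ U.Space V.Space).symm (w t.1) := fun t => rfl
      simp only [this]
      exact (LinearIsometryEquiv.continuous _).comp (hw.comp continuous_fst)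
    · simp only [iteratedFDerivWithin_const_of_ne hk]
      exact continuous_const

/-- Smooth open embeddings can be factored through larger smooth open embeddings. -/
theorem exists_comp_eq (ι : SmoothEmb V W) (h : SmoothEmb U W) (hr : range h.1 ⊆ range ι.1) :
    ∃ f : SmoothEmb U V, ι.comp f = h := by
  choose f hf using fun u => hr (mem_range_self u)
  obtain ⟨Oι, Fι, hOι, hVι, hFι, hFeqι⟩ := ι.2.smooth
  obtain ⟨Pι, Gι, hPι, hιP, hGι, hGeqι⟩ := ι.2.smooth_inverse
  obtain ⟨O, F, hO, hU, hF, hFeq⟩ := h.2.smooth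
  obtain ⟨P, G, hP, hhP, hG, hGeq⟩ := h.2.smooth_inverse
  have hcomp : ι.1 ∘ f = h.1 := funext hf
  refine ⟨⟨f, ?_, ⟨O ∩ F ⁻¹' Pι, Gι ∘ F, hF.continuousOn.isOpen_inter_preimage hO hPι,
    fun u hu => ⟨hU hu, ?_⟩, hGι.comp (hF.mono inter_subset_left) fun x hx => hx.2, fun u => ?_⟩,
    ⟨Oι ∩ Fι ⁻¹' P, G ∘ Fι, hFι.continuousOn.isOpen_inter_preimage hOι hP,
    fun u => ⟨hVι (f u).2, ?_⟩, hG.comp (hFι.mono inter_subset_left) fun x hx => hx.2,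
    fun u => ?_⟩⟩, Subtype.ext hcomp⟩
  · refine IsOpenEmbedding.of_comp f ι.2.isOpenEmbedding ?_
    rw [hcomp]
    exact h.2.isOpenEmbedding
  · rw [mem_preimage, hFeq ⟨u, hu⟩, ← hf]
    exact hιP _
  · rw [Function.comp_apply, hFeq, ← hf, hGeqι]
  · rw [mem_preimage, hFeqι, hf]
    exact hhP u
  · rw [Function.comp_apply, hFeqι, hf, hGeq]

theorem comp_injective (ι : SmoothEmb V W) :
    Function.Injective fun f : SmoothEmb U V => ι.comp f := fun _ _ h =>
  Subtype.ext (funext fun u => ι.2.isOpenEmbedding.injective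
    (congrArg (fun k : SmoothEmb U W => k.1 u) h))

/-- A smooth inverse `G` of `ι` recovers `φ` as `G ∘ (ι ∘ φ)`, and the Faà di Bruno formula
expresses its jets continuously through those of `ι ∘ φ`. This gives continuity of the factors
produced by `exists_comp_eq`. -/
theorem continuous_of_comp {T : Type*} [TopologicalSpace T] (ι : SmoothEmb V W)
    {φ : T → SmoothEmb U V} (h : Continuous fun t => ι.comp (φ t)) : Continuous φ := by
  obtain ⟨O, G, hO, hι, hG, hGeq⟩ := ι.2.smooth_inverse
  refine continuous_of_jet fun k => ?_
  have hm : ∀ t, MapsTo (ι.comp (φ t)).ambient U.set O := fun t x hx => by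
    rw [(ι.comp (φ t)).ambient_apply ⟨x, hx⟩]
    exact hι _
  have key : ∀ (t : T) (u : U.set), jet k (φ t) u = ∑ c : OrderedFinpartition k,
      c.compAlongOrderedFinpartitionL ℝ U.Space W.Space V.Space
        (iteratedFDerivWithin ℝ c.length G O ((ι.comp (φ t)).1 u))
        fun m => jet (c.partSize m) (ι.comp (φ t)) u := fun t u => by
    have heq : EqOn (φ t).ambient (G ∘ (ι.comp (φ t)).ambient) U.set := fun x hx => by
      rw [Function.comp_apply, (ι.comp (φ t)).ambient_apply ⟨x, hx⟩,
        (φ t).ambient_apply ⟨x, hx⟩]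
      exact (hGeq _).symm
    change iteratedFDerivWithin ℝ k _ U.set u = _
    rw [iteratedFDerivWithin_congr heq u.2,
      iteratedFDerivWithin_comp (hG _ (hm t u.2)) ((ι.comp (φ t)).contDiffOn_ambient _ u.2)
        hO.uniqueDiffOn U.uniqueDiffOn u.2 (hm t) (by exact_mod_cast le_top),
      (ι.comp (φ t)).ambient_apply]
    rfl
  simp only [key]
  refine continuous_finsetSum _ fun c _ => ?_
  have hc : Continuous fun t : T × U.set => (ι.comp (φ t.1), t.2) :=
    (h.comp continuous_fst).prodMk continuous_snd
  have h1 : Continuous fun t : T × U.set =>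
      iteratedFDerivWithin ℝ c.length G O ((ι.comp (φ t.1)).1 t.2) :=
    (hG.continuousOn_iteratedFDerivWithin (by exact_mod_cast le_top)
      hO.uniqueDiffOn).comp_continuous
      (continuous_subtype_val.comp (continuous_eval.comp hc)) fun t => hι _
  exact ((c.compAlongOrderedFinpartitionL ℝ U.Space W.Space V.Space).continuous.comp h1).eval
    (continuous_pi fun m => (continuous_jet (c.partSize m)).comp hc)

end SmoothEmb

theorem smul_mem_cubeSide {a b : ℕ} {l x : ℝ} (h0 : 0 < l) (h1 : l ≤ 1) (i : Fin a ⊕ Fin b)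
    (hx : x ∈ cubeSide a b i) : l * x ∈ cubeSide a b i := by
  rcases i with i | i <;> simp only [cubeSide, Sum.elim_inl, Sum.elim_inr, mem_Ioo, mem_Ico] at hx ⊢
  · constructor <;> nlinarith
  · constructor <;> nlinarith

theorem zero_mem_cube (a b : ℕ) : (0 : Fin a ⊕ Fin b → ℝ) ∈ (cube a b).set := by
  rintro (i | i) - <;> simp [cube, boxOfSides, cubeSide]

/-- The centre of a cube. -/
def cubeZero (a b : ℕ) : (cube a b).set := ⟨(0 : Fin a ⊕ Fin b → ℝ), zero_mem_cube a b⟩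

/-- Scaling of a cube by a factor in `(0, 1]`. -/
def cubeScale (a b : ℕ) (l : Ioc (0 : ℝ) 1) : SmoothEmb (cube a b) (cube a b) :=
  ⟨fun x => ⟨l.1 • x.1, fun i _ => smul_mem_cubeSide l.2.1 l.2.2 i (x.2 i (mem_univ i))⟩, by
    refine ⟨IsOpenEmbedding.of_continuous_injective_isOpenMap ?_ (fun x y hxy => ?_) ?_,
      ⟨univ, fun x => l.1 • x, isOpen_univ, subset_univ _, ContDiff.contDiffOn (by fun_prop),
        fun _ => rfl⟩, ⟨univ, fun x => l.1⁻¹ • x, isOpen_univ, fun _ => mem_univ _,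
        ContDiff.contDiffOn (by fun_prop), fun u => inv_smul_smul₀ l.2.1.ne' _⟩⟩
    · fun_prop
    · exact Subtype.ext (smul_right_injective _ l.2.1.ne' (congrArg Subtype.val hxy))
    · rintro _ ⟨O, hO, rfl⟩
      -- The upper bounds must be imposed on the rescaled point, but the closed face needs no
      -- condition, because scaling preserves signs. So an open box suffices to describe the image.
      let B : Set (Fin a ⊕ Fin b → ℝ) := Set.pi univ fun _ => Ioo (-1) 1
      have hB : IsOpen B := isOpen_set_pi finite_univ fun _ _ => isOpen_Ioo
      refine ⟨(fun y : (cube a b).Space => l.1⁻¹ • y) ⁻¹' (O ∩ B), (hO.inter hB).preimage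
        (continuous_const_smul _), ?_⟩
      ext y
      constructor
      · rintro ⟨hyO, hyB⟩
        refine ⟨⟨l.1⁻¹ • y.1, ?_⟩, hyO, Subtype.ext (smul_inv_smul₀ l.2.1.ne' _)⟩
        rintro (i | i) -
        · exact hyB _ (mem_univ _)
        · exact ⟨mul_nonneg (inv_nonneg.2 l.2.1.le) (y.2 (Sum.inr i) (mem_univ _)).1,
            (hyB (Sum.inr i) (mem_univ _)).2⟩
      · rintro ⟨x, hx, rfl⟩
        have hl : l.1⁻¹ • l.1 • x.1 = x.1 := inv_smul_smul₀ l.2.1.ne' _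
        rw [mem_preimage, mem_preimage, hl]
        refine ⟨hx, ?_⟩
        rintro (i | i) -
        · exact x.2 (Sum.inl i) (mem_univ _)
        · have := x.2 (Sum.inr i) (mem_univ _)
          exact ⟨neg_one_lt_zero.trans_le this.1, this.2⟩⟩

theorem cubeScale_apply {a b : ℕ} (l : Ioc (0 : ℝ) 1) (x : (cube a b).set) :
    ((cubeScale a b l).1 x).1 = l.1 • x.1 := rfl

theorem cubeScale_zero {a b : ℕ} (l : Ioc (0 : ℝ) 1) :
    (cubeScale a b l).1 (cubeZero a b) = cubeZero a b :=
  Subtype.ext (smul_zero l.1 : l.1 • (0 : Fin a ⊕ Fin b → ℝ) = 0)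

theorem cubeScale_one {a b : ℕ} (l : Ioc (0 : ℝ) 1) (hl : l.1 = 1) :
    cubeScale a b l = SmoothEmb.id _ :=
  SmoothEmb.ext' fun u => by
    rw [cubeScale_apply, hl, one_smul]
    rfl

/-- Every jet of the scaling is the factor times the corresponding jet of the identity. -/
theorem continuous_cubeScale (a b : ℕ) : Continuous (cubeScale a b) := by
  refine SmoothEmb.continuous_of_jet fun k => ?_
  have hk : (k : WithTop ℕ∞) ≤ ∞ := by exact_mod_cast le_top
  have hid : ContDiff ℝ ∞ fun y : (cube a b).Space => y := contDiff_id
  have key : ∀ (l : Ioc (0 : ℝ) 1) (u : (cube a b).set), SmoothEmb.jet k (cubeScale a b l) u =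
      l.1 • iteratedFDerivWithin ℝ k (fun y : (cube a b).Space => y) (cube a b).set u :=
      fun l u => by
    have heq : EqOn (cubeScale a b l).ambient (l.1 • fun y : (cube a b).Space => y)
        (cube a b).set := fun y hy => (cubeScale a b l).ambient_apply ⟨y, hy⟩
    change iteratedFDerivWithin ℝ k _ _ _ = _
    rw [iteratedFDerivWithin_congr heq u.2, iteratedFDerivWithin_const_smul_apply
      (hid.of_le hk).contDiffWithinAt (cube a b).uniqueDiffOn u.2]
  simp only [key]
  have hc : Continuous fun u : (cube a b).set =>
      iteratedFDerivWithin ℝ k (fun y : (cube a b).Space => y) (cube a b).set u :=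
    continuousOn_iff_continuous_domRestrict.1
      (hid.contDiffOn.continuousOn_iteratedFDerivWithin hk (cube a b).uniqueDiffOn)
  exact (continuous_subtype_val.comp continuous_fst).smul (hc.comp continuous_snd)

end SmoothConstructions

/-! ### Invariance of corners -/

section Corners

variable {a b p q : ℕ}

open Filter

/-- Along the line through `x` in direction `e` the coordinate has a local minimum at time 0. -/
theorem fderiv_apply_eq_zero_of_nonneg {ι κ : Type*} [Fintype ι] [Fintype κ]
    {F : (ι → ℝ) → κ → ℝ} {A : (ι → ℝ) →L[ℝ] κ → ℝ} {x e : ι → ℝ} {j : κ}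
    (hF : HasFDerivAt F A x) (h0 : F x j = 0) (h : ∀ᶠ t : ℝ in 𝓝 0, 0 ≤ F (x + t • e) j) :
    A e j = 0 := by
  have h1 : HasDerivAt (fun t : ℝ => x + t • e) e 0 := by
    simpa using ((hasDerivAt_id (0 : ℝ)).smul_const e).const_add x
  have h2 : HasDerivAt (fun t : ℝ => F (x + t • e)) (A e) 0 := by
    refine HasFDerivAt.comp_hasDerivAt (0 : ℝ) ?_ h1
    simpa using hF
  have h3 : IsLocalMin (fun t : ℝ => F (x + t • e) j) 0 := by
    filter_upwards [h] with t ht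
    simpa [h0] using ht
  exact h3.hasDerivAt_eq_zero (hasDerivAt_pi.1 h2 j)

/-- The coordinates which vanish at the image of the centre. -/
def zeroCoords (g : SmoothEmb (cube a b) (quadrant p q)) : Finset (Fin q) :=
  Finset.univ.filter fun j => (g.1 (cubeZero a b)).1 (Sum.inr j) = 0

theorem mem_zeroCoords (g : SmoothEmb (cube a b) (quadrant p q)) {j : Fin q} :
    j ∈ zeroCoords g ↔ (g.1 (cubeZero a b)).1 (Sum.inr j) = 0 := by
  simp [zeroCoords]

/-- In matrix terms: the columns outside `s` have zero entries in the rows `z`, so these rows see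
only the columns in `s`, and the block with rows `z` and columns `s` inherits surjectivity. -/
theorem surjective_restrict {ι κ Z S : Type*} [Fintype ι] [DecidableEq ι]
    (A : (ι → ℝ) →ₗ[ℝ] κ → ℝ) (hA : Function.Surjective A) (z : Z ↪ κ) (s : S ↪ ι)
    (h : ∀ i ∉ range s, ∀ j, A (Pi.single i 1) (z j) = 0) :
    Function.Surjective (LinearMap.funLeft ℝ ℝ z ∘ₗ A ∘ₗ Function.ExtendByZero.linearMap ℝ s) := by
  intro y
  obtain ⟨x, hx⟩ := hA (Function.extend z y 0)
  refine ⟨x ∘ s, funext fun j => ?_⟩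
  have h1 : x = Function.extend s (x ∘ s) 0 + ∑ i, (x i - Function.extend s (x ∘ s) 0 i) •
      (Pi.single i 1 : ι → ℝ) := by
    funext k
    simp [Finset.sum_apply, Pi.single_apply]
  have h2 : A x (z j) = A (Function.extend s (x ∘ s) 0) (z j) := by
    conv_lhs => rw [h1]
    rw [map_add, map_sum, Pi.add_apply, Finset.sum_apply, Finset.sum_eq_zero, add_zero]
    intro i _
    rw [map_smul, Pi.smul_apply, smul_eq_mul]
    by_cases hi : i ∈ range s
    · obtain ⟨i, rfl⟩ := hi
      rw [s.injective.extend_apply, Function.comp_apply, sub_self, zero_mul]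
    · rw [h i hi j, mul_zero]
  change A (Function.extend s (x ∘ s) 0) (z j) = y j
  rw [← h2, hx, z.injective.extend_apply]

/-- A surjective block has at least as many columns as rows. Applied to the two mutually inverse
derivatives at a corner, this compares the depths in both directions. -/
theorem card_le_of_restrict {ι κ Z S : Type*} [Fintype ι] [Fintype Z] [Fintype S]
    (A : (ι → ℝ) →ₗ[ℝ] κ → ℝ) (hA : Function.Surjective A) (z : Z ↪ κ) (s : S ↪ ι)
    (h : ∀ i ∉ range s, ∀ (e : ι → ℝ), (∀ k ≠ i, e k = 0) → ∀ j, A e (z j) = 0) :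
    Fintype.card Z ≤ Fintype.card S := by
  classical
  have := LinearMap.finrank_le_finrank_of_surjective (surjective_restrict A hA z s
    fun i hi j => h i hi _ (fun k hk => Pi.single_eq_of_ne hk 1) j)
  simpa using this

/-- A smooth open embedding preserves dimension and the depth of the corner at the centre. -/
theorem card_zeroCoords (g : SmoothEmb (cube a b) (quadrant p q)) :
    a + b = p + q ∧ (zeroCoords g).card = b := by
  obtain ⟨O, F, hO, hUO, hF, hFg⟩ := g.2.smooth
  obtain ⟨P, G, hP, hgP, hG, hGg⟩ := g.2.smooth_inverse
  let U : Set (Fin a ⊕ Fin b → ℝ) := (cube a b).set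
  let V : Set (Fin p ⊕ Fin q → ℝ) := (quadrant p q).set
  let x : Fin a ⊕ Fin b → ℝ := 0
  let y : Fin p ⊕ Fin q → ℝ := (g.1 (cubeZero a b)).1
  have hxU : x ∈ U := zero_mem_cube a b
  have hyV : y ∈ V := (g.1 (cubeZero a b)).2
  have hFx : F x = y := hFg (cubeZero a b)
  have hGy : G y = x := hGg (cubeZero a b)
  obtain ⟨A, hA⟩ : ∃ A : (Fin a ⊕ Fin b → ℝ) →L[ℝ] Fin p ⊕ Fin q → ℝ, HasFDerivAt F A x :=
    ⟨_, ((hF.contDiffAt (hO.mem_nhds (hUO hxU))).differentiableAt (by simp)).hasFDerivAt⟩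
  obtain ⟨B, hB⟩ : ∃ B : (Fin p ⊕ Fin q → ℝ) →L[ℝ] Fin a ⊕ Fin b → ℝ, HasFDerivAt G B y :=
    ⟨_, ((hG.contDiffAt (hP.mem_nhds (hgP _))).differentiableAt (by simp)).hasFDerivAt⟩
  -- Openness of the image enters here: it makes `F ∘ G` the identity on the quadrant near `y`.
  have hnear : ∀ᶠ z in 𝓝[V] y, ∃ u : (cube a b).set, (g.1 u).1 = z := by
    have h1 : range g.1 ∈ 𝓝 (g.1 (cubeZero a b)) :=
      g.2.isOpenEmbedding.isOpen_range.mem_nhds (mem_range_self _)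
    rw [mem_nhds_subtype_iff_nhdsWithin] at h1
    filter_upwards [h1] with z hz
    obtain ⟨_, ⟨u, rfl⟩, hu⟩ := hz
    exact ⟨u, hu⟩
  -- The extensions `F` and `G` are inverse to each other only within the boxes, but derivatives
  -- within sets of unique differentiability determine the full derivatives.
  have hBA : B.comp A = ContinuousLinearMap.id ℝ _ := by
    refine ((cube a b).uniqueDiffOn x hxU).eq
      ((hFx ▸ hB : HasFDerivAt G B (F x)).comp x hA).hasFDerivWithinAt ?_
    refine (hasFDerivWithinAt_id x _).congr (fun u hu => ?_) ?_
    · exact (congrArg G (hFg ⟨u, hu⟩)).trans (hGg ⟨u, hu⟩)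
    · exact (congrArg G hFx).trans hGy
  have hAB : A.comp B = ContinuousLinearMap.id ℝ _ := by
    refine ((quadrant p q).uniqueDiffOn y hyV).eq
      ((hGy ▸ hA : HasFDerivAt F A (G y)).comp y hB).hasFDerivWithinAt ?_
    refine (hasFDerivWithinAt_id y _).congr_of_eventuallyEq ?_ ?_
    · filter_upwards [hnear] with z hz
      obtain ⟨u, rfl⟩ := hz
      exact (congrArg F (hGg u)).trans (hFg u)
    · exact (congrArg F hGy).trans hFx
  have hAB' : ∀ z, A (B z) = z := fun z => congrArg (fun L => L z) hAB
  have hBA' : ∀ z, B (A z) = z := fun z => congrArg (fun L => L z) hBA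
  have hAs : Function.Surjective A.toLinearMap := fun z => ⟨B z, hAB' z⟩
  have hBs : Function.Surjective B.toLinearMap := fun z => ⟨A z, hBA' z⟩
  refine ⟨?_, le_antisymm ?_ ?_⟩
  · have h1 := LinearMap.finrank_le_finrank_of_surjective hAs
    have h2 := LinearMap.finrank_le_finrank_of_surjective hBs
    simp only [Module.finrank_fintype_fun_eq_card, Fintype.card_sum, Fintype.card_fin] at h1 h2
    omega
  -- The cube contains both directions along its open coordinates, so these do not change the
  -- coordinates vanishing at the image of the centre to first order. At most `b` coordinates can
  -- vanish.
  · have h1 := card_le_of_restrict A.toLinearMap hAs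
      ((Function.Embedding.subtype (· ∈ zeroCoords g)).trans Function.Embedding.inr)
      (Function.Embedding.inr : Fin b ↪ Fin a ⊕ Fin b) ?_
    · simpa using h1
    · rintro (i | i) hi e he ⟨j, hj⟩
      · refine fderiv_apply_eq_zero_of_nonneg hA ((congrFun hFx _).trans
          ((mem_zeroCoords g).1 hj)) ?_
        have h2 : ∀ᶠ t : ℝ in 𝓝 0, t * e (Sum.inl i) ∈ Ioo (-1 : ℝ) 1 := by
          refine ContinuousAt.eventually_mem (by fun_prop) (Ioo_mem_nhds ?_ ?_) <;> simp
        filter_upwards [h2] with t ht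
        have hU : x + t • e ∈ U := by
          rintro (k | k) -
          · by_cases hk : k = i
            · subst hk
              simpa [x, cube, boxOfSides, cubeSide] using ht
            · simp [x, he (Sum.inl k) (by simpa using hk), cube, boxOfSides, cubeSide]
          · simp [x, he (Sum.inr k) (by simp), cube, boxOfSides, cubeSide]
        rw [hFg ⟨_, hU⟩]
        exact (g.1 ⟨_, hU⟩).2 (Sum.inr j) (mem_univ _)
      · exact absurd ⟨i, rfl⟩ hi
  -- The same for the inverse: a coordinate of the quadrant that is not zero at `y` can move both
  -- ways, while the last `b` coordinates of the inverse are non-negative and vanish at `y`.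
  · have h1 := card_le_of_restrict B.toLinearMap hBs
      (Function.Embedding.inr : Fin b ↪ Fin a ⊕ Fin b)
      ((Function.Embedding.subtype (· ∈ zeroCoords g)).trans Function.Embedding.inr) ?_
    · simpa using h1
    · intro i hi e he j
      refine fderiv_apply_eq_zero_of_nonneg hB (congrFun hGy _) ?_
      have hV : ∀ᶠ t : ℝ in 𝓝 0, y + t • e ∈ V := by
        have h2 : ∀ k : Fin q, ∀ᶠ t : ℝ in 𝓝 0, 0 ≤ y (Sum.inr k) + t * e (Sum.inr k) := by
          intro k
          by_cases hk : Sum.inr k = i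
          · have hpos : 0 < y (Sum.inr k) := by
              refine lt_of_le_of_ne (hyV (Sum.inr k) (mem_univ _)) fun h0 => hi ?_
              exact ⟨⟨k, (mem_zeroCoords g).2 h0.symm⟩, hk⟩
            have h3 : ∀ᶠ t : ℝ in 𝓝 0, y (Sum.inr k) + t * e (Sum.inr k) ∈ Ioi (0 : ℝ) := by
              refine ContinuousAt.eventually_mem (by fun_prop) (Ioi_mem_nhds ?_)
              simpa using hpos
            exact h3.mono fun t ht => (mem_Ioi.1 ht).le
          · refine Eventually.of_forall fun t => ?_
            rw [he _ hk, mul_zero, add_zero]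
            exact hyV (Sum.inr k) (mem_univ _)
        filter_upwards [eventually_all.2 h2] with t ht
        rintro (k | k) -
        · exact mem_univ _
        · exact ht k
      have hc : Tendsto (fun t : ℝ => y + t • e) (𝓝 0) (𝓝 y) := by
        have : ContinuousAt (fun t : ℝ => y + t • e) 0 := by fun_prop
        simpa [ContinuousAt] using this
      have hc' : Tendsto (fun t : ℝ => y + t • e) (𝓝 0) (𝓝[V] y) :=
        tendsto_nhdsWithin_iff.2 ⟨hc, hV⟩
      filter_upwards [hc'.eventually hnear] with t ht
      obtain ⟨u, hu⟩ := ht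
      rw [← hu, hGg]
      exact (u.2 (Sum.inr j) (mem_univ _)).1

/-- The coordinates which vanish at the centre do not change along a path of smooth open
embeddings. -/
theorem zeroCoords_eq {T : Type*} [TopologicalSpace T] [PreconnectedSpace T]
    {φ : T → SmoothEmb (cube a b) (quadrant p q)} (hφ : Continuous φ) (s t : T) :
    zeroCoords (φ s) = zeroCoords (φ t) := by
  have h : IsLocallyConstant fun t => zeroCoords (φ t) := by
    rw [IsLocallyConstant.iff_eventually_eq]
    intro t
    have h1 : ∀ j : Fin q, ∀ᶠ s in 𝓝 t, j ∈ zeroCoords (φ s) → j ∈ zeroCoords (φ t) := by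
      intro j
      by_cases hj : j ∈ zeroCoords (φ t)
      · exact Eventually.of_forall fun _ _ => hj
      · have hc : Continuous fun s => ((φ s).1 (cubeZero a b)).1 (Sum.inr j) :=
          SmoothEmb.continuous_eval_coord (cubeZero a b) (Sum.inr j) hφ
        rw [mem_zeroCoords] at hj
        filter_upwards [hc.continuousAt.eventually_ne hj] with s hs h
        exact absurd ((mem_zeroCoords _).1 h) hs
    filter_upwards [eventually_all.2 h1] with s hs
    -- Being nonzero is an open condition, so the set can only shrink nearby; its cardinality is
    -- always `b`, so it does not.
    exact Finset.eq_of_subset_of_card_le hs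
      (by rw [(card_zeroCoords _).2, (card_zeroCoords _).2])
  exact h.apply_eq_of_isPreconnected isPreconnected_univ (mem_univ _) (mem_univ _)

end Corners

/-! ### Embeddings between spaces of operations -/

namespace TopFunctor

universe u v

variable {D : TopCategory.{u}} {D' : TopCategory.{v}} (F : TopFunctor D D') {C : Type}
  {X : D.Obj} {obj : C → D.Obj} {ι : ∀ c, D.Hom (obj c) X}

/-- The space of operations is a subspace of a product of spaces of morphisms, lengths and paths,
and postcomposition with an embedding is an embedding of path spaces. -/
theorem isEmbedding_mapSlice (hF : ∀ a b, IsEmbedding (F.map : D.Hom a b → _)) {I : Type}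
    (x : I → C) (y : C) :
    IsEmbedding (F.mapSlice (X := X) (obj := obj) (ι := ι) x y) := by
  have hmulti : IsEmbedding (F.mapMulti : D.MultiHom (fun i => obj (x i)) (obj y) → _) := by
    refine IsEmbedding.of_comp (g := Subtype.val) ?_ continuous_subtype_val ?_
    · refine Continuous.subtype_mk (continuous_pi fun i => ?_) _
      exact (hF _ _).continuous.comp ((continuous_apply i).comp continuous_subtype_val)
    · exact (IsEmbedding.piMap fun i => hF (obj (x i)) (obj y)).comp IsEmbedding.subtypeVal
  have hpath : ∀ i, IsEmbedding (ContinuousMap.comp (⟨F.map, F.continuous_map⟩ :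
      C(D.Hom (obj (x i)) X, _)) : C(ℝ≥0, _) → C(ℝ≥0, _)) := fun i =>
    ContinuousMap.isEmbedding_postcomp _ (hF _ _)
  refine IsEmbedding.of_comp (g := Subtype.val) (F.mapSlice x y).continuous
    continuous_subtype_val ?_
  exact (hmulti.prodMap (IsEmbedding.piMap fun i => IsEmbedding.id.prodMap (hpath i))).comp
    IsEmbedding.subtypeVal

/-- Membership may be tested one morphism and one time at a time: since `F` is an embedding on
morphism spaces, pointwise preimages automatically form continuous paths with the correct ends. -/
theorem mem_range_mapSlice (hF : ∀ a b, IsEmbedding (F.map : D.Hom a b → _)) {I : Type}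
    {x : I → C} {y : C} (t : TopCategory.SliceMul (F.obj X) (fun c => F.obj (obj c))
      (fun c => F.map (ι c)) x y) (h₁ : ∀ i, t.1.1.1 i ∈ range F.map)
    (h₂ : ∀ i s, (t.1.2 i).2 s ∈ range F.map) : t ∈ range (F.mapSlice x y) := by
  choose f hf using h₁
  choose γ hγ using h₂
  refine ⟨⟨(⟨f, ?_⟩, fun i => ((t.1.2 i).1, ⟨γ i, ?_⟩)), fun i => ⟨?_, fun s hs => ?_⟩⟩,
    TopCategory.SliceMul.ext hf (fun _ => rfl) hγ⟩
  · rintro ⟨i, u⟩ ⟨j, v⟩ h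
    have h' := congrArg (F.equiv _) h
    simp only [← F.toFun_map, hf] at h'
    have h'' := @t.1.1.2 ⟨i, F.equiv _ u⟩ ⟨j, F.equiv _ v⟩ h'
    rw [Sigma.mk.injEq] at h''
    obtain ⟨rfl, h2⟩ := h''
    rw [(F.equiv _).injective (eq_of_heq h2)]
  · rw [(hF _ _).isInducing.continuous_iff]
    exact (t.1.2 i).2.continuous.congr fun s => (hγ i s).symm
  · exact (hF _ _).injective ((hγ i 0).trans (t.2 i).1)
  · refine (hF _ _).injective ((hγ i s).trans (((t.2 i).2 s hs).trans ?_))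
    rw [F.map_comp, hf]

end TopFunctor

/-! ### Rectilinear maps among smooth embeddings -/

section RectRange

variable {p q : ℕ}

theorem Rect.toSmoothEmb_apply {a b : Option (Finset (Fin q))}
    (f : Rect (rectSet p a) (rectSet p b)) (u : (stdBox p a).set) (i : (stdBox p b).Coord) :
    (f.toSmoothEmb.1 u).1 i = f.slope (coordEquiv p b i) *
      u.1 ((coordEquiv p a).symm (coordEquiv p b i)) + f.shift (coordEquiv p b i) :=
  f.apply_eq ((pointEquiv p a).symm u) (coordEquiv p b i)

/-- Forgetting the derivatives is a continuous map back to the compact-open topology, whose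
composite with this map is the subspace inclusion. -/
theorem Rect.isEmbedding_toSmoothEmb (a b : Option (Finset (Fin q))) :
    IsEmbedding (Rect.toSmoothEmb : Rect (rectSet p a) (rectSet p b) → _) := by
  let r : SmoothEmb (stdBox p a) (stdBox p b) → C(rectSet p a, rectSet p b) := fun g =>
    ⟨fun x => (pointEquiv p b).symm (g.1 (pointEquiv p a x)), (pointEquiv p b).symm.continuous.comp
      (g.continuous_apply.comp (pointEquiv p a).continuous)⟩
  have hr : Continuous r := by
    refine ContinuousMap.continuous_of_continuous_uncurry _ ?_
    exact (pointEquiv p b).symm.continuous.comp (SmoothEmb.continuous_eval.comp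
      (continuous_fst.prodMk ((pointEquiv p a).continuous.comp continuous_snd)))
  refine IsEmbedding.of_comp Rect.continuous_toSmoothEmb hr ?_
  have : r ∘ Rect.toSmoothEmb = (Subtype.val : Rect (rectSet p a) (rectSet p b) → _) := by
    funext f
    refine ContinuousMap.ext fun x => ?_
    change (pointEquiv p b).symm (pointEquiv p b (f.1 ((pointEquiv p a).symm
      (pointEquiv p a x)))) = f.1 x
    rw [Homeomorph.symm_apply_apply, Homeomorph.symm_apply_apply]
  rw [this]
  exact IsEmbedding.subtypeVal

/-- Openness is part of being a smooth open embedding, so only the affine formula with positive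
slopes has to be checked. -/
theorem mem_range_toSmoothEmb {a b : Option (Finset (Fin q))}
    {g : SmoothEmb (stdBox p a) (stdBox p b)} :
    g ∈ range (Rect.toSmoothEmb : Rect (rectSet p a) (rectSet p b) → _) ↔
      ∃ l v : (stdBox p b).Coord → ℝ, (∀ i, 0 < l i) ∧ ∀ u i, (g.1 u).1 i =
        l i * u.1 ((coordEquiv p a).symm (coordEquiv p b i)) + v i := by
  constructor
  · rintro ⟨f, rfl⟩
    exact ⟨_, _, fun i => f.slope_pos (coordEquiv p b i), f.toSmoothEmb_apply⟩
  · rintro ⟨l, v, hl, h⟩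
    refine ⟨⟨⟨fun x => (pointEquiv p b).symm (g.1 (pointEquiv p a x)), ?_⟩,
      ⟨fun i => l ((coordEquiv p b).symm i), fun i => v ((coordEquiv p b).symm i),
        fun i => hl _, fun x i => ?_⟩, ?_⟩, ?_⟩
    · exact (pointEquiv p b).symm.continuous.comp
        (g.continuous_apply.comp (pointEquiv p a).continuous)
    · refine (h (pointEquiv p a x) ((coordEquiv p b).symm i)).trans ?_
      rw [Equiv.apply_symm_apply]
      change l _ * x.1 (coordEquiv p a ((coordEquiv p a).symm i)) + _ = _
      rw [Equiv.apply_symm_apply]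
    · exact (pointEquiv p b).symm.isOpenMap.comp
        (g.2.isOpenEmbedding.isOpenMap.comp (pointEquiv p a).isOpenMap)
    · refine Subtype.ext (funext fun u => ?_)
      change pointEquiv p b ((pointEquiv p b).symm (g.1 (pointEquiv p a
        ((pointEquiv p a).symm u)))) = g.1 u
      rw [Homeomorph.apply_symm_apply, Homeomorph.apply_symm_apply]

/-- A factor of a rectilinear map through a rectilinear map is rectilinear. -/
theorem mem_range_toSmoothEmb_of_comp {a b c : Option (Finset (Fin q))}
    (h : Rect (rectSet p b) (rectSet p c)) {g : SmoothEmb (stdBox p a) (stdBox p b)}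
    (hg : h.toSmoothEmb.comp g ∈
      range (Rect.toSmoothEmb : Rect (rectSet p a) (rectSet p c) → _)) :
    g ∈ range (Rect.toSmoothEmb : Rect (rectSet p a) (rectSet p b) → _) := by
  rw [mem_range_toSmoothEmb] at hg ⊢
  obtain ⟨l, v, hl, hg⟩ := hg
  let e : (stdBox p b).Coord → (stdBox p c).Coord := fun i =>
    (coordEquiv p c).symm (coordEquiv p b i)
  have he : ∀ i, coordEquiv p c (e i) = coordEquiv p b i := fun i => Equiv.apply_symm_apply _ _
  have hs : ∀ i, 0 < h.slope (coordEquiv p b i) := fun i => h.slope_pos _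
  refine ⟨fun i => l (e i) / h.slope (coordEquiv p b i), fun i =>
    (v (e i) - h.shift (coordEquiv p b i)) / h.slope (coordEquiv p b i),
    fun i => div_pos (hl _) (hs i), fun u i => ?_⟩
  have h1 := hg u (e i)
  have h2 := h.toSmoothEmb_apply (g.1 u) (e i)
  simp only [he, Equiv.symm_apply_apply] at h1 h2
  have h3 := h2.symm.trans h1
  have := (hs i).ne'
  field_simp
  linarith

end RectRange

/-! ### Forgetting the paths -/

section Forget

open unitInterval

variable {p q : ℕ}

theorem straightLine_self {Q : Finset (Fin q)}
    (f : Rect (rectSet p (some Q)) (rectSet p (none : Option (Finset (Fin q))))) (t : ℝ≥0) :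
    straightLine f f t = f := by
  refine Subtype.ext (ContinuousMap.ext fun x => Subtype.ext ?_)
  change (1 - ((min t 1 : ℝ≥0) : ℝ)) • (f.1 x).1 + ((min t 1 : ℝ≥0) : ℝ) • (f.1 x).1 = _
  rw [← add_smul, sub_add_cancel, one_smul]

/-- The length of the paths in the deformation to straight-line paths. -/
def forgetLength (r : ℝ≥0) (s : I) : ℝ≥0 :=
  -- On the first third the length grows from `r` to `max r 1`, on the second it is constant, and on
  -- the last it shrinks to 1.
  max (r * Real.toNNReal (min 1 (3 - 3 * s))) (Real.toNNReal (min 1 (3 * s)))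

theorem forgetLength_zero (r : ℝ≥0) : forgetLength r 0 = r := by
  simp [forgetLength]

theorem forgetLength_one (r : ℝ≥0) : forgetLength r 1 = 1 := by
  simp [forgetLength]

theorem continuous_forgetLength {T : Type*} [TopologicalSpace T] {r : T → ℝ≥0} {s : T → I}
    (hr : Continuous r) (hs : Continuous s) : Continuous fun t => forgetLength (r t) (s t) := by
  unfold forgetLength
  fun_prop

/-- In each third of the deformation, every path that takes part in the interpolation has already
reached its end at the given length: the original one in the first two thirds, the straight line in
the last two. -/
theorem straightLine_of_forgetLength_le {Q : Finset (Fin q)} {r t : ℝ≥0} {s : I}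
    {γ : ℝ≥0 → Rect (rectSet p (some Q)) (rectSet p (none : Option (Finset (Fin q))))}
    {f g : Rect (rectSet p (some Q)) (rectSet p (none : Option (Finset (Fin q))))}
    (hγ : ∀ t, r ≤ t → γ t = g) (ht : forgetLength r s ≤ t) :
    straightLine (γ t) (straightLine f g t) (Real.toNNReal (3 * s - 1)) = g := by
  obtain ⟨h1, h2⟩ := max_le_iff.1 ht
  have hr : (s : ℝ) ≤ 2 / 3 → r ≤ t := fun h => by
    rwa [min_eq_left (by linarith), Real.toNNReal_one, mul_one] at h1
  have hs : 1 / 3 ≤ (s : ℝ) → 1 ≤ t := fun h => by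
    rwa [min_eq_left (by linarith), Real.toNNReal_one] at h2
  rcases le_total (s : ℝ) (1 / 3) with h | h
  · rw [Real.toNNReal_of_nonpos (by linarith), straightLine_zero, hγ t (hr (by linarith))]
  rw [straightLine_of_one_le f g (hs h)]
  rcases le_total (s : ℝ) (2 / 3) with h' | h'
  · rw [hγ t (hr h'), straightLine_self]
  · exact straightLine_of_one_le _ _ (Real.one_le_toNNReal.2 (by linarith))

/-- The deformation of the spaces of operations over the quadrant to those with straight-line
paths. -/
def straightenDeformation {J : Type} (x : J → Finset (Fin q)) (y : Finset (Fin q)) :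
    C(TopCategory.SliceMul (rectQuadrant p q) (typedCube p q) (incl p) x y × I,
      TopCategory.SliceMul (rectQuadrant p q) (typedCube p q) (incl p) x y) where
  toFun t := ⟨(t.1.1.1, fun i => (forgetLength (t.1.1.2 i).1 t.2,
      -- The parameter `3 s - 1` is truncated below here and above inside `straightLine`, so the
      -- interpolation takes place during the middle third only.
      ⟨fun u => straightLine ((t.1.1.2 i).2 u)
          (straightLine (incl p (x i)) (Rect.comp (incl p y) (t.1.1.1.1 i)) u)
          (Real.toNNReal (3 * t.2 - 1)),
        continuous_straightLine (t.1.1.2 i).2.continuous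
          (continuous_straightLine continuous_const continuous_const continuous_id)
          continuous_const⟩)), fun i =>
    ⟨(congrArg₂ (fun f g => straightLine f g _) (t.1.2 i).1 (straightLine_zero _ _)).trans
        (straightLine_self _ _),
      fun _ hs => straightLine_of_forgetLength_le (t.1.2 i).2 hs⟩⟩
  continuous_toFun := by
    have h0 : Continuous fun t : TopCategory.SliceMul (rectQuadrant p q) (typedCube p q) (incl p)
        x y × I => t.1.1 := continuous_subtype_val.comp continuous_fst
    have h1 : ∀ i, Continuous fun t : TopCategory.SliceMul (rectQuadrant p q) (typedCube p q)
        (incl p) x y × I => t.1.1.2 i := fun i =>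
      (continuous_apply i).comp (continuous_snd.comp h0)
    have h2 : ∀ i, Continuous fun t : TopCategory.SliceMul (rectQuadrant p q) (typedCube p q)
        (incl p) x y × I => (rectCat p q).comp (a := typedCube p q (x i)) (b := typedCube p q y)
            (c := rectQuadrant p q) (incl p y) (t.1.1.1.1 i) := fun i =>
      (rectCat p q).continuous_comp.comp (continuous_const.prodMk
        ((continuous_apply i).comp (continuous_subtype_val.comp (continuous_fst.comp h0))))
    refine Continuous.subtype_mk ((continuous_fst.comp h0).prodMk (continuous_pi fun i =>
      (continuous_forgetLength (continuous_fst.comp (h1 i)) continuous_snd).prodMk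
        (ContinuousMap.continuous_of_continuous_uncurry _ ?_))) _
    refine continuous_straightLine
      (((continuous_snd.comp (h1 i)).comp continuous_fst).eval continuous_snd)
      (continuous_straightLine continuous_const ((h2 i).comp continuous_fst) continuous_snd) ?_
    fun_prop

theorem straightenDeformation_zero {J : Type} (x : J → Finset (Fin q)) (y : Finset (Fin q))
    (t : TopCategory.SliceMul (rectQuadrant p q) (typedCube p q) (incl p) x y) :
    straightenDeformation x y (t, 0) = t := by
  refine TopCategory.SliceMul.ext (fun _ => rfl) (fun i => forgetLength_zero _) fun i s => ?_
  have h : Real.toNNReal (3 * (0 : I) - 1) = 0 := by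
    rw [Icc.coe_zero, Real.toNNReal_of_nonpos (by norm_num)]
  exact (congrArg (straightLine ((t.1.2 i).2 s) (straightLine (incl p (x i))
    (Rect.comp (incl p y) (t.1.1.1 i)) s)) h).trans (straightLine_zero _ _)

theorem straightenDeformation_one {J : Type} (x : J → Finset (Fin q)) (y : Finset (Fin q))
    (t : TopCategory.SliceMul (rectQuadrant p q) (typedCube p q) (incl p) x y) :
    straightenDeformation x y (t, 1) = straighten x y t.1.1 := by
  refine TopCategory.SliceMul.ext (fun _ => rfl) (fun i => forgetLength_one _) fun i s => ?_
  have h : (1 : ℝ≥0) ≤ Real.toNNReal (3 * (1 : I) - 1) := by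
    rw [Icc.coe_one]
    exact Real.one_le_toNNReal.2 (by norm_num)
  exact straightLine_of_one_le _ _ h

/-- The deformation to straight-line paths does not move the underlying family, so it covers the
constant homotopy of `S`, and it ends at the section `straighten`. -/
theorem isWeakHomotopyEquiv_toSwissCheese {J : Type} [Finite J]
    (x : J → (rectSliceOperad p q).Color) (y : (rectSliceOperad p q).Color) :
    IsWeakHomotopyEquiv ((toSwissCheese p q).onMul x y) := by
  refine IsDeformable.isWeakHomotopyEquiv fun N _ S => ?_
  refine ⟨S.comp ContinuousMap.fst, (straighten x y).comp S,
    (straightenDeformation x y).comp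
      ⟨fun t => (t.1.1.2, t.2), by fun_prop⟩, fun _ => rfl, fun _ => rfl, fun t _ => t.2.symm,
    fun t => ?_, fun t => ?_⟩
  · exact straightenDeformation_zero x y t.1.2
  · exact (straightenDeformation_one x y t.1.2).trans (congrArg (straighten x y) t.2.symm)

end Forget

/-! ### Deforming operations of the little discs operad -/

namespace TopCategory.SliceMul

universe u

variable {D : TopCategory.{u}} {C : Type}

/-- The topology of a space of operations. -/
abbrev topologicalSpace (X : D.Obj) (obj : C → D.Obj) (ι : ∀ c, D.Hom (obj c) X) {I : Type}
    (x : I → C) (y : C) : TopologicalSpace (SliceMul X obj ι x y) := inferInstance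

variable {X : D.Obj} {obj : C → D.Obj} {ι : ∀ c, D.Hom (obj c) X} {I : Type} {x : I → C} {y : C}

theorem continuous_length (i : I) :
    Continuous fun t : SliceMul X obj ι x y => (t.1.2 i).1 :=
  continuous_fst.comp ((continuous_apply i).comp (continuous_snd.comp continuous_subtype_val))

theorem continuous_path (i : I) :
    Continuous fun t : SliceMul X obj ι x y × ℝ≥0 => (t.1.1.2 i).2 t.2 := by
  have h : Continuous fun t : SliceMul X obj ι x y × ℝ≥0 => (t.1.1.2 i).2 :=
    continuous_snd.comp ((continuous_apply i).comp
      (continuous_snd.comp (continuous_subtype_val.comp continuous_fst)))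
  exact h.eval continuous_snd

variable (X obj ι) in
/-- The operation with given morphisms and paths. -/
def ofPaths (f : ∀ i, D.Hom (obj (x i)) (obj y)) (r : I → ℝ≥0)
    (γ : ∀ i, ℝ≥0 → D.Hom (obj (x i)) X)
    (hf : Function.Injective fun s : Σ i, D.carrier (obj (x i)) => D.toFun (f s.1) s.2)
    (hγ : ∀ i, Continuous (γ i)) (h₀ : ∀ i, γ i 0 = ι (x i))
    (h₁ : ∀ i s, r i ≤ s → γ i s = D.comp (ι y) (f i)) : SliceMul X obj ι x y :=
  ⟨(⟨f, hf⟩, fun i => (r i, ⟨γ i, hγ i⟩)), fun i => ⟨h₀ i, h₁ i⟩⟩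

theorem continuous_of {T : Type*} [TopologicalSpace T] {Φ : T → SliceMul X obj ι x y}
    (h₁ : ∀ i, Continuous fun t => (Φ t).1.1.1 i) (h₂ : ∀ i, Continuous fun t => ((Φ t).1.2 i).1)
    (h₃ : ∀ i, Continuous fun t : T × ℝ≥0 => ((Φ t.1).1.2 i).2 t.2) : Continuous Φ :=
  continuous_induced_rng.2 (Continuous.prodMk (continuous_induced_rng.2 (continuous_pi h₁))
    (continuous_pi fun i => (h₂ i).prodMk
      (ContinuousMap.continuous_of_continuous_uncurry _ (h₃ i))))

end TopCategory.SliceMul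

section Deformation

open Filter unitInterval

variable {a b p q : ℕ}

theorem zero_le_quadrant {v : (quadrant p q).Space} (hv : v ∈ (quadrant p q).set) (j : Fin q) :
    0 ≤ v (Sum.inr j) := hv (Sum.inr j) (mem_univ _)

theorem mem_quadrant {v : (quadrant p q).Space} (hv : ∀ j : Fin q, 0 ≤ v (Sum.inr j)) :
    v ∈ (quadrant p q).set := by
  rintro (i | j) -
  · exact mem_univ _
  · exact hv j

/-- Translations of a smooth open embedding into the quadrant which move only coordinates
staying away from the boundary. -/
theorem exists_translate {U : Box} (g : SmoothEmb U (quadrant p q)) (w : (quadrant p q).Space)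
    (hw : ∀ j : Fin q, w (Sum.inr j) = 0 ∨
      ∀ u, 0 < (g.1 u).1 (Sum.inr j) ∧ 0 < (g.1 u).1 (Sum.inr j) + w (Sum.inr j)) :
    ∃ ψ : SmoothEmb U (quadrant p q), ∀ u, (ψ.1 u).1 = (g.1 u).1 + w := by
  have hmem : ∀ u, (g.1 u).1 + w ∈ (quadrant p q).set := fun u => mem_quadrant fun j => by
    change 0 ≤ (g.1 u).1 (Sum.inr j) + w (Sum.inr j)
    rcases hw j with h | h
    · rw [h, add_zero]
      exact zero_le_quadrant (g.1 u).2 j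
    · exact (h u).2.le
  refine ⟨⟨fun u => ⟨_, hmem u⟩, SmoothEmb.isSmoothOpenEmbedding_of_add g w (fun _ => rfl)
    fun u => ?_⟩, fun _ => rfl⟩
  -- A moved coordinate is positive before the translation, hence still non-negative after moving
  -- nearby points back.
  have h : ∀ j : Fin q, ∀ᶠ y in 𝓝[(quadrant p q).set] ((g.1 u).1 + w),
      0 ≤ (y - w) (Sum.inr j) := fun j => by
    rcases hw j with h | h
    · filter_upwards [self_mem_nhdsWithin] with y hy
      change 0 ≤ y (Sum.inr j) - w (Sum.inr j)
      rw [h, sub_zero]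
      exact zero_le_quadrant hy j
    · have hc : Continuous fun y : (quadrant p q).Space => (y - w) (Sum.inr j) := by fun_prop
      have h0 : 0 < ((g.1 u).1 + w - w) (Sum.inr j) := by
        rw [add_sub_cancel_right]
        exact (h u).1
      filter_upwards [mem_nhdsWithin_of_mem_nhds
        (hc.continuousAt.eventually_mem (Ioi_mem_nhds h0))] with y hy
      exact (mem_Ioi.1 hy).le
  filter_upwards [eventually_all.2 h] with y hy
  exact mem_quadrant hy

/-! ### Uniform constants for compact families -/

section Compactness

variable {T : Type*} [TopologicalSpace T] [CompactSpace T]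

theorem eventually_le_of_pos {f : T → ℝ} (hf : Continuous f) (h : ∀ t, 0 < f t) :
    ∀ᶠ δ in 𝓝[>] (0 : ℝ), ∀ t, δ ≤ f t := by
  obtain ⟨ε, hε, hεf⟩ := isCompact_univ.exists_forall_le' hf.continuousOn fun t _ => h t
  filter_upwards [Ioo_mem_nhdsGT hε] with δ hδ t
  exact hδ.2.le.trans (hεf t (mem_univ t))

/-- On a connected parameter space each boundary coordinate of the centre vanishes always or never;
in the second case compactness bounds it away from zero. -/
theorem eventually_zeroCoords [PreconnectedSpace T]
    {φ : T → SmoothEmb (cube a b) (quadrant p q)} (hφ : Continuous φ) :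
    ∀ᶠ δ in 𝓝[>] (0 : ℝ), ∀ (j : Fin q) (t : T), j ∈ zeroCoords (φ t) ∨
      δ ≤ ((φ t).1 (cubeZero a b)).1 (Sum.inr j) := by
  refine eventually_all.2 fun j => ?_
  by_cases h : ∃ t, j ∈ zeroCoords (φ t)
  · obtain ⟨t, ht⟩ := h
    refine Eventually.of_forall fun δ s => Or.inl ?_
    rwa [zeroCoords_eq hφ s t]
  · push Not at h
    have hpos : ∀ t, 0 < ((φ t).1 (cubeZero a b)).1 (Sum.inr j) := fun t =>
      lt_of_le_of_ne (zero_le_quadrant ((φ t).1 _).2 j)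
        fun h0 => h t ((mem_zeroCoords _).2 h0.symm)
    filter_upwards [eventually_le_of_pos (SmoothEmb.continuous_eval_coord (cubeZero a b)
      (Sum.inr j) hφ) hpos] with δ hδ t
    exact Or.inr (hδ t)

theorem eventually_mem_of_dist_lt {E : Type*} [PseudoMetricSpace E] {c : T → E}
    (hc : Continuous c) {R : Set E} (hR : IsOpen R) (h : ∀ t, c t ∈ R) :
    ∀ᶠ δ in 𝓝[>] (0 : ℝ), ∀ (t : T) (v : E), dist v (c t) < δ → v ∈ R := by
  obtain ⟨ε, hε, hεR⟩ := (isCompact_range hc).exists_thickening_subset_open hR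
    (range_subset_iff.2 h)
  filter_upwards [Ioo_mem_nhdsGT hε] with δ hδ t v hv
  exact hεR (Metric.mem_thickening_iff.2 ⟨c t, mem_range_self t, hv.trans hδ.2⟩)

theorem dist_cubeScale_lt {l : Ioc (0 : ℝ) 1} {ε : ℝ} (hl : l.1 < ε) (u : (cube a b).set) :
    dist ((cubeScale a b l).1 u) (cubeZero a b) < ε := by
  refine lt_of_le_of_lt ?_ hl
  refine (dist_pi_le_iff l.2.1.le).2 fun i => ?_
  change dist (l.1 * u.1 i) 0 ≤ l.1
  rw [dist_zero_right, Real.norm_eq_abs, abs_mul, abs_of_pos l.2.1]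
  refine mul_le_of_le_one_right l.2.1.le (abs_le.2 ?_)
  rcases i with i | i
  · have := u.2 (Sum.inl i) (mem_univ _)
    exact ⟨this.1.le, this.2.le⟩
  · have := u.2 (Sum.inr i) (mem_univ _)
    exact ⟨(neg_one_lt_zero.trans_le this.1).le, this.2.le⟩

/-- By compactness of `T`, one neighbourhood of the centre works for all parameters, and small
scalings map the whole cube into it. -/
theorem eventually_dist_cubeScale_lt {V : Box} {φ : T → SmoothEmb (cube a b) V}
    (hφ : Continuous φ) {δ : ℝ} (hδ : 0 < δ) :
    ∀ᶠ l in 𝓝[>] (0 : ℝ), ∀ (l' : Ioc (0 : ℝ) 1), l'.1 = l → ∀ t u,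
      dist ((φ t).1 ((cubeScale a b l').1 u)) ((φ t).1 (cubeZero a b)) < δ := by
  have hc : Continuous fun z : (cube a b).set × T =>
      dist ((φ z.2).1 z.1) ((φ z.2).1 (cubeZero a b)) := by
    refine Continuous.dist ?_ ?_
    · exact SmoothEmb.continuous_eval.comp ((hφ.comp continuous_snd).prodMk continuous_fst)
    · exact SmoothEmb.continuous_eval.comp ((hφ.comp continuous_snd).prodMk continuous_const)
  have h : ∀ᶠ u in 𝓝 (cubeZero a b), ∀ t ∈ (univ : Set T),
      dist ((φ t).1 u) ((φ t).1 (cubeZero a b)) < δ := by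
    refine isCompact_univ.eventually_forall_of_forall_eventually fun t _ => ?_
    refine hc.continuousAt.eventually_lt continuousAt_const ?_
    simpa using hδ
  obtain ⟨ε, hε, hball⟩ := Metric.eventually_nhds_iff.1 h
  filter_upwards [Ioo_mem_nhdsGT hε] with l hl l' hl' t u
  exact hball (dist_cubeScale_lt (hl' ▸ hl.2) u) t (mem_univ t)

end Compactness

variable (p q) in
/-- The colours of the little discs operad. -/
abbrev DiscColor : Type := Σ a b : ℕ, SmoothEmb (cube a b) (quadrant p q)

/-- The spaces of operations of the little discs operad. -/
def DiscMul {J : Type} (x : J → DiscColor p q) (y : DiscColor p q) : Type :=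
  TopCategory.SliceMul (D := smoothCat) (C := DiscColor p q) (quadrant p q)
    (fun c => cube c.1 c.2.1) (fun c => c.2.2) x y

instance {J : Type} (x : J → DiscColor p q) (y : DiscColor p q) : TopologicalSpace (DiscMul x y) :=
  TopCategory.SliceMul.topologicalSpace (D := smoothCat) (C := DiscColor p q) (quadrant p q)
    (fun c => cube c.1 c.2.1) (fun c => c.2.2) x y

namespace DiscMul

variable {J : Type} {x : J → DiscColor p q} {y : DiscColor p q}

/-- The length of the path of an embedding. -/
def length (t : DiscMul x y) (i : J) : ℝ≥0 := (t.1.2 i).1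

/-- The embeddings along the path. -/
def path (t : DiscMul x y) (i : J) (s : ℝ≥0) : SmoothEmb (cube (x i).1 (x i).2.1) (quadrant p q) :=
  (t.1.2 i).2 s

/-- The underlying embedding. -/
def emb (t : DiscMul x y) (i : J) : SmoothEmb (cube (x i).1 (x i).2.1) (cube y.1 y.2.1) :=
  t.1.1.1 i

theorem path_zero (t : DiscMul x y) (i : J) : t.path i 0 = (x i).2.2 := (t.2 i).1

theorem path_of_le (t : DiscMul x y) (i : J) {s : ℝ≥0} (hs : t.length i ≤ s) :
    t.path i s = y.2.2.comp (t.emb i) := (t.2 i).2 s hs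

theorem path_min (t : DiscMul x y) (i : J) (s : ℝ≥0) :
    t.path i (min s (t.length i)) = t.path i s := by
  rcases le_total s (t.length i) with h | h
  · rw [min_eq_left h]
  · rw [min_eq_right h, t.path_of_le i h, t.path_of_le i le_rfl]

/-- The paths end at the composite of the underlying embedding with the injective embedding of the
target, so the underlying embedding is determined by them. -/
theorem ext_path {t t' : DiscMul x y} (h₁ : ∀ i, t.length i = t'.length i)
    (h₂ : ∀ i s, t.path i s = t'.path i s) : t = t' := by
  refine TopCategory.SliceMul.ext (D := smoothCat) (C := DiscColor p q)
    (X := quadrant p q) (obj := fun c => cube c.1 c.2.1) (ι := fun c => c.2.2) (x := x) (y := y)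
    (fun i => ?_) h₁ h₂
  refine SmoothEmb.comp_injective y.2.2 ?_
  refine (t.path_of_le i (le_max_left _ (t'.length i))).symm.trans ((h₂ _ _).trans ?_)
  exact t'.path_of_le i (le_max_right _ _)

theorem continuous_length (i : J) : Continuous fun t : DiscMul x y => t.length i :=
  TopCategory.SliceMul.continuous_length (D := smoothCat) (C := DiscColor p q)
    (X := quadrant p q) (obj := fun c => cube c.1 c.2.1) (ι := fun c => c.2.2) (x := x) (y := y) i

theorem continuous_path (i : J) : Continuous fun t : DiscMul x y × ℝ≥0 => t.1.path i t.2 :=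
  TopCategory.SliceMul.continuous_path (D := smoothCat) (C := DiscColor p q)
    (X := quadrant p q) (obj := fun c => cube c.1 c.2.1) (ι := fun c => c.2.2) (x := x) (y := y) i

theorem injective_end (t : DiscMul x y) : Function.Injective
    fun s : Σ i, (cube (x i).1 (x i).2.1).set => (t.path s.1 (t.length s.1)).1 s.2 :=
  fun s s' h => by
    simp only [t.path_of_le _ le_rfl] at h
    exact @t.1.1.2 s s' (y.2.2.2.isOpenEmbedding.injective h)

/-- Families of operations can be constructed from families of paths. -/
theorem exists_of_paths {T : Type*} [TopologicalSpace T] {r : J → T → ℝ≥0}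
    {γ : ∀ i, T × ℝ≥0 → SmoothEmb (cube (x i).1 (x i).2.1) (quadrant p q)}
    (hr : ∀ i, Continuous (r i)) (hγ : ∀ i, Continuous (γ i))
    (h₀ : ∀ i t, γ i (t, 0) = (x i).2.2)
    (h₁ : ∀ i t s, r i t ≤ s → γ i (t, s) = γ i (t, r i t))
    (h₂ : ∀ i t, range (γ i (t, r i t)).1 ⊆ range y.2.2.1)
    (h₃ : ∀ t, Function.Injective
      fun s : Σ i, (cube (x i).1 (x i).2.1).set => (γ s.1 (t, r s.1 t)).1 s.2) :
    ∃ Φ : C(T, DiscMul x y), ∀ t i, (Φ t).length i = r i t ∧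
      ∀ s, (Φ t).path i s = γ i (t, s) := by
  -- The underlying embeddings are recovered by factoring the ends of the paths through the
  -- embedding of the target.
  choose f hf using fun i t => y.2.2.exists_comp_eq (γ i (t, r i t)) (h₂ i t)
  have hfc : ∀ i, Continuous (f i) := fun i => by
    refine SmoothEmb.continuous_of_comp y.2.2 ?_
    simp only [hf]
    exact (hγ i).comp (continuous_id.prodMk (hr i))
  refine ⟨⟨fun t => TopCategory.SliceMul.ofPaths (D := smoothCat) (C := DiscColor p q)
      (quadrant p q) (fun c => cube c.1 c.2.1) (fun c => c.2.2) (fun i => f i t) (fun i => r i t)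
      (fun i s => γ i (t, s)) (fun s s' h => h₃ t ?_)
      (fun i => (hγ i).comp (continuous_const.prodMk continuous_id)) (fun i => h₀ i t)
      fun i s hs => (h₁ i t s hs).trans (hf i t).symm, ?_⟩,
    fun t i => ⟨rfl, fun s => rfl⟩⟩
  · simp only [← hf]
    exact congrArg y.2.2.1 h
  · exact TopCategory.SliceMul.continuous_of (D := smoothCat) (C := DiscColor p q)
      (X := quadrant p q) (obj := fun c => cube c.1 c.2.1) (ι := fun c => c.2.2) hfc hr hγ

end DiscMul

end Deformation

/-! ### Shrinking compact families and retracting their paths -/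

section DiscDeformation

open Filter unitInterval

variable {p q : ℕ}

namespace DiscMul

variable {J : Type} {x : J → DiscColor p q} {y : DiscColor p q}

/-- The image of the centre along the path. -/
def center (t : DiscMul x y) (i : J) (s : ℝ≥0) : (quadrant p q).set :=
  (t.path i s).1 (cubeZero _ _)

theorem mem_zeroCoords_path (t : DiscMul x y) {i : J} (s s' : ℝ≥0) :
    zeroCoords (t.path i s) = zeroCoords (t.path i s') :=
  zeroCoords_eq ((continuous_path i).comp (continuous_const.prodMk continuous_id) :
    Continuous fun s => t.path i s) s s'

section Compact

variable {K : Type*} [TopologicalSpace K]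

theorem continuous_path_comp (S : C(K, DiscMul x y)) (i : J) {T : Type*} [TopologicalSpace T]
    {k : T → K} {s : T → ℝ≥0} (hk : Continuous k) (hs : Continuous s) :
    Continuous fun t => (S (k t)).path i (s t) :=
  (continuous_path i).comp ((S.continuous.comp hk).prodMk hs)

/-- Paths are constant beyond their length, so all their values are attained over the compact
interval of rescaled times. This is what makes constants uniform in time. -/
theorem exists_path_eq (t : DiscMul x y) (i : J) (s : ℝ≥0) :
    ∃ τ : I, t.path i s = t.path i (Real.toNNReal τ * t.length i) := by
  rcases le_total (t.length i) s with h | h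
  · refine ⟨1, ?_⟩
    rw [Icc.coe_one, Real.toNNReal_one, one_mul, t.path_of_le i h, t.path_of_le i le_rfl]
  · rcases eq_or_ne (t.length i) 0 with h0 | h0
    · refine ⟨1, ?_⟩
      rw [h0, nonpos_iff_eq_zero] at h
      rw [h, h0, mul_zero]
    · refine ⟨⟨(s / t.length i : ℝ≥0), NNReal.coe_nonneg _, ?_⟩, ?_⟩
      · exact_mod_cast div_le_one_of_le₀ h zero_le
      · rw [Real.toNNReal_coe, div_mul_cancel₀ _ h0]

variable [CompactSpace K] [PreconnectedSpace K] [Finite J]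

/-- Collects the constants of the deformation: cubes scaled by `l` stay `δ`-close to their centres,
while `δ` controls the distance of the centres from the irrelevant faces and, at the end of the
paths, from each other and from the complement of the target disc. -/
theorem exists_separation (S : C(K, DiscMul x y)) : ∃ (δ : ℝ) (l : Ioc (0 : ℝ) 1), 0 < δ ∧
    (∀ i k s (j : Fin q), j ∈ zeroCoords ((S k).path i s) ∨
      δ ≤ ((S k).center i s).1 (Sum.inr j)) ∧
    (∀ i k v, dist v ((S k).center i ((S k).length i)) < δ → v ∈ range y.2.2.1) ∧
    (∀ i i' k, i ≠ i' → 2 * δ ≤ dist ((S k).center i ((S k).length i))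
      ((S k).center i' ((S k).length i'))) ∧
    ∀ i k s u, dist (((S k).path i s).1 ((cubeScale _ _ l).1 u)) ((S k).center i s) < δ := by
  have hr : ∀ i, Continuous fun k => (S k).length i := fun i =>
    (continuous_length i).comp S.continuous
  have hg : ∀ i, Continuous fun t : K × I =>
      (S t.1).path i (Real.toNNReal t.2 * (S t.1).length i) := fun i => by
    refine continuous_path_comp S i continuous_fst (Continuous.mul ?_ ?_)
    · fun_prop
    · exact (hr i).comp continuous_fst
  have he : ∀ i, Continuous fun k => (S k).center i ((S k).length i) := fun i =>
    SmoothEmb.continuous_eval.comp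
      ((continuous_path_comp S i continuous_id (hr i)).prodMk continuous_const)
  have hA : ∀ᶠ δ in 𝓝[>] (0 : ℝ), ∀ i (j : Fin q) (t : K × I),
      j ∈ zeroCoords ((S t.1).path i (Real.toNNReal t.2 * (S t.1).length i)) ∨
        δ ≤ ((S t.1).center i (Real.toNNReal t.2 * (S t.1).length i)).1 (Sum.inr j) :=
    eventually_all.2 fun i => eventually_zeroCoords (hg i)
  have hB : ∀ᶠ δ in 𝓝[>] (0 : ℝ), ∀ i k v,
      dist v ((S k).center i ((S k).length i)) < δ → v ∈ range y.2.2.1 := by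
    refine eventually_all.2 fun i => eventually_mem_of_dist_lt (he i)
      y.2.2.2.isOpenEmbedding.isOpen_range fun k => ?_
    change ((S k).path i _).1 _ ∈ _
    rw [(S k).path_of_le i le_rfl]
    exact mem_range_self _
  have hC : ∀ᶠ δ in 𝓝[>] (0 : ℝ), ∀ t : {t : J × J // t.1 ≠ t.2}, ∀ k,
      δ ≤ dist ((S k).center t.1.1 ((S k).length t.1.1))
        ((S k).center t.1.2 ((S k).length t.1.2)) / 2 := by
    refine eventually_all.2 fun t => eventually_le_of_pos
      (((he t.1.1).dist (he t.1.2)).div_const 2) fun k => half_pos (dist_pos.2 fun h => t.2 ?_)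
    have hinj := (S k).injective_end
    exact congrArg Sigma.fst (@hinj ⟨t.1.1, cubeZero _ _⟩ ⟨t.1.2, cubeZero _ _⟩ h)
  -- First `δ` is fixed, and only then the scale, since the size of the scaled cubes is measured
  -- against `δ`.
  obtain ⟨δ, ⟨⟨hδA, hδB⟩, hδC⟩, hδ⟩ :=
    (((hA.and hB).and hC).and (self_mem_nhdsWithin : Ioi (0 : ℝ) ∈ 𝓝[>] 0)).exists
  have hD : ∀ᶠ l in 𝓝[>] (0 : ℝ), ∀ i, ∀ (l' : Ioc (0 : ℝ) 1), l'.1 = l → ∀ (t : K × I) u,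
      dist (((S t.1).path i (Real.toNNReal t.2 * (S t.1).length i)).1 ((cubeScale _ _ l').1 u))
        ((S t.1).center i (Real.toNNReal t.2 * (S t.1).length i)) < δ :=
    eventually_all.2 fun i => eventually_dist_cubeScale_lt (hg i) hδ
  obtain ⟨l, hl, hl1⟩ := (hD.and (Ioo_mem_nhdsGT (zero_lt_one' ℝ))).exists
  refine ⟨δ, ⟨l, hl1.1, hl1.2.le⟩, hδ, fun i k s j => ?_, hδB, fun i i' k h => ?_,
    fun i k s u => ?_⟩
  · obtain ⟨τ, hτ⟩ := (S k).exists_path_eq i s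
    unfold center
    rw [hτ]
    exact hδA i j (k, τ)
  · have := hδC ⟨(i, i'), h⟩ k
    simp only at this
    linarith
  · obtain ⟨τ, hτ⟩ := (S k).exists_path_eq i s
    unfold center
    rw [hτ]
    exact hl i ⟨l, _⟩ rfl (k, τ) u

/-- Compact families of operations of the little discs operad can be shrunk and then translated
along their own paths, back to the initial embeddings. -/
theorem exists_deformation (S : C(K, DiscMul x y)) : ∃ H : C(K × I, DiscMul x y),
    (∀ k, H (k, 0) = S k) ∧ ∀ k η i s, ∃ (v : ℝ≥0) (l : Ioc (0 : ℝ) 1)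
      (w : (quadrant p q).Space), (η = 1 → v = 0) ∧ ∀ z, (((H (k, η)).path i s).1 z).1 =
        (((S k).path i v).1 ((cubeScale _ _ l).1 z)).1 + w := by
  obtain ⟨δ, l₀, hδ, hA, hB, hC, hD⟩ := exists_separation S
  -- The scale at stage `η` of the deformation: it decreases from 1 to `l₀` for `η ≤ 1/2` and is
  -- `l₀` from then on.
  let lam : I → Ioc (0 : ℝ) 1 := fun η => ⟨max l₀.1 (1 - 2 * η), lt_max_of_lt_left l₀.2.1,
    max_le l₀.2.2 (by linarith [η.2.1])⟩
  -- The initial stretch of time during which the initial embedding is scaled from 1 to `lam η` at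
  -- unit speed; the original path starts only afterwards.
  let pre : I → ℝ≥0 := fun η => Real.toNNReal (1 - (lam η).1)
  -- The fraction of the original path that is still followed: all of it for `η ≤ 1/2`, nothing at
  -- `η = 1`.
  let th : I → ℝ≥0 := fun η => Real.toNNReal (min 1 (2 - 2 * η))
  let v : ∀ (i : J) (k : K) (η : I) (s : ℝ≥0), ℝ≥0 := fun i k η s =>
    min (s - pre η) (th η * (S k).length i)
  let sc : I → ℝ≥0 → Ioc (0 : ℝ) 1 := fun η s => ⟨max (1 - s) (lam η).1,
    lt_max_of_lt_right (lam η).2.1, max_le (by linarith [s.2]) (lam η).2.2⟩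
  have hlam : Continuous lam := by fun_prop
  have hpre : Continuous pre := by fun_prop
  have hth : Continuous th := by fun_prop
  have hsc : Continuous fun t : I × ℝ≥0 => sc t.1 t.2 := by
    refine Continuous.subtype_mk ?_ _
    exact (by fun_prop : Continuous fun t : I × ℝ≥0 => 1 - (t.2 : ℝ)).max
      (continuous_subtype_val.comp (hlam.comp continuous_fst))
  have hpre_coe : ∀ η, (pre η : ℝ) = 1 - (lam η).1 := fun η =>
    Real.coe_toNNReal _ (by linarith [(lam η).2.2])
  have hth_one : ∀ η : I, (η : ℝ) ≤ 1 / 2 → th η = 1 := fun η h => by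
    simp only [th]
    rw [min_eq_left (by linarith), Real.toNNReal_one]
  have hth_le : ∀ η, th η ≤ 1 := fun η => Real.toNNReal_le_one.2 (min_le_left _ _)
  have hlam_eq : ∀ η : I, 1 / 2 < (η : ℝ) → lam η = l₀ := fun η h =>
    Subtype.ext (max_eq_left (by linarith [l₀.2.1]))
  have hsc_eq : ∀ η s, pre η ≤ s → sc η s = lam η := fun η s h => by
    refine Subtype.ext (max_eq_right ?_)
    have : (pre η : ℝ) ≤ s := by exact_mod_cast h
    linarith [hpre_coe η]
  have hv_half : ∀ i k (η : I) s, (η : ℝ) ≤ 1 / 2 →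
      (S k).path i (v i k η s) = (S k).path i (s - pre η) := fun i k η s h => by
    simp only [v]
    rw [hth_one η h, one_mul, path_min]
  have hr : ∀ i, Continuous fun k => (S k).length i := fun i =>
    (continuous_length i).comp S.continuous
  have hvc : ∀ i, Continuous fun t : (K × I) × ℝ≥0 => v i t.1.1 t.1.2 t.2 := fun i => by
    refine Continuous.min ?_ ?_
    · exact continuous_snd.sub (hpre.comp (continuous_snd.comp continuous_fst))
    · exact (hth.comp (continuous_snd.comp continuous_fst)).mul
        ((hr i).comp (continuous_fst.comp continuous_fst))
  -- The path at stage `η`: the original embedding at the stopped time `v`, scaled, and translated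
  -- so that its centre sits where the original centre is at the unstopped time.
  have hψ : ∀ (i : J) (t : (K × I) × ℝ≥0), ∃ ψ : SmoothEmb (cube (x i).1 (x i).2.1)
      (quadrant p q), ∀ u, (ψ.1 u).1 =
        (((S t.1.1).path i (v i t.1.1 t.1.2 t.2)).1 ((cubeScale _ _ (sc t.1.2 t.2)).1 u)).1 +
          (((S t.1.1).center i (t.2 - pre t.1.2)).1 -
            ((S t.1.1).center i (v i t.1.1 t.1.2 t.2)).1) := by
    rintro i ⟨⟨k, η⟩, s⟩
    refine exists_translate (((S k).path i (v i k η s)).comp (cubeScale _ _ (sc η s))) _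
      fun j => ?_
    -- There is nothing to translate while the path has not been stopped, in particular for `η ≤
    -- 1/2` and during the initial stretch. Otherwise the scale is already `l₀`.
    by_cases hpath : (S k).path i (v i k η s) = (S k).path i (s - pre η)
    · left
      simp only [center, hpath, sub_self]
      rfl
    have hη : 1 / 2 < (η : ℝ) := not_le.1 fun h => hpath (hv_half i k η s h)
    have hs : pre η ≤ s := by
      by_contra! h
      refine hpath ?_
      simp only [v]
      rw [tsub_eq_zero_of_le h.le, min_eq_left zero_le]
    have hsc₀ : sc η s = l₀ := (hsc_eq η s hs).trans (hlam_eq η hη)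
    -- Coordinates vanishing at the centre vanish there at all times and are not moved; the others
    -- are at least `δ` at both centres, and the scaled cube deviates from its centre by less than
    -- `δ`.
    rcases hA i k (v i k η s) j with hj | hj
    · left
      have hj' := hj
      rw [(S k).mem_zeroCoords_path _ (s - pre η)] at hj'
      exact sub_eq_zero.2 (((mem_zeroCoords _).1 hj').trans ((mem_zeroCoords _).1 hj).symm)
    · right
      intro u
      have hj' : δ ≤ ((S k).center i (s - pre η)).1 (Sum.inr j) := by
        refine (hA i k (s - pre η) j).resolve_left fun hmem => ?_
        rw [(S k).mem_zeroCoords_path _ (v i k η s), mem_zeroCoords] at hmem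
        exact absurd (hj.trans_eq hmem) (not_le.2 hδ)
      have hd := (dist_le_pi_dist _ _ (Sum.inr j)).trans_lt (hD i k (v i k η s) u)
      rw [Real.dist_eq, abs_lt] at hd
      rw [hsc₀]
      change 0 < (((S k).path i (v i k η s)).1 ((cubeScale _ _ l₀).1 u)).1 (Sum.inr j) ∧
        0 < (((S k).path i (v i k η s)).1 ((cubeScale _ _ l₀).1 u)).1 (Sum.inr j) +
          (((S k).center i (s - pre η)).1 (Sum.inr j) -
            ((S k).center i (v i k η s)).1 (Sum.inr j))
      constructor <;> linarith [hd.1]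
  choose ψ hψ using hψ
  have hψc : ∀ i, Continuous (ψ i) := fun i => by
    refine SmoothEmb.continuous_of_add (φ := fun t : (K × I) × ℝ≥0 =>
      ((S t.1.1).path i (v i t.1.1 t.1.2 t.2)).comp (cubeScale _ _ (sc t.1.2 t.2))) ?_ ?_ (hψ i)
    · refine SmoothEmb.continuous_comp.comp (Continuous.prodMk ?_ ?_)
      · exact continuous_path_comp S i (continuous_fst.comp continuous_fst) (hvc i)
      · exact (continuous_cubeScale _ _).comp
          (hsc.comp ((continuous_snd.comp continuous_fst).prodMk continuous_snd))
    · refine Continuous.sub ?_ ?_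
      · refine SmoothEmb.continuous_eval_point _ (continuous_path_comp S i
          (continuous_fst.comp continuous_fst) ?_)
        exact continuous_snd.sub (hpre.comp (continuous_snd.comp continuous_fst))
      · exact SmoothEmb.continuous_eval_point _ (continuous_path_comp S i
          (continuous_fst.comp continuous_fst) (hvc i))
  let R : J → K × I → ℝ≥0 := fun i t => pre t.2 + (S t.1).length i
  have hend : ∀ i k η s, R i (k, η) ≤ s → ∀ u, (ψ i ((k, η), s)).1 u =
      (((S k).path i (th η * (S k).length i)).1 ((cubeScale _ _ (lam η)).1 u)).1 +
        (((S k).center i ((S k).length i)).1 -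
          ((S k).center i (th η * (S k).length i)).1) := fun i k η s hs u => by
    have h1 : (S k).length i ≤ s - pre η := le_tsub_of_add_le_left hs
    have h2 : v i k η s = th η * (S k).length i :=
      min_eq_right ((mul_le_of_le_one_left zero_le (hth_le η)).trans h1)
    have h3 : (S k).center i (s - pre η) = (S k).center i ((S k).length i) := by
      simp only [center]
      rw [(S k).path_of_le i h1, (S k).path_of_le i le_rfl]
    rw [hψ, h2, h3, hsc_eq η s (le_self_add.trans hs)]
  have hend_half : ∀ i k (η : I), (η : ℝ) ≤ 1 / 2 → ∀ u, (ψ i ((k, η), R i (k, η))).1 u =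
      ((S k).path i ((S k).length i)).1 ((cubeScale _ _ (lam η)).1 u) := fun i k η hη u =>
    Subtype.ext (by rw [hend i k η _ le_rfl, hth_one η hη, one_mul, sub_self, add_zero])
  have hend_dist : ∀ i k (η : I), 1 / 2 < (η : ℝ) → ∀ u,
      dist ((ψ i ((k, η), R i (k, η))).1 u) ((S k).center i ((S k).length i)) < δ :=
    fun i k η hη u => by
      have := hD i k (th η * (S k).length i) u
      rw [Subtype.dist_eq, dist_eq_norm] at this ⊢
      rwa [hend i k η _ le_rfl, hlam_eq η hη, add_sub_assoc, sub_sub_cancel_left, ← sub_eq_add_neg]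
  obtain ⟨Φ, hΦ⟩ := exists_of_paths (x := x) (y := y) (r := R) (γ := ψ)
    (fun i => (hpre.comp continuous_snd).add ((hr i).comp continuous_fst)) hψc
    (fun i t => SmoothEmb.ext' fun u => by
      have h1 : v i t.1 t.2 0 = 0 := by simp [v]
      have h2 : (sc t.2 0).1 = 1 := max_eq_left_iff.2 (by simpa using (lam t.2).2.2) |>.trans
        (by simp)
      rw [hψ, h1, zero_tsub, sub_self, add_zero, path_zero, cubeScale_one _ h2]
      rfl)
    (fun i t s hs => SmoothEmb.ext' fun u => by
      rw [hend i t.1 t.2 s hs, hend i t.1 t.2 _ le_rfl])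
    (fun i t => by
      rintro _ ⟨u, rfl⟩
      rcases le_or_gt (t.2 : ℝ) (1 / 2) with hη | hη
      · rw [hend_half i t.1 t.2 hη, (S t.1).path_of_le i le_rfl]
        exact mem_range_self _
      · exact hB i t.1 _ (hend_dist i t.1 t.2 hη u))
    (fun t => by
      obtain ⟨k, η⟩ := t
      rintro ⟨i, u⟩ ⟨i', u'⟩ h
      change (ψ i ((k, η), R i (k, η))).1 u = (ψ i' ((k, η), R i' (k, η))).1 u' at h
      -- In the first half the end is a scaling of the original end. In the second, distinct cubes
      -- lie in `δ`-balls about points at distance at least `2 * δ`.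
      rcases le_or_gt (η : ℝ) (1 / 2) with hη | hη
      · rw [hend_half i k η hη, hend_half i' k η hη] at h
        have hinj := (S k).injective_end
        have h' := @hinj ⟨i, _⟩ ⟨i', _⟩ h
        rw [Sigma.mk.injEq] at h'
        obtain ⟨rfl, h2⟩ := h'
        rw [(cubeScale _ _ (lam η)).2.isOpenEmbedding.injective (eq_of_heq h2)]
      · by_cases hi : i = i'
        · subst hi
          rw [(ψ i _).2.isOpenEmbedding.injective h]
        · have h1 := hend_dist i k η hη u
          have h2 := hend_dist i' k η hη u'
          have h3 := hC i i' k hi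
          rw [h, dist_comm] at h1
          linarith [dist_triangle ((S k).center i ((S k).length i))
            ((ψ i' ((k, η), R i' (k, η))).1 u') ((S k).center i' ((S k).length i'))])
  refine ⟨Φ, fun k => ?_, fun k η i s => ⟨v i k η s, sc η s,
    ((S k).center i (s - pre η)).1 - ((S k).center i (v i k η s)).1, fun hη => ?_, fun z => ?_⟩⟩
  · have hl : lam 0 = ⟨1, one_pos, le_rfl⟩ := Subtype.ext (by
      simp only [lam, Icc.coe_zero, mul_zero, sub_zero]
      exact max_eq_right l₀.2.2)
    have hp : pre 0 = 0 := by simp [pre, hl]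
    refine ext_path (fun i => ?_) fun i s => SmoothEmb.ext' fun u => ?_
    · rw [(hΦ (k, 0) i).1]
      simp only [R, hp, zero_add]
    · rw [(hΦ (k, 0) i).2, hψ]
      simp only [center]
      rw [hv_half i k 0 s (by simp), hp, tsub_zero, sub_self, add_zero,
        hsc_eq 0 s (hp ▸ zero_le), hl, cubeScale_one _ rfl]
      rfl
  · subst hη
    simp [v, th]
  · rw [(hΦ (k, η) i).2]
    exact hψ i ((k, η), s) z

end Compact

end DiscMul

end DiscDeformation

/-! ### Rectilinearity of the deformed operations and the weak equivalences -/

section LittleDiscs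

open unitInterval

variable {p q : ℕ}

theorem mem_range_toSmoothEmb_of_scale {Q : Finset (Fin q)}
    {g g' : SmoothEmb (stdBox p (some Q)) (stdBox p (none : Option (Finset (Fin q))))}
    (hg : g ∈ range (Rect.toSmoothEmb : Rect (rectSet p (some Q)) (rectSet p none) → _))
    (l : Ioc (0 : ℝ) 1) (w : (stdBox p (none : Option (Finset (Fin q)))).Space)
    (h : ∀ z, (g'.1 z).1 = (g.1 ((cubeScale _ _ l).1 z)).1 + w) :
    g' ∈ range (Rect.toSmoothEmb : Rect (rectSet p (some Q)) (rectSet p none) → _) := by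
  rw [mem_range_toSmoothEmb] at hg ⊢
  obtain ⟨α, v, hα, hg⟩ := hg
  refine ⟨fun i => α i * l.1, fun i => v i + w i, fun i => mul_pos (hα i) l.2.1, fun u i => ?_⟩
  refine (congrFun (h u) i).trans ?_
  refine (congrArg (· + w i) (hg _ i)).trans ?_
  change α i * (l.1 * u.1 _) + v i + w i = _
  ring

/-- Rectilinear paths suffice: the path ends at the composite of the underlying embedding with a
rectilinear inclusion, which forces that embedding to be rectilinear too. -/
theorem mem_range_toLittleDiscs {J : Type} {x : J → Finset (Fin q)} {y : Finset (Fin q)}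
    (t : DiscMul (fun i => discOfType p q (x i)) (discOfType p q y))
    (h : ∀ i s, t.path i s ∈
      range (Rect.toSmoothEmb : Rect (rectSet p (some (x i))) (rectSet p none) → _)) :
    t ∈ range ((rectToSmooth p q).mapSlice (X := rectQuadrant p q) (obj := typedCube p q)
      (ι := incl p) x y) := by
  refine TopFunctor.mem_range_mapSlice (rectToSmooth p q) (X := rectQuadrant p q)
    (obj := typedCube p q) (ι := incl p) Rect.isEmbedding_toSmoothEmb t (fun i => ?_) h
  refine mem_range_toSmoothEmb_of_comp (a := some (x i)) (incl p y) (g := t.emb i) ?_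
  have := h i (t.length i)
  rwa [t.path_of_le i le_rfl] at this

/-- Every embedding in the deformation is a scaled and translated copy of one on the original path,
so rectilinear operations stay so. At the last stage only the initial embeddings are copied, and
these are rectilinear. -/
theorem isWeakHomotopyEquiv_toLittleDiscs {J : Type} [Finite J]
    (x : J → (rectSliceOperad p q).Color) (y : (rectSliceOperad p q).Color) :
    IsWeakHomotopyEquiv ((toLittleDiscs p q).onMul x y) := by
  refine isWeakHomotopyEquiv_of_isEmbedding
    ((rectToSmooth p q).isEmbedding_mapSlice Rect.isEmbedding_toSmoothEmb x y) fun N _ S => ?_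
  let S' : C(N → I, DiscMul (fun i => discOfType p q (x i)) (discOfType p q y)) := S
  obtain ⟨H, H0, hH⟩ := DiscMul.exists_deformation S'
  refine ⟨H, H0, fun k => mem_range_toLittleDiscs (H (k, 1)) fun i s => ?_,
    fun k t hk => mem_range_toLittleDiscs (H (k, t)) fun i s => ?_⟩
  · obtain ⟨v, l, w, hv, h⟩ := hH k 1 i s
    refine mem_range_toSmoothEmb_of_scale ?_ l w h
    rw [hv rfl, DiscMul.path_zero]
    exact mem_range_self (incl p (x i))
  · obtain ⟨v, l, w, -, h⟩ := hH k t i s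
    refine mem_range_toSmoothEmb_of_scale ?_ l w h
    obtain ⟨z, hz⟩ := hk
    change DiscMul.path (x := fun i => discOfType p q (x i)) (y := discOfType p q y) (S k) i v ∈ _
    rw [← hz]
    exact mem_range_self ((z.1.2 i).2 v)

/-- Straightening is a section of a weak equivalence, hence one itself. -/
theorem isWeakHomotopyEquiv_canonicalMap {J : Type} [Finite J]
    (x : J → (swissCheeseOperad p q).Color) (y : (swissCheeseOperad p q).Color) :
    IsWeakHomotopyEquiv (canonicalMap p q x y) := by
  let x' : J → (rectSliceOperad p q).Color := x
  let y' : (rectSliceOperad p q).Color := y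
  let s : C((swissCheeseOperad p q).Mul x y, (rectSliceOperad p q).Mul x' y') := straighten x y
  have hs : IsWeakHomotopyEquiv s := (isWeakHomotopyEquiv_toSwissCheese x' y').of_rightInverse
    (toSwissCheese_straighten x y)
  exact (isWeakHomotopyEquiv_toLittleDiscs x' y').comp hs

end LittleDiscs

/-! ### Equivalences of colours -/

namespace TopOperad

variable (P : TopOperad) {a b c d : P.Color}

theorem comp₁_assoc (h : P.Mul (fun _ : Unit => c) d) (g : P.Mul (fun _ : Unit => b) c)
    (f : P.Mul (fun _ : Unit => a) b) :
    P.comp₁ (P.comp₁ h g) f = P.comp₁ h (P.comp₁ g f) := by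
  have hL := P.comp_reindex_outer (Equiv.sigmaUnique Unit fun _ => Unit).symm
    (P.comp h fun _ : Unit => g) (fun _ : Σ _ : Unit, Unit => f)
  have hA := P.comp_assoc h (fun _ : Unit => g) (fun _ _ : Unit => f)
  have hR := P.comp_reindex_inner (fun _ : Unit => (Equiv.sigmaUnique Unit fun _ => Unit).symm)
    h (fun _ : Unit => P.comp g fun _ : Unit => f)
  unfold comp₁
  rw [hL, hA, hR]
  simp only [← P.reindex_trans]
  rfl

theorem one_comp₁ (f : P.Mul (fun _ : Unit => a) b) : P.comp₁ (P.one b) f = f := by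
  unfold comp₁
  rw [P.one_comp, ← P.reindex_trans]
  exact P.reindex_refl f

theorem comp₁_one (f : P.Mul (fun _ : Unit => a) b) : P.comp₁ f (P.one a) = f := by
  unfold comp₁
  rw [P.comp_one, ← P.reindex_trans]
  exact P.reindex_refl f

theorem continuous_comp₁ : Continuous fun t : P.Mul (fun _ : Unit => b) c ×
    P.Mul (fun _ : Unit => a) b => P.comp₁ t.1 t.2 :=
  (P.continuous_reindex _).comp (P.continuous_comp.comp
    (continuous_fst.prodMk (continuous_pi fun _ => continuous_snd)))

theorem joined_comp₁ {g g' : P.Mul (fun _ : Unit => b) c} {f f' : P.Mul (fun _ : Unit => a) b}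
    (hg : Joined g g') (hf : Joined f f') : Joined (P.comp₁ g f) (P.comp₁ g' f') := by
  obtain ⟨γ⟩ := hg
  obtain ⟨δ⟩ := hf
  exact ⟨(γ.prod δ).map P.continuous_comp₁⟩

/-- A unary operation is invertible up to homotopy if it has a right inverse which has a right
inverse. -/
theorem colorEquiv_of_rightInverse {f h : P.Mul (fun _ : Unit => a) b}
    {g : P.Mul (fun _ : Unit => b) a} (hfg : Joined (P.comp₁ f g) (P.one b))
    (hgh : Joined (P.comp₁ g h) (P.one a)) : P.ColorEquiv a b := by
  have h1 : Joined f h := by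
    have h2 := P.joined_comp₁ (Joined.refl f) hgh
    have h3 := P.joined_comp₁ hfg (Joined.refl h)
    rw [comp₁_one] at h2
    rw [one_comp₁, comp₁_assoc] at h3
    exact h2.symm.trans h3
  exact ⟨f, g, (P.joined_comp₁ (Joined.refl g) h1).trans hgh, hfg⟩

theorem colorEquiv_refl (a : P.Color) : P.ColorEquiv a a :=
  ⟨P.one a, P.one a, by rw [one_comp₁], by rw [one_comp₁]⟩

end TopOperad

/-! ### Moving one embedded cube into another -/

section EssSurj

open Filter unitInterval

variable {a b p q : ℕ}

/-- Smooth open embeddings of a cube in the quadrant can be shrunk and translated into each other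
if their centres lie in the same face. -/
theorem exists_joined_comp {ι ι' : SmoothEmb (cube a b) (quadrant p q)}
    (h : zeroCoords ι = zeroCoords ι') : ∃ f : SmoothEmb (cube a b) (cube a b),
      f.1 (cubeZero a b) = cubeZero a b ∧ Joined ι (ι'.comp f) := by
  -- Here `δ` bounds the nonvanishing coordinates of both centres from below and is small enough for
  -- the `δ`-ball about the centre of `ι'` to lie in its image.
  obtain ⟨δ, ⟨⟨h1, h2⟩, h3⟩, hδ⟩ :=
    (((eventually_zeroCoords (T := Unit) (φ := fun _ => ι) continuous_const).and
      (eventually_zeroCoords (T := Unit) (φ := fun _ => ι') continuous_const)).and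
        (eventually_mem_of_dist_lt (T := Unit) (c := fun _ => ι'.1 (cubeZero a b))
          continuous_const ι'.2.isOpenEmbedding.isOpen_range fun _ => mem_range_self _) |>.and
            (self_mem_nhdsWithin : Ioi (0 : ℝ) ∈ 𝓝[>] 0)).exists
  obtain ⟨l, hl, hl1⟩ := ((eventually_dist_cubeScale_lt (T := Unit) (φ := fun _ => ι)
    continuous_const hδ).and (Ioo_mem_nhdsGT (zero_lt_one' ℝ))).exists
  let l' : Ioc (0 : ℝ) 1 := ⟨l, hl1.1, hl1.2.le⟩
  have hl' : ∀ u, dist (ι.1 ((cubeScale a b l').1 u)) (ι.1 (cubeZero a b)) < δ :=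
    hl l' rfl ()
  let w : (quadrant p q).Space := (ι'.1 (cubeZero a b)).1 - (ι.1 (cubeZero a b)).1
  have hψ : ∀ s : I, ∃ ψ : SmoothEmb (cube a b) (quadrant p q), ∀ u, (ψ.1 u).1 =
      ((ι.comp (cubeScale a b l')).1 u).1 + (s : ℝ) • w := fun s => by
    refine exists_translate _ _ fun j => ?_
    rcases h1 j () with hj | hj
    · left
      have hj' := hj
      rw [h, mem_zeroCoords] at hj'
      rw [mem_zeroCoords] at hj
      change (s : ℝ) * ((ι'.1 (cubeZero a b)).1 (Sum.inr j) -
        (ι.1 (cubeZero a b)).1 (Sum.inr j)) = 0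
      rw [hj, hj', sub_zero, mul_zero]
    · right
      intro u
      have hj' : δ ≤ (ι'.1 (cubeZero a b)).1 (Sum.inr j) := by
        refine (h2 j ()).resolve_left fun hmem => ?_
        rw [← h, mem_zeroCoords] at hmem
        exact absurd (hj.trans_eq hmem) (not_le.2 hδ)
      have hd := (dist_le_pi_dist _ _ (Sum.inr j)).trans_lt (hl' u)
      rw [Real.dist_eq, abs_lt] at hd
      change 0 < (ι.1 ((cubeScale a b l').1 u)).1 (Sum.inr j) ∧
        0 < (ι.1 ((cubeScale a b l').1 u)).1 (Sum.inr j) + (s : ℝ) *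
          ((ι'.1 (cubeZero a b)).1 (Sum.inr j) - (ι.1 (cubeZero a b)).1 (Sum.inr j))
      refine ⟨by linarith [hd.1], ?_⟩
      -- The coordinate exceeds `(1 - s) * (c - δ) + s * (c' - δ)`, where `c, c' ≥ δ` are the
      -- coordinates of the two centres.
      nlinarith [hd.1, mul_nonneg s.2.1 (sub_nonneg.2 hj'),
        mul_nonneg (sub_nonneg.2 s.2.2) (sub_nonneg.2 hj)]
  choose ψ hψ using hψ
  have hψc : Continuous ψ := SmoothEmb.continuous_of_add (φ := fun _ => ι.comp (cubeScale a b l'))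
    (w := fun s : I => (s : ℝ) • w) continuous_const (by fun_prop) hψ
  have hψ1 : ∀ u, ((ψ 1).1 u).1 =
      (ι.1 ((cubeScale a b l').1 u)).1 + w := fun u => by
    rw [hψ, Icc.coe_one, one_smul]
    rfl
  obtain ⟨f, hf⟩ := ι'.exists_comp_eq (ψ 1) (by
    rintro _ ⟨u, rfl⟩
    refine h3 () _ ?_
    have := hl' u
    rw [Subtype.dist_eq, dist_eq_norm] at this ⊢
    rwa [hψ1, add_sub_assoc, sub_sub_cancel_left, ← sub_eq_add_neg])
  refine ⟨f, ι'.2.isOpenEmbedding.injective ?_, ?_⟩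
  · refine (congrArg (fun k : SmoothEmb (cube a b) (quadrant p q) => k.1 (cubeZero a b)) hf).trans
      (Subtype.ext ?_)
    rw [hψ1, cubeScale_zero]
    exact add_sub_cancel _ _
  · rw [hf]
    let sc : I → Ioc (0 : ℝ) 1 := fun s => ⟨max (1 - s) l, lt_max_of_lt_right hl1.1,
      max_le (by linarith [s.2.1]) hl1.2.le⟩
    have h4 : Joined ι (ι.comp (cubeScale a b l')) := by
      refine ⟨⟨⟨fun s => ι.comp (cubeScale a b (sc s)), ?_⟩, ?_, ?_⟩⟩
      · exact SmoothEmb.continuous_comp.comp (continuous_const.prodMk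
          ((continuous_cubeScale a b).comp (by fun_prop)))
      · change ι.comp (cubeScale a b (sc 0)) = ι
        rw [cubeScale_one (sc 0) (by simp [sc, hl1.2.le])]
        rfl
      · change ι.comp (cubeScale a b (sc 1)) = ι.comp (cubeScale a b l')
        congr 2
        exact Subtype.ext (by simp [sc, l', hl1.1.le])
    refine h4.trans ⟨⟨⟨ψ, hψc⟩, ?_, rfl⟩⟩
    refine SmoothEmb.ext' fun u => (hψ 0 u).trans ?_
    rw [Icc.coe_zero, zero_smul, add_zero]

/-- Smooth open embeddings between cubes preserving the centre have right inverses up to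
scaling. -/
theorem exists_comp_eq_cubeScale {a' b' : ℕ} (f : SmoothEmb (cube a b) (cube a' b'))
    (hf : f.1 (cubeZero a b) = cubeZero a' b') :
    ∃ (l : Ioc (0 : ℝ) 1) (g : SmoothEmb (cube a' b') (cube a b)),
      g.1 (cubeZero a' b') = cubeZero a b ∧ f.comp g = cubeScale a' b' l := by
  -- The image of `f` contains a ball about the centre, so a small enough scaling of the target cube
  -- factors through `f`.
  obtain ⟨ε, hε, hball⟩ := Metric.isOpen_iff.1 f.2.isOpenEmbedding.isOpen_range
    (cubeZero a' b') ⟨_, hf⟩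
  let l : Ioc (0 : ℝ) 1 := ⟨min (ε / 2) 1, lt_min (half_pos hε) one_pos, min_le_right _ _⟩
  obtain ⟨g, hg⟩ := f.exists_comp_eq (cubeScale a' b' l) (by
    rintro _ ⟨u, rfl⟩
    exact hball (dist_cubeScale_lt ((min_le_left _ _).trans_lt (half_lt_self hε)) u))
  refine ⟨l, g, f.2.isOpenEmbedding.injective ?_, hg⟩
  rw [hf]
  exact (congrArg (fun k : SmoothEmb (cube a' b') (cube a' b') => k.1 (cubeZero a' b')) hg).trans
    (cubeScale_zero l)

end EssSurj

/-! ### Essential surjectivity -/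

namespace TopCategory.SliceMul

universe u

variable {D : TopCategory.{u}} {C : Type} {X : D.Obj} {obj : C → D.Obj}
  {ι : ∀ c, D.Hom (obj c) X} {J : Type} {I : J → Type} {x : ∀ j, I j → C} {y : J → C} {z : C}

theorem path_comp_of_le (g : SliceMul X obj ι y z) (f : ∀ j, SliceMul X obj ι (x j) (y j))
    (k : Σ j, I j) {s : ℝ≥0} (hs : s ≤ ((f k.1).1.2 k.2).1) :
    ((comp g f).1.2 k).2 s = ((f k.1).1.2 k.2).2 s :=
  mooreConcat_apply_of_ge (comp_aux g f k.1 k.2) hs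

theorem path_comp_of_ge (g : SliceMul X obj ι y z) (f : ∀ j, SliceMul X obj ι (x j) (y j))
    (k : Σ j, I j) {s : ℝ≥0} (hs : ((f k.1).1.2 k.2).1 ≤ s) :
    ((comp g f).1.2 k).2 s =
      D.comp ((g.1.2 k.1).2 (s - ((f k.1).1.2 k.2).1)) ((f k.1).1.1.1 k.2) :=
  mooreConcat_apply_of_le (comp_aux g f k.1 k.2) hs

end TopCategory.SliceMul

/-- Going back and forth, in truncated subtraction. -/
theorem sub_max_two_mul_sub {A r z : ℝ≥0} (hz : z ≤ r) :
    r - (max (2 * (A + r) - (A + r + z)) A - A) = z := by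
  obtain ⟨z', rfl⟩ := exists_add_of_le hz
  have h : 2 * (A + (z + z')) - (A + (z + z') + z) = A + z' := by
    refine tsub_eq_of_eq_add ?_
    ring
  rw [h, max_eq_left le_self_add, add_tsub_cancel_left, add_tsub_cancel_right]

section DiscColors

open unitInterval

variable {p q : ℕ}

namespace DiscMul

variable {b c d : DiscColor p q}

variable (d) in
/-- The identity operation. -/
def one : DiscMul (fun _ : Unit => d) d := (littleDiscsOperad p q).one d

/-- Composition of unary operations. -/
def comp₁ (t : DiscMul (fun _ : Unit => c) d) (t' : DiscMul (fun _ : Unit => b) c) :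
    DiscMul (fun _ : Unit => b) d :=
  TopOperad.comp₁ (littleDiscsOperad p q) (a := b) (b := c) (c := d) t t'

theorem path_comp₁_of_le (t : DiscMul (fun _ : Unit => c) d) (t' : DiscMul (fun _ : Unit => b) c)
    {s : ℝ≥0} (hs : s ≤ t'.length ()) : (t.comp₁ t').path () s = t'.path () s :=
  TopCategory.SliceMul.path_comp_of_le (D := smoothCat) (C := DiscColor p q) (X := quadrant p q)
    (obj := fun c => cube c.1 c.2.1) (ι := fun c => c.2.2) (x := fun _ _ : Unit => b)
    (y := fun _ : Unit => c) (z := d) t (fun _ => t') ⟨(), ()⟩ hs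

theorem path_comp₁_of_ge (t : DiscMul (fun _ : Unit => c) d) (t' : DiscMul (fun _ : Unit => b) c)
    {s : ℝ≥0} (hs : t'.length () ≤ s) :
    (t.comp₁ t').path () s = (t.path () (s - t'.length ())).comp (t'.emb ()) :=
  TopCategory.SliceMul.path_comp_of_ge (D := smoothCat) (C := DiscColor p q) (X := quadrant p q)
    (obj := fun c => cube c.1 c.2.1) (ι := fun c => c.2.2) (x := fun _ _ : Unit => b)
    (y := fun _ : Unit => c) (z := d) t (fun _ => t') ⟨(), ()⟩ hs

/-- Unary operations of the little discs operad from paths of embeddings. -/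
theorem exists_unary {f : SmoothEmb (cube c.1 c.2.1) (cube d.1 d.2.1)} {r : ℝ≥0}
    {γ : ℝ≥0 → SmoothEmb (cube c.1 c.2.1) (quadrant p q)} (hγ : Continuous γ)
    (h₀ : γ 0 = c.2.2) (h₁ : ∀ s, r ≤ s → γ s = d.2.2.comp f) :
    ∃ t : DiscMul (fun _ : Unit => c) d, t.length () = r ∧ t.emb () = f ∧
      ∀ s, t.path () s = γ s := by
  obtain ⟨Φ, hΦ⟩ := exists_of_paths (x := fun _ : Unit => c) (y := d) (T := Unit)
    (r := fun _ _ => r) (γ := fun _ t => γ t.2) (fun _ => continuous_const)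
    (fun _ => hγ.comp continuous_snd) (fun _ _ => h₀)
    (fun _ _ s hs => (h₁ s hs).trans (h₁ r le_rfl).symm)
    (fun _ _ => by
      rw [h₁ r le_rfl]
      rintro _ ⟨u, rfl⟩
      exact mem_range_self _)
    (fun _ => by
      rintro ⟨⟨⟩, u⟩ ⟨⟨⟩, u'⟩ h
      change (γ r).1 u = (γ r).1 u' at h
      rw [(γ r).2.isOpenEmbedding.injective h])
  refine ⟨Φ (), (hΦ () ()).1, SmoothEmb.comp_injective d.2.2 ?_, (hΦ () ()).2⟩
  refine ((Φ ()).path_of_le () le_rfl).symm.trans ?_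
  rw [(hΦ () ()).2, (hΦ () ()).1]
  exact h₁ r le_rfl

/-- Unary operations which preserve the centre have right inverses up to homotopy. -/
theorem exists_rightInverse (t : DiscMul (fun _ : Unit => c) d)
    (ht : (t.emb ()).1 (cubeZero _ _) = cubeZero _ _) :
    ∃ t' : DiscMul (fun _ : Unit => d) c, (t'.emb ()).1 (cubeZero _ _) = cubeZero _ _ ∧
      Joined (t.comp₁ t') (one d) := by
  let r : ℝ≥0 := t.length ()
  let f : SmoothEmb (cube c.1 c.2.1) (cube d.1 d.2.1) := t.emb ()
  let γ : ℝ≥0 → SmoothEmb (cube c.1 c.2.1) (quadrant p q) := t.path ()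
  have hγ : Continuous γ := (continuous_path ()).comp (continuous_const.prodMk continuous_id)
  have hγ₀ : γ 0 = c.2.2 := t.path_zero ()
  have hγ₁ : ∀ s, r ≤ s → γ s = d.2.2.comp f := fun s hs => t.path_of_le () hs
  obtain ⟨l, g, hg, hfg⟩ := exists_comp_eq_cubeScale f ht
  -- The time needed to scale down from 1 to `l` at unit speed.
  let A : ℝ≥0 := Real.toNNReal (1 - l.1)
  have hA : (A : ℝ) = 1 - l.1 := Real.coe_toNNReal _ (by linarith [l.2.2])
  let sc : ℝ≥0 → Ioc (0 : ℝ) 1 := fun s => ⟨max (1 - s) l.1, lt_max_of_lt_right l.2.1,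
    max_le (by linarith [s.2]) l.2.2⟩
  have hsc : Continuous sc := by fun_prop
  have hscA : sc A = l := Subtype.ext (by simp [sc, hA])
  have hsc₀ : (sc 0).1 = 1 := by simp [sc, l.2.2]
  -- The path of the right inverse: scale the embedding of `d` down to its composite with `f ∘ g`,
  -- then run `γ` backwards, precomposed with `g`.
  let δ : ℝ≥0 → SmoothEmb (cube d.1 d.2.1) (quadrant p q) := fun s =>
    if s ≤ A then d.2.2.comp (cubeScale _ _ (sc s)) else (γ (r - (s - A))).comp g
  have hδA : ∀ s, s ≤ A → δ s = d.2.2.comp (cubeScale _ _ (sc s)) := fun s hs => if_pos hs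
  have hδg : ∀ s, A ≤ s → δ s = (γ (r - (s - A))).comp g := fun s hs => by
    rcases hs.eq_or_lt with rfl | hs
    · rw [hδA A le_rfl, hscA, tsub_self, tsub_zero, hγ₁ r le_rfl, ← hfg]
      rfl
    · exact if_neg (not_le.2 hs)
  have hδ : Continuous δ := by
    refine Continuous.if_le ?_ ?_ continuous_id continuous_const ?_
    · exact SmoothEmb.continuous_comp.comp (continuous_const.prodMk
        ((continuous_cubeScale _ _).comp hsc))
    · exact SmoothEmb.continuous_comp.comp (Continuous.prodMk
        (hγ.comp (by fun_prop)) continuous_const)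
    · rintro s rfl
      rw [← hδA A le_rfl, hδg A le_rfl]
  have hδ₀ : δ 0 = d.2.2 := by
    rw [hδA 0 zero_le, cubeScale_one _ hsc₀]
    rfl
  obtain ⟨t', htl, hte, htp⟩ := exists_unary (c := d) (d := c) (f := g) (r := A + r) hδ hδ₀
    fun s hs => by
      rw [hδg s (le_self_add.trans hs), tsub_eq_zero_of_le (le_tsub_of_add_le_left hs), hγ₀]
  -- The path of the composite runs along `δ` and then back along its second part. It is contracted
  -- by turning round at time `m τ` and returning to time `min (m τ) A`; `e` is the resulting
  -- position on `δ`.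
  let m : I → ℝ≥0 := fun τ => Real.toNNReal τ * (A + r)
  let e : I × ℝ≥0 → ℝ≥0 := fun τ => min τ.2 (max (2 * m τ.1 - τ.2) (min (m τ.1) A))
  have hm : Continuous m := by fun_prop
  have he : Continuous e := by fun_prop
  have hend : ∀ τ s, m τ + (m τ - A) ≤ s → e (τ, s) = min (m τ) A := fun τ s hs => by
    have h1 : min (m τ) A ≤ s := (min_le_left _ _).trans (le_self_add.trans hs)
    have h2 : 2 * m τ - s ≤ min (m τ) A := by
      rw [tsub_le_iff_right]
      calc 2 * m τ = m τ + m τ := two_mul _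
        _ ≤ (m τ + (m τ - A)) + min (m τ) A := by
          rw [add_assoc]
          refine add_le_add_right ?_ _
          rcases le_total (m τ) A with h | h
          · rw [min_eq_left h]
            exact le_add_self
          · rw [min_eq_right h, tsub_add_cancel_of_le h]
        _ ≤ min (m τ) A + s := by
          rw [add_comm]
          exact add_le_add_right hs _
    simp only [e]
    rw [max_eq_right h2, min_eq_right h1]
  have hend' : ∀ τ s, m τ + (m τ - A) ≤ s →
      -- The journey always stops within the scaling part, so the end factors through the embedding
      -- of `d`.
      δ (e (τ, s)) = d.2.2.comp (cubeScale _ _ (sc (min (m τ) A))) := fun τ s hs => by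
    rw [hend τ s hs, hδA _ (min_le_right _ _)]
  obtain ⟨Φ, hΦ⟩ := exists_of_paths (x := fun _ : Unit => d) (y := d) (T := I)
    (r := fun _ τ => m τ + (m τ - A)) (γ := fun _ τ => δ (e τ))
    (fun _ => by fun_prop) (fun _ => hδ.comp he)
    (fun _ τ => by
      have : e (τ, 0) = 0 := min_eq_left zero_le
      rw [this, hδ₀])
    (fun _ τ s hs => (hend' τ s hs).trans (hend' τ _ le_rfl).symm)
    (fun _ τ => by
      rw [hend' τ _ le_rfl]
      rintro _ ⟨u, rfl⟩
      exact mem_range_self _)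
    (fun τ => by
      rintro ⟨⟨⟩, u⟩ ⟨⟨⟩, u'⟩ h
      change (δ (e (τ, m τ + (m τ - A)))).1 u = (δ (e (τ, m τ + (m τ - A)))).1 u' at h
      rw [(δ (e (τ, m τ + (m τ - A)))).2.isOpenEmbedding.injective h])
  have hΦ₀ : Φ 0 = one d := by
    have hm0 : m 0 = 0 := by simp [m]
    refine ext_path (fun i => ?_) fun i s => ?_
    · rw [(hΦ 0 i).1, hm0, zero_tsub, zero_add]
      rfl
    · rw [(hΦ 0 i).2, hend' 0 s (by rw [hm0]; simp), hm0, min_eq_left zero_le,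
        cubeScale_one _ hsc₀]
      rfl
  have hΦ₁ : Φ 1 = t.comp₁ t' := by
    have hm1 : m 1 = A + r := by simp [m]
    refine ext_path (fun i => ?_) fun i s => ?_
    · rw [(hΦ 1 i).1, hm1, add_tsub_cancel_left]
      exact congrArg (· + r) htl.symm
    · rw [(hΦ 1 i).2]
      rcases le_total s (A + r) with hs | hs
      · have h1 : e (1, s) = s := by
          refine min_eq_left (le_max_of_le_left ?_)
          rw [hm1, two_mul]
          exact le_tsub_of_add_le_left (add_le_add hs hs)
        rw [h1, ← htp]
        exact (path_comp₁_of_le t t' (hs.trans_eq htl.symm)).symm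
      · have h2 : e (1, s) = max (2 * (A + r) - s) A := by
          simp only [e]
          rw [hm1, min_eq_right (le_self_add : A ≤ A + r), min_eq_right]
          refine max_le ?_ (le_self_add.trans hs)
          rw [tsub_le_iff_right, two_mul]
          exact add_le_add hs hs
        -- On the way back `δ` traverses `γ` forwards, which is the second half of the concatenated
        -- path.
        have h3 : γ (r - (max (2 * (A + r) - s) A - A)) = γ (s - (A + r)) := by
          rcases le_total (A + r + r) s with hs' | hs'
          · rw [max_eq_right, tsub_self, tsub_zero, hγ₁ r le_rfl,
              hγ₁ _ (le_tsub_of_add_le_left hs')]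
            rw [tsub_le_iff_right, two_mul]
            calc A + r + (A + r) = A + (A + r + r) := by ring
              _ ≤ A + s := by gcongr
          · obtain ⟨z, rfl⟩ := exists_add_of_le hs
            rw [sub_max_two_mul_sub (by simpa using hs'), add_tsub_cancel_left]
        rw [h2, hδg _ (le_max_right _ _), h3, ← hte, ← htl]
        exact (path_comp₁_of_ge t t' (htl.trans_le hs)).symm
  exact ⟨t', by rw [hte]; exact hg, Joined.symm ⟨⟨⟨Φ, Φ.continuous⟩, hΦ₀, hΦ₁⟩⟩⟩

end DiscMul

theorem zeroCoords_incl (Q : Finset (Fin q)) :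
    zeroCoords (discOfType p q Q).2.2 = Q := by
  ext j
  rw [mem_zeroCoords]
  change (0 : ℝ) + (if j ∈ Q then 0 else 1) = 0 ↔ j ∈ Q
  split_ifs with h <;> simp [h]

/-- The type `Q` is read off from the centre, and the invariance of corners gives the standard cube
of type `Q` the same dimensions as `d`. Shrinking it into `d` preserves centres, so right inverses
can be taken twice. -/
theorem exists_colorEquiv (d : (littleDiscsOperad p q).Color) :
    ∃ Q : Finset (Fin q), (littleDiscsOperad p q).ColorEquiv (discOfType p q Q) d := by
  obtain ⟨a, b, ι⟩ := d
  obtain ⟨hab, hb⟩ := card_zeroCoords ι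
  -- The type of `ι` involves `a` and `b`, so `Q` is made independent of `ι` before these are
  -- replaced by expressions in `Q.card`.
  obtain ⟨Q, hQ⟩ : ∃ Q, Q = zeroCoords ι := ⟨_, rfl⟩
  rw [← hQ] at hb
  have hle : Q.card ≤ q := by simpa using Q.card_le_univ
  obtain rfl : a = p + (q - Q.card) := by omega
  subst hb
  refine ⟨Q, ?_⟩
  obtain ⟨f, hf, ⟨γ⟩⟩ := exists_joined_comp (ι := (discOfType p q Q).2.2) (ι' := ι)
    ((zeroCoords_incl Q).trans hQ)
  obtain ⟨t, -, hte, -⟩ := DiscMul.exists_unary (c := discOfType p q Q)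
    (d := ⟨p + (q - Q.card), Q.card, ι⟩) (f := f) (r := 1)
    (γ := fun s : ℝ≥0 => γ (projIcc 0 1 zero_le_one (s : ℝ))) (by fun_prop) (by simp)
    fun s hs => by
      rw [projIcc_of_right_le zero_le_one (by exact_mod_cast hs)]
      exact γ.target
  obtain ⟨t', ht', h1⟩ := DiscMul.exists_rightInverse (c := discOfType p q Q)
    (d := ⟨p + (q - Q.card), Q.card, ι⟩) t (by rw [hte]; exact hf)
  obtain ⟨t'', -, h2⟩ := DiscMul.exists_rightInverse (d := discOfType p q Q)
    (c := ⟨p + (q - Q.card), Q.card, ι⟩) t' ht'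
  exact (littleDiscsOperad p q).colorEquiv_of_rightInverse h1 h2

end DiscColors

/-! ### The two equivalences of operads -/

theorem isEquivalence_toSwissCheese (p q : ℕ) : (toSwissCheese p q).IsEquivalence where
  isWeakHomotopyEquiv := isWeakHomotopyEquiv_toSwissCheese
  essSurj d := ⟨d, TopOperad.colorEquiv_refl _ d⟩

theorem isEquivalence_toLittleDiscs (p q : ℕ) : (toLittleDiscs p q).IsEquivalence where
  isWeakHomotopyEquiv := isWeakHomotopyEquiv_toLittleDiscs
  essSurj := exists_colorEquiv

end LittleCubes

end

theorem mainTheorem9 (p q : ℕ) :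
    (LittleCubes.toSwissCheese p q).IsEquivalence ∧
    (LittleCubes.toLittleDiscs p q).IsEquivalence ∧
    ∀ {I : Type} [Finite I] (x : I → (LittleCubes.swissCheeseOperad p q).Color)
      (y : (LittleCubes.swissCheeseOperad p q).Color),
      LittleCubes.IsWeakHomotopyEquiv (LittleCubes.canonicalMap p q x y) :=
  ⟨LittleCubes.isEquivalence_toSwissCheese p q, LittleCubes.isEquivalence_toLittleDiscs p q,
    fun x y => LittleCubes.isWeakHomotopyEquiv_canonicalMap x y⟩
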